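/- **Definitions (two-handed tile assembly model, 2HAM).** A *glue* is a pair (label, strength) with the label a finite string and the strength in $\mathbb N$; a *tile type* is a choice of one glue on each of the four sides of a unit square (tiles are not rotated). An *assembly* over a tile set $T$ is a partial function $\alpha:\mathbb Z^2\dashrightarrow T$. Adjacent tiles are joined by an edge of the binding graph, weighted by the strength of the glue, if their abutting glues are equal; $\alpha$ is *$\tau$-stable* if every cut of its binding graph into two nonempty parts has weight at least $\tau$. The *supertile* $\tilde\alpha$ of $\alpha$ is the set of all translations of $\alpha$. For supertiles $\tilde\alpha,\tilde\beta$ let $C^\tau_{\tilde\alpha,\tilde\beta}$ be the set of supertiles of all $\tau$-stable unions $\alpha\cup\beta$ with $\alpha\in\tilde\alpha$, $\beta\in\tilde\beta$ disjoint. A *2HAM system* is a triple $\mathcal T=(T,\sigma,\tau)$ with $T$ a finite tile set, $\tau$ the temperature, and $\sigma$ a set of supertiles of nonempty $\tau$-stable assemblies over $T$, each initially present in infinitely many copies; $\|\sigma\|$ is the number of distinct supertiles in $\sigma$. A supertile is *producible* ($\in\mathcal A[\mathcal T]$) if it is the result (union) of a finite or infinite sequence of attachments that starts at an element of $\sigma$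 and at each step attaches a supertile obtained from $\sigma$ by finitely many combinations. Write $\tilde\alpha\to^1_{\mathcal T}\tilde\beta$ if $\tilde\beta\in C^\tau_{\tilde\alpha,\tilde\delta}$ for some producible $\tilde\delta$, $\tilde\alpha\to^{\le1}_{\mathcal T}\tilde\beta$ if $\tilde\alpha=\tilde\beta$ or $\tilde\alpha\to^1_{\mathcal T}\tilde\beta$, and $\tilde\alpha\to_{\mathcal T}\tilde\beta$ if $\tilde\beta$ is the result of a finite or infinite sequence of such attachments that starts at $\tilde\alpha$. For a tile set $U$ let $U_{\mathrm{sup}}$ be the set of its single-tile supertiles. **Simulation.** Let $m\ge1$. An *$m$-block* over $U$ is a partial function $\{0,\dots,m-1\}^2\dashrightarrow U$; for an assembly $\alpha$ over $U$ let $\alpha^m_{x,y}$ be its block with entries $\alpha(mx+i,my+j)$, $0\le i,j<m$. A *representation function* $R$ is a partial function from $m$-blocks over $U$ to $T$; put $R^*(\alpha)(x,y)=R(\alpha^m_{x,y})$, and for a supertile $\tilde\alpha$ let $\tilde R(\tilde\alpha)$ be the set of all nonempty assemblies $R^*(\alpha)$ with $\alpha\in\tilde\alpha$. If it is empty, $\tilde\alpha$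 represents nothing. The system $\mathcal U=(U,S,\tau)$ *simulates* $\mathcal T=(T,\sigma,\tau)$ *at scale $m$* if for some $R$: 1. (equivalent productions) the nonempty sets among $\tilde R(\tilde\alpha)$, $\tilde\alpha\in\mathcal A[\mathcal U]$, are exactly the producible supertiles of $\mathcal T$, and every $\tilde\alpha\in\mathcal A[\mathcal U]$ maps cleanly. That is: either $\tilde R(\tilde\alpha)$ is a supertile over $T$ and, for each $\alpha\in\tilde\alpha$ with $R^*(\alpha)$ nonempty, every nonempty block of $\alpha$ is at, or directly north, east, south or west of, a position occupied in $R^*(\alpha)$ (unless $\alpha$ has at most one nonempty block); or $\tilde R(\tilde\alpha)=\emptyset$ and some $\alpha\in\tilde\alpha$ has at most one nonempty block; 2. ($\mathcal T$ follows $\mathcal U$) if $\tilde\alpha,\tilde\beta\in\mathcal A[\mathcal U]$, $\tilde\alpha\to^1_{\mathcal U}\tilde\beta$ and $\tilde R(\tilde\alpha)\ne\emptyset$, then $\tilde R(\tilde\alpha)\to^{\le1}_{\mathcal T}\tilde R(\tilde\beta)$; 3. ($\mathcal U$ weakly models $\mathcal T$) if $\tilde\alpha,\tilde\beta\in\mathcal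 A[\mathcal T]$ and $\tilde\alpha\to^1_{\mathcal T}\tilde\beta$, then for every $\tilde\alpha'\in\mathcal A[\mathcal U]$ with $\tilde R(\tilde\alpha')=\tilde\alpha$ there are $\tilde\alpha'',\tilde\beta'\in\mathcal A[\mathcal U]$ with $\tilde\alpha'\to_{\mathcal U}\tilde\alpha''\to^1_{\mathcal U}\tilde\beta'$, $\tilde R(\tilde\alpha'')=\tilde\alpha$ and $\tilde R(\tilde\beta')=\tilde\beta$. **Theorem.** There are absolute constants $K,C\in\mathbb N$ and $c\in\mathbb R$ such that for every integer $\tau\ge2$ there is a tile set $U_\tau$ with $|U_\tau|\le K$ with the following property. For every 2HAM system $\mathcal T=(T,\sigma,\tau)$ of temperature $\tau$ there is a set $I_{\mathcal T}$ of at most $C\,(|T|+\|\sigma\|)$ supertiles over $U_\tau$ (all of them finite if all supertiles in $\sigma$ are finite) such that the 2HAM system $\mathcal U_{\mathcal T}=(U_\tau,\;U_{\tau,\mathrm{sup}}\cup I_{\mathcal T},\;\tau)$ simulates $\mathcal T$ at a scale $m\le c\sqrt{\log|T|+\tau}$ (where $\log 0$ is read as $0$). -/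

import Mathlib

open scoped ENNReal

noncomputable section

namespace TwoHAM

/-! ### Tiles and assemblies -/

/-- The four sides of a unit square. -/
inductive Side
  | north
  | east
  | south
  | west

/-- The side that abuts the given one when two unit squares are adjacent. -/
def Side.opposite : Side → Side
  | north => south
  | east => west
  | south => north
  | west => east

/-- The unit vector pointing out of a side. -/
def Side.vec : Side → ℤ × ℤ
  | north => (0, 1)
  | east => (1, 0)
  | south => (0, -1)
  | west => (-1, 0)

/-- A glue: a label (a finite string) and a nonnegative integer strength. -/
structure Glue where
  label : String
  strength : ℕ

/-- A (non-rotatable) tile type: one glue on each of the four sides. -/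
abbrev TileType := Side → Glue

/-- An assembly: a partial placement of tiles on the integer lattice. -/
abbrev Assembly := ℤ × ℤ → Option TileType

namespace Assembly

/-- The set of occupied positions. -/
def dom (α : Assembly) : Set (ℤ × ℤ) := {p | α p ≠ none}

/-- The assembly without tiles. -/
def empty : Assembly := fun _ => none

/-- The assembly consisting of one tile of type `t` at the origin. -/
def single (t : TileType) : Assembly := fun p => if p = 0 then some t else none

/-- All tiles of the assembly have a type in `T`. -/
def Over (α : Assembly) (T : Finset TileType) : Prop := ∀ p t, α p = some t → t ∈ T

/-- The translation `α + u`. -/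
def translate (α : Assembly) (u : ℤ × ℤ) : Assembly := fun p => α (p - u)

/-- The union `α ∪ β` (with priority to `α`; only used for disjoint assemblies). -/
def union (α β : Assembly) : Assembly := fun p => (α p).orElse fun _ => β p

/-- `α` is a subassembly of `β`. -/
def Sub (α β : Assembly) : Prop := ∀ p ∈ α.dom, α p = β p

open Classical in
/-- The strength of the bond between the tile at `p` and the tile on the other side of its side
`d`: the two tiles interact if the glues on their abutting sides are equal, with the strength of
that glue. It is `0` if one of the two positions is unoccupied. -/
def bond (α : Assembly) (p : ℤ × ℤ) (d : Side) : ℕ :=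
  match α p, α (p + d.vec) with
  | some s, some t => if s d = t d.opposite then (s d).strength else 0
  | _, _ => 0

open Classical in
/-- The total weight of the edges of the binding graph between the tiles in `A` and the tiles
outside `A` (each such edge is counted once, at its endpoint in `A`). -/
def cutWeight (α : Assembly) (A : Set (ℤ × ℤ)) : ℝ≥0∞ :=
  ∑' e : (ℤ × ℤ) × Side,
    if e.1 ∈ A ∧ e.1 + e.2.vec ∉ A then (α.bond e.1 e.2 : ℝ≥0∞) else 0

/-- `τ`-stability: every cut of the binding graph into two nonempty parts has weight at
least `τ`. -/
def Stable (τ : ℕ) (α : Assembly) : Prop :=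
  ∀ A : Set (ℤ × ℤ), (α.dom ∩ A).Nonempty → (α.dom \ A).Nonempty → (τ : ℝ≥0∞) ≤ α.cutWeight A

/-- `β` can be attached to `α` in place: the two are disjoint, and their union is `τ`-stable. -/
def CanAttach (τ : ℕ) (α β : Assembly) : Prop :=
  Disjoint α.dom β.dom ∧ Stable τ (α.union β)

end Assembly

/-! ### Supertiles and tile assembly systems -/

/-- A supertile is a set of assemblies, namely the set of all translations of one assembly. -/
abbrev Supertile := Set Assembly

/-- The supertile of an assembly: the set of all its translations. -/
def Assembly.supertile (α : Assembly) : Supertile := {β | ∃ u, β = α.translate u}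

/-- `s` is the supertile of a nonempty `τ`-stable assembly over the tile set `T`. -/
def IsStableSupertile (T : Finset TileType) (τ : ℕ) (s : Supertile) : Prop :=
  ∃ α : Assembly, α.dom.Nonempty ∧ α.Over T ∧ α.Stable τ ∧ s = α.supertile

/-- A supertile with finitely many tiles. -/
def IsFiniteSupertile (s : Supertile) : Prop := ∀ α ∈ s, α.dom.Finite

/-- The single-tile supertiles of a tile set. -/
def tileSupertiles (T : Finset TileType) : Set Supertile :=
  {s | ∃ t ∈ T, s = (Assembly.single t).supertile}

/-- The combination set of two supertiles: all `τ`-stable supertiles obtained by attaching a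
translation of the one to a translation of the other without overlap. -/
def combination (τ : ℕ) (a b : Supertile) : Set Supertile :=
  {g | ∃ α ∈ a, ∃ β ∈ b, α.CanAttach τ β ∧ g = (α.union β).supertile}

/-- A two-handed tile assembly system: a finite tile set, an initial state and a temperature.
The initial state is given as a set of supertiles, each of which is present in infinitely many
copies. -/
structure TAS where
  tiles : Finset TileType
  init : Set Supertile
  temp : ℕ
  init_stable : ∀ s ∈ init, IsStableSupertile tiles temp s

/-- The assemblies `a 0, a 1, …` are obtained one from the other by attaching an assembly whose
supertile satisfies `P`, or by doing nothing. (A finite sequence is one that is eventually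
constant.) -/
def IsAssemblySequence (P : Supertile → Prop) (τ : ℕ) (a : ℕ → Assembly) : Prop :=
  ∀ i, a (i + 1) = a i ∨
    ∃ β : Assembly, P β.supertile ∧ (a i).CanAttach τ β ∧ a (i + 1) = (a i).union β

/-- `α` is the result (the union) of the sequence `a` of assemblies. -/
def IsResult (a : ℕ → Assembly) (α : Assembly) : Prop :=
  α.dom = (⋃ i, (a i).dom) ∧ ∀ i, (a i).Sub α

namespace TAS

/-- The supertiles that occur in the states reachable from the initial state by finitely many
attachments. As all initial supertiles have infinite count, they never run out. -/
inductive Available (𝒯 : TAS) : Supertile → Prop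
  | init {s : Supertile} : s ∈ 𝒯.init → Available 𝒯 s
  | attach {a b g : Supertile} :
      Available 𝒯 a → Available 𝒯 b → g ∈ combination 𝒯.temp a b → Available 𝒯 g

/-- The set of producible supertiles: the results of the finite or infinite assembly sequences
that start at an initial supertile. In particular, producible supertiles may be infinite. -/
def producible (𝒯 : TAS) : Set Supertile :=
  {s | ∃ (a : ℕ → Assembly) (α : Assembly), (a 0).supertile ∈ 𝒯.init ∧
    IsAssemblySequence 𝒯.Available 𝒯.temp a ∧ IsResult a α ∧ s = α.supertile}

/-- One step `a →¹ b`: some producible supertile is attached to `a`, with result `b`. -/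
def Step (𝒯 : TAS) (a b : Supertile) : Prop :=
  ∃ d ∈ 𝒯.producible, b ∈ combination 𝒯.temp a d

/-- At most one step, `a →^{≤1} b`. -/
def StepLE (𝒯 : TAS) (a b : Supertile) : Prop := a = b ∨ 𝒯.Step a b

/-- Growth `a → b`: `b` is the result of a finite or infinite sequence of attachments of
producible supertiles that starts at `a`. -/
def Grows (𝒯 : TAS) (s t : Supertile) : Prop :=
  ∃ (a : ℕ → Assembly) (α : Assembly), s = (a 0).supertile ∧
    IsAssemblySequence (· ∈ 𝒯.producible) 𝒯.temp a ∧ IsResult a α ∧ t = α.supertile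

end TAS

/-! ### Simulation -/

/-- An `m`-block (macrotile): a partial placement of tiles on an `m × m` square. -/
abbrev Block (m : ℕ) := Fin m → Fin m → Option TileType

/-- The block of `α` in row and column `q` of the lattice of `m × m` squares. -/
def Assembly.block (m : ℕ) (α : Assembly) (q : ℤ × ℤ) : Block m :=
  fun i j => α (m * q.1 + (i : ℕ), m * q.2 + (j : ℕ))

/-- The block of `α` at `q` contains a tile. -/
def Assembly.BlockNonempty (m : ℕ) (α : Assembly) (q : ℤ × ℤ) : Prop :=
  ∃ i j, α.block m q i j ≠ none

/-- At most one block of `α` contains a tile. -/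
def Assembly.AtMostOneBlock (m : ℕ) (α : Assembly) : Prop :=
  ∀ q q', α.BlockNonempty m q → α.BlockNonempty m q' → q = q'

/-- An `m`-block representation function: a partial map from `m`-blocks to the tile set `T`. -/
structure Repr (m : ℕ) (T : Finset TileType) where
  toFun : Block m → Option TileType
  mem_tiles : ∀ b t, toFun b = some t → t ∈ T

namespace Repr

variable {m : ℕ} {T : Finset TileType}

/-- The assembly representation function `R*`. -/
def onAssembly (R : Repr m T) (α : Assembly) : Assembly := fun q => R.toFun (α.block m q)

/-- The supertile representation function: all the nonempty readings `R*(α)`, for `α` in the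
supertile `s`. (A translation that does not fit the lattice of `m × m` squares may have an empty
reading.) The supertile `s` represents the supertile `t` if this set is equal to `t`, and it
represents nothing if this set is empty. -/
def onSupertile (R : Repr m T) (s : Supertile) : Set Assembly :=
  {β | β ≠ Assembly.empty ∧ ∃ α ∈ s, β = R.onAssembly α}

/-- `α` maps cleanly to `R*(α)`: every nonempty block of `α` is at or directly north, east, south
or west of a position that is occupied in `R*(α)`, unless `α` has at most one nonempty block. -/
def CleanOn (R : Repr m T) (α : Assembly) : Prop :=
  (∀ q, α.BlockNonempty m q →
    ∃ u v : ℤ, u ^ 2 + v ^ 2 < 2 ∧ q + (u, v) ∈ (R.onAssembly α).dom) ∨ α.AtMostOneBlock m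

/-- The supertile `s` maps cleanly: either it represents a supertile over `T`, and every
assembly in `s` with a nonempty reading maps cleanly to that reading; or it represents nothing,
and it fits into a single block. -/
def Clean (R : Repr m T) (s : Supertile) : Prop :=
  ((∃ β : Assembly, β.dom.Nonempty ∧ β.Over T ∧ R.onSupertile s = β.supertile) ∧
    ∀ α ∈ s, R.onAssembly α ≠ Assembly.empty → R.CleanOn α) ∨
  (R.onSupertile s = ∅ ∧ ∃ α ∈ s, α.AtMostOneBlock m)

end Repr

section Simulation

variable (𝒰 𝒯 : TAS) {m : ℕ} (R : Repr m 𝒯.tiles)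

/-- `𝒰` and `𝒯` have equivalent productions. -/
def EquivalentProductions : Prop :=
  {t | t.Nonempty ∧ ∃ s ∈ 𝒰.producible, t = R.onSupertile s} = 𝒯.producible ∧
    ∀ s ∈ 𝒰.producible, R.Clean s

/-- `𝒯` follows `𝒰`. -/
def Follows : Prop :=
  ∀ a ∈ 𝒰.producible, ∀ b ∈ 𝒰.producible, 𝒰.Step a b → (R.onSupertile a).Nonempty →
    𝒯.StepLE (R.onSupertile a) (R.onSupertile b)

/-- `𝒰` weakly models `𝒯`. -/
def WeaklyModels : Prop :=
  ∀ a ∈ 𝒯.producible, ∀ b ∈ 𝒯.producible, 𝒯.Step a b →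
    ∀ a' ∈ 𝒰.producible, R.onSupertile a' = a →
      ∃ a'' ∈ 𝒰.producible, R.onSupertile a'' = a ∧ 𝒰.Grows a' a'' ∧
        ∃ b' ∈ 𝒰.producible, 𝒰.Step a'' b' ∧ R.onSupertile b' = b

/-- `𝒰` simulates `𝒯` through the `m`-block representation function `R`. -/
def SimulatesVia : Prop :=
  EquivalentProductions 𝒰 𝒯 R ∧ Follows 𝒰 𝒯 R ∧ WeaklyModels 𝒰 𝒯 R

/-- `𝒰` simulates `𝒯` at scale factor `m`. -/
def SimulatesAtScale (𝒰 𝒯 : TAS) (m : ℕ) : Prop :=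
  0 < m ∧ ∃ R : Repr m 𝒯.tiles, SimulatesVia 𝒰 𝒯 R

end Simulation

end TwoHAM

end

/-! ### Assemblies, the links between them, and stability -/

noncomputable section

namespace TwoHAM

/-! ### Sides -/

/-! A tile set of bounded size has no labels for the glues of an arbitrary tile set, so glues are
compared by shape. Each tile type becomes a body: a square core with teeth on its four sides. Bodies
never touch each other directly. The border between two neighboring macrotiles has two ports, and
each port consists of three consecutive locks. Lock 0 joins the lower body to a lower pad, lock 1
the lower pad to an upper pad, lock 2 the upper pad to the upper body. Pads are optional, so
neighbors with different glues simply do without a full set of pads and do not obstruct each other.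

A lock that codes a glue is a rectangle of cells cut into two complementary parts. Rows congruent to
2 modulo 3 belong to the left part, rows congruent to 1 to the right part, and in the other rows the
bits of the code decide. The left part for `A` and the right part for `B` are disjoint only if the
bits of `A` are contained in those of `B`. The codes list every bit together with its complement, so
this forces `A = B` (`Kit.label_eq_of_disjoint`).

Special glues between the two lowest rows of a lock hold its parts together. In locks 0 and 2 there
are two of strength about half of the temperature, enough to mount a pad on a body
(`Kit.mount_link`). In lock 1 each port carries half of the strength of the coded glue, capped at
the temperature and written with glues of strength `√τ` and `1`. Hence all four pads of a border
transmit exactly the capped strength, whereas two loose pads bind too weakly to combine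
(`Kit.link_pad_pad_lt`). All pieces are made of 2 × 2 cells with inner glues of strength at least
half of the temperature; any cut crosses a four-cycle twice, so the pieces are stable although every
single glue is weaker than the temperature. Inner glues are never exposed and a tile has at most one
special glue, so the free single tiles are inert.

A configuration `Kit.render β P` consists of the bodies of the tiles of `β` and a set `P` of mounted
pads. Soundness: a producible assembly of the simulator is a translated configuration of a
producible `β`, a pad, or a tile (`Kit.isForm_of_producible`), and an attachment to a configuration
either mounts a pad or is an attachment to `β` (`Kit.attach_cases`), since configurations bind at
most as strongly as the assemblies they represent (`Kit.link_render_le`). Completeness: if `β'` can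
attach to `β`, finitely many bonds suffice, and mounting the pads of those bonds makes the
configurations attachable (`Kit.exists_pads`, `Kit.le_link_render`). The initial supertiles are
represented by configurations with all pads between their matching neighbors, which are stable
(`Kit.render_fullPads_stable`).

A reading recognizes bodies. One special glue occurs only at one place of a body, which forces
alignment with the block lattice (`Kit.marker_unique`), and the inner glues reveal the shape and so
the tile type (`Kit.body_eq_of_sub`). A square array of about `log |T|` bits and about `√τ` columns
for special glues give the scale. -/

instance : DecidableEq Side := fun a b => by
  cases a <;> cases b <;> first | exact isTrue rfl | exact isFalse (by nofun)

instance : Fintype Side where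
  elems := {Side.north, Side.east, Side.south, Side.west}
  complete := by intro d; cases d <;> simp

@[simp] theorem Side.opposite_opposite (d : Side) : d.opposite.opposite = d := by cases d <;> rfl

@[simp] theorem Side.vec_opposite (d : Side) : d.opposite.vec = -d.vec := by
  cases d <;> simp [Side.opposite, Side.vec]

theorem Side.sum_univ {M : Type*} [AddCommMonoid M] (f : Side → M) :
    ∑ d, f d = f .north + f .east + f .south + f .west := by
  have : (Finset.univ : Finset Side) = {Side.north, Side.east, Side.south, Side.west} := rfl
  rw [this]
  simp [add_assoc]

namespace Assembly

variable {α β γ : Assembly}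

/-! ### Unions, translations and subassemblies -/

theorem mem_dom_iff {p : ℤ × ℤ} : p ∈ α.dom ↔ ∃ t, α p = some t := Option.ne_none_iff_exists'

theorem notMem_dom_iff {p : ℤ × ℤ} : p ∉ α.dom ↔ α p = none := by
  simp [dom]

theorem mem_dom_of_eq {p : ℤ × ℤ} {t : TileType} (h : α p = some t) : p ∈ α.dom :=
  mem_dom_iff.2 ⟨t, h⟩

theorem union_of_mem {p : ℤ × ℤ} (h : p ∈ α.dom) : α.union β p = α p := by
  obtain ⟨t, ht⟩ := mem_dom_iff.1 h
  simp [union, ht]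

theorem union_of_notMem {p : ℤ × ℤ} (h : p ∉ α.dom) : α.union β p = β p := by
  simp [union, notMem_dom_iff.1 h]

theorem dom_union : (α.union β).dom = α.dom ∪ β.dom := by
  ext p
  by_cases h : p ∈ α.dom
  · have := h
    simp only [dom, Set.mem_ofPred_eq, Set.mem_union] at *
    rw [union_of_mem h]; simp [this]
  · have := h
    simp only [dom, Set.mem_ofPred_eq, Set.mem_union] at *
    rw [union_of_notMem h]; simp_all

theorem union_of_mem_right (hd : Disjoint α.dom β.dom) {p : ℤ × ℤ} (h : p ∈ β.dom) :
    α.union β p = β p :=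
  union_of_notMem (Set.disjoint_right.1 hd h)

theorem union_comm (hd : Disjoint α.dom β.dom) : α.union β = β.union α := by
  funext p
  by_cases h : p ∈ α.dom
  · rw [union_of_mem h, union_of_mem_right hd.symm h]
  · rw [union_of_notMem h]
    by_cases h' : p ∈ β.dom
    · rw [union_of_mem h']
    · rw [union_of_notMem h', notMem_dom_iff.1 h, notMem_dom_iff.1 h']

theorem union_assoc : (α.union β).union γ = α.union (β.union γ) := by
  funext p
  simp only [union]
  cases α p <;> rfl

theorem union_eq_some {p : ℤ × ℤ} {t : TileType} (h : α.union β p = some t) :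
    α p = some t ∨ β p = some t := by
  by_cases hp : p ∈ α.dom
  · exact Or.inl (by rw [← h, union_of_mem hp])
  · exact Or.inr (by rw [← h, union_of_notMem hp])

@[simp] theorem translate_apply (u p : ℤ × ℤ) : α.translate u p = α (p - u) := rfl

@[simp] theorem translate_zero : α.translate 0 = α := by
  funext p; simp [translate]

@[simp] theorem translate_translate (u v : ℤ × ℤ) :
    (α.translate u).translate v = α.translate (u + v) := by
  funext p; simp only [translate]; congr 1; abel

theorem mem_dom_translate {u p : ℤ × ℤ} : p ∈ (α.translate u).dom ↔ p - u ∈ α.dom := Iff.rfl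

theorem union_translate (u : ℤ × ℤ) :
    (α.union β).translate u = (α.translate u).union (β.translate u) := rfl

theorem disjoint_translate {u : ℤ × ℤ} :
    Disjoint (α.translate u).dom (β.translate u).dom ↔ Disjoint α.dom β.dom := by
  simp only [Set.disjoint_left, mem_dom_translate]
  refine ⟨fun h p hp => ?_, fun h p hp => h hp⟩
  simpa using @h (p + u) (by simpa using hp)

theorem nonempty_translate {u : ℤ × ℤ} : (α.translate u).dom.Nonempty ↔ α.dom.Nonempty := by
  refine ⟨fun ⟨p, hp⟩ => ⟨p - u, hp⟩, fun ⟨p, hp⟩ => ⟨p + u, ?_⟩⟩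
  rw [mem_dom_translate]; simpa using hp

theorem Sub.refl (α : Assembly) : α.Sub α := fun _ _ => rfl

theorem Sub.dom_subset (h : α.Sub β) : α.dom ⊆ β.dom := fun p hp => by
  have := h p hp
  simp only [dom, Set.mem_ofPred_eq] at *
  rwa [← this]

theorem Sub.apply_eq_some (h : α.Sub β) {p : ℤ × ℤ} {t : TileType} (hp : α p = some t) :
    β p = some t := by rw [← h p (mem_dom_of_eq hp), hp]

theorem sub_iff : α.Sub β ↔ ∀ p t, α p = some t → β p = some t :=
  ⟨fun h _ _ hp => h.apply_eq_some hp, fun h p hp => by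
    obtain ⟨t, ht⟩ := mem_dom_iff.1 hp
    rw [ht, h p t ht]⟩

theorem Sub.trans (h : α.Sub β) (h' : β.Sub γ) : α.Sub γ :=
  sub_iff.2 fun _ _ hp => h'.apply_eq_some (h.apply_eq_some hp)

theorem sub_union_left : α.Sub (α.union β) := fun _ hp => (union_of_mem hp).symm

theorem sub_union_right (hd : Disjoint α.dom β.dom) : β.Sub (α.union β) :=
  fun _ hp => (union_of_mem_right hd hp).symm

theorem union_sub (h : α.Sub γ) (h' : β.Sub γ) : (α.union β).Sub γ :=
  sub_iff.2 fun _ _ hp => (union_eq_some hp).elim h.apply_eq_some h'.apply_eq_some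

theorem Sub.translate (h : α.Sub β) (u : ℤ × ℤ) : (α.translate u).Sub (β.translate u) :=
  fun p hp => h (p - u) hp

theorem eq_of_sub_of_dom_subset (h : α.Sub β) (h' : β.dom ⊆ α.dom) : α = β := by
  funext p
  by_cases hp : p ∈ α.dom
  · exact h p hp
  · rw [notMem_dom_iff.1 hp, notMem_dom_iff.1 fun hq => hp (h' hq)]

theorem ext_some (h : ∀ p t, α p = some t ↔ β p = some t) : α = β :=
  funext fun p => Option.ext (h p)

theorem Over.translate {T : Finset TileType} (h : α.Over T) (u : ℤ × ℤ) :
    (α.translate u).Over T := fun p => h (p - u)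

theorem Over.union {T : Finset TileType} (h : α.Over T) (h' : β.Over T) : (α.union β).Over T :=
  fun p t ht => (union_eq_some ht).elim (h p t) (h' p t)

/-! ### Supertiles -/

theorem mem_supertile_self (α : Assembly) : α ∈ α.supertile := ⟨0, by simp⟩

theorem translate_mem_supertile (α : Assembly) (u : ℤ × ℤ) : α.translate u ∈ α.supertile :=
  ⟨u, rfl⟩

@[simp] theorem supertile_translate (u : ℤ × ℤ) : (α.translate u).supertile = α.supertile := by
  ext β
  constructor
  · rintro ⟨v, rfl⟩; exact ⟨u + v, by simp⟩
  · rintro ⟨v, rfl⟩; exact ⟨v - u, by simp⟩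

theorem supertile_eq_of_mem (h : β ∈ α.supertile) : β.supertile = α.supertile := by
  obtain ⟨u, rfl⟩ := h; simp

theorem exists_translate_of_supertile_eq (h : α.supertile = β.supertile) :
    ∃ u, α = β.translate u := by
  have := mem_supertile_self α; rwa [h] at this

/-! ### Links -/

open Classical in
/-- The strength with which two possibly present tiles bind, the second on side `d` of the
first. -/
def pairBond (s t : Option TileType) (d : Side) : ℕ :=
  match s, t with
  | some s, some t => if s d = t d.opposite then (s d).strength else 0
  | _, _ => 0

theorem bond_eq (p : ℤ × ℤ) (d : Side) : α.bond p d = pairBond (α p) (α (p + d.vec)) d := rfl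

@[simp] theorem pairBond_none_left (t : Option TileType) (d : Side) : pairBond none t d = 0 := by
  cases t <;> rfl

@[simp] theorem pairBond_none_right (t : Option TileType) (d : Side) : pairBond t none d = 0 := by
  cases t <;> rfl

open Classical in
theorem pairBond_some (s t : TileType) (d : Side) :
    pairBond (some s) (some t) d = if s d = t d.opposite then (s d).strength else 0 := rfl

theorem pairBond_ne_zero {s t : Option TileType} {d : Side} (h : pairBond s t d ≠ 0) :
    ∃ s' t', s = some s' ∧ t = some t' ∧ s' d = t' d.opposite ∧
      pairBond s t d = (s' d).strength := by
  rcases s with _ | s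
  · simp at h
  rcases t with _ | t
  · simp at h
  rw [pairBond_some] at h ⊢
  split_ifs at h with h'
  · exact ⟨s, t, rfl, rfl, h', if_pos h'⟩
  · exact absurd rfl h

theorem pairBond_comm (s t : Option TileType) (d : Side) :
    pairBond s t d = pairBond t s d.opposite := by
  rcases s with _ | s <;> rcases t with _ | t <;> simp [pairBond_some]
  by_cases h : s d = t d.opposite
  · simp [h]
  · simp [h, Ne.symm h]

/-- The total strength of the bonds between tiles of `α` and the tiles of `β` on side `d` of
them. -/
def halfLink (α β : Assembly) (d : Side) : ℝ≥0∞ :=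
  ∑' p : ℤ × ℤ, (pairBond (α p) (β (p + d.vec)) d : ℝ≥0∞)

/-- The total strength of the bonds between tiles of `α` and tiles of `β`. -/
def link (α β : Assembly) : ℝ≥0∞ :=
  ∑' e : (ℤ × ℤ) × Side, (pairBond (α e.1) (β (e.1 + e.2.vec)) e.2 : ℝ≥0∞)

theorem halfLink_opposite (α β : Assembly) (d : Side) :
    halfLink α β d.opposite = halfLink β α d := by
  unfold halfLink
  rw [← (Equiv.addRight d.vec).tsum_eq]
  refine tsum_congr fun p => ?_
  rw [pairBond_comm]
  simp

/-- The southern and western bonds of `α` are the northern and eastern bonds of `β`. Two directions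
therefore suffice in all later estimates, at the price of exchanging the two assemblies. -/
theorem link_eq (α β : Assembly) :
    link α β = (halfLink α β .north + halfLink β α .north) +
      (halfLink α β .east + halfLink β α .east) := by
  have h1 : link α β = ∑ d, halfLink α β d := by
    unfold link halfLink
    rw [ENNReal.tsum_prod', ENNReal.tsum_comm, tsum_fintype]
  have hs : halfLink α β .south = halfLink β α .north := halfLink_opposite α β .north
  have hw : halfLink α β .west = halfLink β α .east := halfLink_opposite α β .east
  rw [h1, Side.sum_univ, hs, hw]
  ring

theorem link_comm (α β : Assembly) : link α β = link β α := by
  rw [link_eq, link_eq]; ring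

theorem pairBond_mono {s t s' t' : Option TileType} {d : Side}
    (hs : ∀ x, s = some x → s' = some x) (ht : ∀ x, t = some x → t' = some x) :
    pairBond s t d ≤ pairBond s' t' d := by
  rcases s with _ | s
  · simp
  rcases t with _ | t
  · simp
  rw [hs s rfl, ht t rfl]

theorem link_mono {α' β' : Assembly} (hα : α.Sub α') (hβ : β.Sub β') :
    link α β ≤ link α' β' :=
  ENNReal.tsum_le_tsum fun _ => Nat.cast_le.2 <|
    pairBond_mono (fun _ => hα.apply_eq_some) fun _ => hβ.apply_eq_some

theorem cutWeight_mono (h : α.Sub β) (A : Set (ℤ × ℤ)) : α.cutWeight A ≤ β.cutWeight A := by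
  refine ENNReal.tsum_le_tsum fun e => ?_
  split_ifs
  · exact Nat.cast_le.2 <| pairBond_mono (fun _ => h.apply_eq_some) fun _ => h.apply_eq_some
  · exact le_rfl

open Classical in
/-- The restriction of an assembly to a set of positions. -/
def restrict (α : Assembly) (A : Set (ℤ × ℤ)) : Assembly := fun p => if p ∈ A then α p else none

theorem restrict_of_mem {A : Set (ℤ × ℤ)} {p : ℤ × ℤ} (h : p ∈ A) : α.restrict A p = α p :=
  if_pos h

theorem restrict_of_notMem {A : Set (ℤ × ℤ)} {p : ℤ × ℤ} (h : p ∉ A) : α.restrict A p = none :=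
  if_neg h

theorem restrict_eq_some {A : Set (ℤ × ℤ)} {p : ℤ × ℤ} {t : TileType} :
    α.restrict A p = some t ↔ p ∈ A ∧ α p = some t := by
  by_cases h : p ∈ A
  · simp [restrict_of_mem h, h]
  · simp [restrict_of_notMem h, h]

theorem restrict_sub (A : Set (ℤ × ℤ)) : (α.restrict A).Sub α :=
  sub_iff.2 fun _ _ h => (restrict_eq_some.1 h).2

theorem cutWeight_eq_link (A : Set (ℤ × ℤ)) :
    α.cutWeight A = link (α.restrict A) (α.restrict Aᶜ) := by
  refine tsum_congr fun e => ?_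
  by_cases h1 : e.1 ∈ A
  · by_cases h2 : e.1 + e.2.vec ∈ A
    · simp [h1, h2, restrict_of_notMem (α := α) (A := Aᶜ) (p := e.1 + e.2.vec) (by simpa using h2)]
    · rw [if_pos ⟨h1, h2⟩, restrict_of_mem h1, restrict_of_mem h2]; rfl
  · simp [h1, restrict_of_notMem h1]

theorem restrict_union_left (A : Set (ℤ × ℤ)) (hα : α.dom ⊆ A) (hβ : Disjoint β.dom A) :
    (α.union β).restrict A = α := by
  refine ext_some fun p t => ?_
  rw [restrict_eq_some]
  constructor
  · rintro ⟨hA, h⟩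
    exact (union_eq_some h).resolve_right fun h' => Set.disjoint_left.1 hβ (mem_dom_of_eq h') hA
  · intro h
    exact ⟨hα (mem_dom_of_eq h), sub_union_left.apply_eq_some h⟩

theorem cutWeight_union (A : Set (ℤ × ℤ)) (hα : α.dom ⊆ A) (hβ : Disjoint β.dom A) :
    (α.union β).cutWeight A = link α β := by
  have hd : Disjoint α.dom β.dom := (hβ.mono_right hα).symm
  rw [cutWeight_eq_link, restrict_union_left A hα hβ, union_comm hd, restrict_union_left]
  · exact fun p hp => Set.disjoint_left.1 hβ hp
  · exact disjoint_compl_right.mono_left hα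

/-! ### Stability -/

/-- The positions `p` and `q` are not separated by any cut of weight less than `τ`. -/
def Tied (τ : ℕ) (α : Assembly) (p q : ℤ × ℤ) : Prop :=
  ∀ A : Set (ℤ × ℤ), ¬ (p ∈ A ↔ q ∈ A) → (τ : ℝ≥0∞) ≤ α.cutWeight A

theorem Tied.refl {τ : ℕ} (p : ℤ × ℤ) : Tied τ α p p := fun _ h => absurd Iff.rfl h

theorem Tied.symm {τ : ℕ} {p q : ℤ × ℤ} (h : Tied τ α p q) : Tied τ α q p :=
  fun A hA => h A fun h' => hA h'.symm

theorem Tied.trans {τ : ℕ} {p q r : ℤ × ℤ} (h : Tied τ α p q) (h' : Tied τ α q r) :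
    Tied τ α p r := fun A hA => by
  by_cases hpq : p ∈ A ↔ q ∈ A
  · exact h' A fun hqr => hA (hpq.trans hqr)
  · exact h A hpq

theorem Tied.mono {τ : ℕ} {p q : ℤ × ℤ} (h : Tied τ α p q) (hs : α.Sub β) : Tied τ β p q :=
  fun A hA => (h A hA).trans (cutWeight_mono hs A)

theorem stable_of_tied {τ : ℕ} (o : ℤ × ℤ) (h : ∀ p ∈ α.dom, Tied τ α p o) : α.Stable τ := by
  rintro A ⟨p, hp, hpA⟩ ⟨q, hq, hqA⟩
  exact ((h p hp).trans (h q hq).symm) A fun h' => hqA (h'.1 hpA)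

theorem Stable.tied {τ : ℕ} (h : α.Stable τ) {p q : ℤ × ℤ} (hp : p ∈ α.dom) (hq : q ∈ α.dom) :
    Tied τ α p q := by
  intro A hA
  by_cases hpA : p ∈ A
  · have hqA : q ∉ A := fun h' => hA (iff_of_true hpA h')
    exact h A ⟨p, hp, hpA⟩ ⟨q, hq, hqA⟩
  · have hqA : q ∈ A := by
      by_contra h'; exact hA (iff_of_false hpA h')
    exact h A ⟨q, hq, hqA⟩ ⟨p, hp, hpA⟩

/-- A cut that splits one of the two parts is heavy by the stability of that part. Any other cut
separates the parts from each other, and its weight is their link. -/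
theorem stable_union {τ : ℕ} (hα : α.Stable τ) (hβ : β.Stable τ) (hd : Disjoint α.dom β.dom)
    (h : (τ : ℝ≥0∞) ≤ link α β) : (α.union β).Stable τ := by
  intro A h1 h2
  by_cases ha : (α.dom ∩ A).Nonempty ∧ (α.dom \ A).Nonempty
  · exact (hα A ha.1 ha.2).trans (cutWeight_mono sub_union_left A)
  by_cases hb : (β.dom ∩ A).Nonempty ∧ (β.dom \ A).Nonempty
  · exact (hβ A hb.1 hb.2).trans (cutWeight_mono (sub_union_right hd) A)
  rw [dom_union] at h1 h2
  simp only [Set.Nonempty, Set.mem_inter_iff, Set.mem_sdiff, Set.mem_union, not_and, not_exists,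
    not_not] at ha hb h1 h2
  obtain ⟨p, hp, hpA⟩ := h1
  obtain ⟨q, hq, hqA⟩ := h2
  rcases hp with hp | hp
  · have hαA : α.dom ⊆ A := fun r hr => ha ⟨p, hp, hpA⟩ r hr
    have hβA : Disjoint β.dom A := by
      rw [Set.disjoint_left]
      intro r hr hrA
      rcases hq with hq | hq
      · exact hqA (hαA hq)
      · exact hqA (hb ⟨r, hr, hrA⟩ q hq)
    rwa [cutWeight_union A hαA hβA]
  · have hβA : β.dom ⊆ A := fun r hr => hb ⟨p, hp, hpA⟩ r hr
    have hαA : Disjoint α.dom A := by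
      rw [Set.disjoint_left]
      intro r hr hrA
      rcases hq with hq | hq
      · exact hqA (ha ⟨r, hr, hrA⟩ q hq)
      · exact hqA (hβA hq)
    rwa [union_comm hd, cutWeight_union A hβA hαA, link_comm]

theorem CanAttach.link_le {τ : ℕ} (h : α.CanAttach τ β) (hα : α.dom.Nonempty)
    (hβ : β.dom.Nonempty) : (τ : ℝ≥0∞) ≤ link α β := by
  have := h.2 α.dom (by
    obtain ⟨p, hp⟩ := hα
    exact ⟨p, by rw [dom_union]; exact Or.inl hp, hp⟩) (by
    obtain ⟨p, hp⟩ := hβ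
    exact ⟨p, by rw [dom_union]; exact Or.inr hp, Set.disjoint_right.1 h.1 hp⟩)
  rwa [cutWeight_union _ subset_rfl h.1.symm] at this

theorem canAttach_of_link {τ : ℕ} (hα : α.Stable τ) (hβ : β.Stable τ)
    (hd : Disjoint α.dom β.dom) (h : (τ : ℝ≥0∞) ≤ link α β) : α.CanAttach τ β :=
  ⟨hd, stable_union hα hβ hd h⟩

theorem CanAttach.symm {τ : ℕ} (h : α.CanAttach τ β) : β.CanAttach τ α :=
  ⟨h.1.symm, by rw [← union_comm h.1]; exact h.2⟩

theorem link_translate (u : ℤ × ℤ) : link (α.translate u) (β.translate u) = link α β := by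
  unfold link
  rw [← (Equiv.prodCongr (Equiv.addRight u) (Equiv.refl Side)).tsum_eq]
  refine tsum_congr fun e => ?_
  simp [add_sub_right_comm]

theorem cutWeight_translate (u : ℤ × ℤ) (A : Set (ℤ × ℤ)) :
    (α.translate u).cutWeight A = α.cutWeight ((· + u) ⁻¹' A) := by
  have h (A : Set (ℤ × ℤ)) :
      (α.translate u).restrict A = (α.restrict ((· + u) ⁻¹' A)).translate u := by
    refine ext_some fun p t => ?_
    simp [restrict_eq_some]
  rw [cutWeight_eq_link, cutWeight_eq_link, h, h, link_translate]
  rfl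

theorem Stable.translate {τ : ℕ} (h : α.Stable τ) (u : ℤ × ℤ) : (α.translate u).Stable τ := by
  rintro A ⟨p, hp, hpA⟩ ⟨q, hq, hqA⟩
  rw [cutWeight_translate]
  exact h _ ⟨p - u, hp, by simpa using hpA⟩ ⟨q - u, hq, by simpa using hqA⟩

theorem CanAttach.translate {τ : ℕ} (h : α.CanAttach τ β) (u : ℤ × ℤ) :
    (α.translate u).CanAttach τ (β.translate u) :=
  ⟨disjoint_translate.2 h.1, by rw [← union_translate]; exact h.2.translate u⟩

theorem single_stable (τ : ℕ) (t : TileType) : (single t).Stable τ := by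
  rintro A ⟨p, hp, hpA⟩ ⟨q, hq, hqA⟩
  have h : ∀ p ∈ (single t).dom, p = 0 := by
    intro p hp
    by_contra h
    exact hp (if_neg h)
  rw [h p hp] at hpA
  rw [h q hq] at hqA
  exact absurd hpA hqA

end Assembly

end TwoHAM

end

/-! ### Attachment sequences and producible assemblies -/

noncomputable section

namespace TwoHAM

open Assembly Relation

/-! ### Sequences of attachments -/

/-- There is a path of `n` steps of the relation `r` from `x` to `y`. -/
def HasPath {X : Type*} (r : X → X → Prop) : ℕ → X → X → Prop
  | 0, x, y => x = y
  | n + 1, x, y => ∃ z, r x z ∧ HasPath r n z y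

theorem HasPath.reflTransGen {X : Type*} {r : X → X → Prop} {n : ℕ} {x y : X}
    (h : HasPath r n x y) : ReflTransGen r x y := by
  induction n generalizing x with
  | zero => exact h ▸ ReflTransGen.refl
  | succ n ih =>
    obtain ⟨z, hz, h⟩ := h
    exact ReflTransGen.head hz (ih h)

theorem exists_hasPath {X : Type*} {r : X → X → Prop} {x y : X} (h : ReflTransGen r x y) :
    ∃ n, HasPath r n x y := by
  induction h using ReflTransGen.head_induction_on with
  | refl => exact ⟨0, rfl⟩
  | head h _ ih =>
    obtain ⟨n, hn⟩ := ih
    exact ⟨n + 1, _, h, hn⟩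

/-- A sequence whose successive members are joined by finite paths can be refined to a sequence
whose successive members are joined by at most one step. -/
theorem exists_refined_seq {X : Type*} {r : X → X → Prop} (x : ℕ → X)
    (h : ∀ i, ReflTransGen r (x i) (x (i + 1))) :
    ∃ a : ℕ → X, a 0 = x 0 ∧ (∀ i, a (i + 1) = a i ∨ r (a i) (a (i + 1))) ∧
      (∀ i, ∃ j, a j = x i) ∧ ∀ j, ∃ i, ReflTransGen r (a j) (x i) := by
  -- A state holds the current point, the index of the member aimed at, and the number of steps
  -- left. When no step is left, the state idles once and takes up a path to the next member.
  let S := {s : X × ℕ × ℕ // HasPath r s.2.2 s.1 (x s.2.1)}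
  choose len hlen using fun i => exists_hasPath (h i)
  have next (s : S) : ∃ s' : S, (s'.1.1 = s.1.1 ∨ r s.1.1 s'.1.1) ∧
      (s.1.2.2 = 0 → s'.1.2.1 = s.1.2.1 + 1) ∧
      (∀ n, s.1.2.2 = n + 1 → s'.1.2.1 = s.1.2.1 ∧ s'.1.2.2 = n) := by
    obtain ⟨⟨y, i, n⟩, hp⟩ := s
    cases n with
    | zero =>
      refine ⟨⟨⟨y, i + 1, len i⟩, ?_⟩, Or.inl rfl, fun _ => rfl, fun n hn => absurd hn (by simp)⟩
      have hy : y = x i := hp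
      rw [hy]
      exact hlen i
    | succ n =>
      obtain ⟨z, hz, hp⟩ := hp
      refine ⟨⟨⟨z, i, n⟩, hp⟩, Or.inr hz, fun h => absurd h (by simp), fun n' hn => ?_⟩
      exact ⟨rfl, by simpa using hn⟩
  choose f hf1 hf2 hf3 using next
  let s0 : S := ⟨⟨x 0, 0, 0⟩, rfl⟩
  let st : ℕ → S := fun j => f^[j] s0
  have hst (j : ℕ) : st (j + 1) = f (st j) := Function.iterate_succ_apply' f j s0
  have down (n j : ℕ) (hn : (st j).1.2.2 = n) :
      ∃ j', (st j').1.2.1 = (st j).1.2.1 ∧ (st j').1.2.2 = 0 := by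
    induction n generalizing j with
    | zero => exact ⟨j, rfl, hn⟩
    | succ n ih =>
      obtain ⟨h1, h2⟩ := hf3 (st j) n hn
      rw [← hst] at h1 h2
      obtain ⟨j', h3, h4⟩ := ih (j + 1) h2
      exact ⟨j', h3.trans h1, h4⟩
  have reach (i : ℕ) : ∃ j, (st j).1.2.1 = i ∧ (st j).1.2.2 = 0 := by
    induction i with
    | zero => exact ⟨0, rfl, rfl⟩
    | succ i ih =>
      obtain ⟨j, h1, h2⟩ := ih
      obtain ⟨j', h3, h4⟩ := down _ (j + 1) rfl
      refine ⟨j', ?_, h4⟩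
      rw [h3, hst, hf2 _ h2, h1]
  refine ⟨fun j => (st j).1.1, rfl, fun j => ?_, fun i => ?_, fun j => ?_⟩
  · simp only [hst]
    exact hf1 (st j)
  · obtain ⟨j, h1, h2⟩ := reach i
    refine ⟨j, ?_⟩
    have := (st j).2
    rw [h2, h1] at this
    exact this
  · exact ⟨_, (st j).2.reflTransGen⟩

theorem exists_dependent_seq {X : Type*} (good : ℕ → X → Prop) (step : ℕ → X → X → Prop) (x₀ : X)
    (h₀ : good 0 x₀) (h : ∀ i x, good i x → ∃ y, good (i + 1) y ∧ step i x y) :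
    ∃ f : ℕ → X, f 0 = x₀ ∧ (∀ i, good i (f i)) ∧ ∀ i, step i (f i) (f (i + 1)) := by
  choose! g hg1 hg2 using h
  let f : ℕ → X := fun n => Nat.rec x₀ (fun i x => g i x) n
  have hf (i : ℕ) : good i (f i) := by
    induction i with
    | zero => exact h₀
    | succ i ih => exact hg1 i _ ih
  exact ⟨f, rfl, hf, fun i => hg2 i _ (hf i)⟩

theorem IsResult.sub {a : ℕ → Assembly} {α β : Assembly} (h : IsResult a α)
    (hβ : ∀ i, (a i).Sub β) : α.Sub β := by
  intro p hp
  rw [h.1, Set.mem_iUnion] at hp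
  obtain ⟨i, hi⟩ := hp
  rw [← h.2 i p hi, hβ i p hi]

theorem IsResult.unique {a : ℕ → Assembly} {α β : Assembly} (h : IsResult a α)
    (h' : IsResult a β) : α = β :=
  eq_of_sub_of_dom_subset (h.sub h'.2) (h'.sub h.2).dom_subset

theorem IsResult.exists_stage {a : ℕ → Assembly} {α : Assembly} (h : IsResult a α)
    (hm : ∀ i j, i ≤ j → (a i).Sub (a j)) {p : ℤ × ℤ} {t : TileType} (hp : α p = some t) :
    ∃ i, ∀ j, i ≤ j → a j p = some t := by
  have hp' := mem_dom_of_eq hp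
  rw [h.1, Set.mem_iUnion] at hp'
  obtain ⟨i, hi⟩ := hp'
  refine ⟨i, fun j hj => (hm i j hj).apply_eq_some ?_⟩
  rw [h.2 i p hi, hp]

theorem isResult_of_refinement {a b : ℕ → Assembly} {α : Assembly} (h : IsResult a α)
    (h1 : ∀ i, ∃ j, b j = a i) (h2 : ∀ j, ∃ i, (b j).Sub (a i)) : IsResult b α := by
  have h3 : ∀ j, (b j).Sub α := fun j => by
    obtain ⟨i, hi⟩ := h2 j
    exact hi.trans (h.2 i)
  refine ⟨subset_antisymm ?_ ?_, h3⟩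
  · rw [h.1]
    refine Set.iUnion_subset fun i => ?_
    obtain ⟨j, hj⟩ := h1 i
    rw [← hj]
    exact Set.subset_iUnion (fun j => (b j).dom) j
  · exact Set.iUnion_subset fun j => (h3 j).dom_subset

theorem isResult_const_of_le {a : ℕ → Assembly} {α : Assembly} (h : ∀ i, (a i).Sub α)
    (h' : ∃ i, a i = α) : IsResult a α := by
  refine ⟨subset_antisymm ?_ (Set.iUnion_subset fun i => (h i).dom_subset), h⟩
  obtain ⟨i, rfl⟩ := h'
  exact Set.subset_iUnion (fun j => (a j).dom) i

/-- The assembly `α` is nonempty, over `T` and `τ`-stable. -/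
structure IsStableAssembly (T : Finset TileType) (τ : ℕ) (α : Assembly) : Prop where
  nonempty : α.dom.Nonempty
  overT : α.Over T
  stable : α.Stable τ

theorem IsStableAssembly.translate {T : Finset TileType} {τ : ℕ} {α : Assembly}
    (h : IsStableAssembly T τ α) (u : ℤ × ℤ) : IsStableAssembly T τ (α.translate u) :=
  ⟨nonempty_translate.2 h.nonempty, h.overT.translate u, h.stable.translate u⟩

theorem IsStableAssembly.isStableSupertile {T : Finset TileType} {τ : ℕ} {α : Assembly}
    (h : IsStableAssembly T τ α) : IsStableSupertile T τ α.supertile :=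
  ⟨α, h.nonempty, h.overT, h.stable, rfl⟩

theorem IsStableSupertile.isStableAssembly {T : Finset TileType} {τ : ℕ} {s : Supertile}
    (h : IsStableSupertile T τ s) {α : Assembly} (hα : α ∈ s) : IsStableAssembly T τ α := by
  obtain ⟨β, h1, h2, h3, rfl⟩ := h
  obtain ⟨u, rfl⟩ := hα
  exact IsStableAssembly.translate ⟨h1, h2, h3⟩ u

theorem IsStableSupertile.eq_supertile {T : Finset TileType} {τ : ℕ} {s : Supertile}
    (h : IsStableSupertile T τ s) {α : Assembly} (hα : α ∈ s) : s = α.supertile := by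
  obtain ⟨β, h1, h2, h3, rfl⟩ := h
  exact (supertile_eq_of_mem hα).symm

theorem IsStableAssembly.union {T : Finset TileType} {τ : ℕ} {α β : Assembly}
    (hα : IsStableAssembly T τ α) (hβ : IsStableAssembly T τ β) (h : α.CanAttach τ β) :
    IsStableAssembly T τ (α.union β) :=
  ⟨by rw [dom_union]; exact hα.nonempty.inl, hα.overT.union hβ.overT, h.2⟩

/-- Finitely many bonds already reach the temperature. This is what reduces attachments of infinite
assemblies to finite stages and to finitely many pads. -/
theorem exists_finset_le_sum {X : Type*} (f : X → ℕ) {n : ℕ}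
    (h : (n : ℝ≥0∞) ≤ ∑' e, (f e : ℝ≥0∞)) : ∃ F : Finset X, n ≤ ∑ e ∈ F, f e := by
  by_contra! hF
  have h0 : 0 < n := by simpa using hF ∅
  have : ∑' e, (f e : ℝ≥0∞) ≤ ((n - 1 : ℕ) : ℝ≥0∞) := by
    rw [ENNReal.tsum_eq_iSup_sum]
    refine iSup_le fun F => ?_
    rw [← Nat.cast_sum]
    exact Nat.cast_le.2 (by have := hF F; omega)
  have := Nat.cast_le.1 (h.trans this)
  omega

namespace TAS

variable {𝒯 : TAS} {α β δ : Assembly}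

theorem Available.isStableSupertile {s : Supertile} (h : 𝒯.Available s) :
    IsStableSupertile 𝒯.tiles 𝒯.temp s := by
  induction h with
  | init h => exact 𝒯.init_stable _ h
  | attach _ _ hg iha ihb =>
    obtain ⟨α, hα, β, hβ, h, rfl⟩ := hg
    exact ((iha.isStableAssembly hα).union (ihb.isStableAssembly hβ) h).isStableSupertile

theorem Available.isStableAssembly (h : 𝒯.Available α.supertile) :
    IsStableAssembly 𝒯.tiles 𝒯.temp α :=
  h.isStableSupertile.isStableAssembly (mem_supertile_self α)

theorem Available.union (hα : 𝒯.Available α.supertile) (hβ : 𝒯.Available β.supertile)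
    (h : α.CanAttach 𝒯.temp β) : 𝒯.Available (α.union β).supertile :=
  hα.attach hβ ⟨α, mem_supertile_self α, β, mem_supertile_self β, h, rfl⟩

/-- `α'` is obtained from `α` by attaching in place an assembly whose supertile satisfies `P`. -/
def AttachStep (𝒯 : TAS) (P : Supertile → Prop) (α α' : Assembly) : Prop :=
  ∃ β : Assembly, P β.supertile ∧ α.CanAttach 𝒯.temp β ∧ α' = α.union β

theorem AttachStep.sub {P : Supertile → Prop} (h : 𝒯.AttachStep P α β) : α.Sub β := by
  obtain ⟨γ, -, -, rfl⟩ := h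
  exact sub_union_left

theorem sub_of_reflTransGen {P : Supertile → Prop} (h : ReflTransGen (𝒯.AttachStep P) α β) :
    α.Sub β := by
  induction h with
  | refl => exact Sub.refl _
  | tail _ h ih => exact ih.trans h.sub

theorem AttachStep.translate {P : Supertile → Prop} (h : 𝒯.AttachStep P α β) (u : ℤ × ℤ) :
    𝒯.AttachStep P (α.translate u) (β.translate u) := by
  obtain ⟨γ, h1, h2, rfl⟩ := h
  exact ⟨γ.translate u, by simpa using h1, h2.translate u, rfl⟩

theorem Available.of_attachStep (h : 𝒯.Available α.supertile)
    (hs : 𝒯.AttachStep 𝒯.Available α β) : 𝒯.Available β.supertile := by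
  obtain ⟨γ, h1, h2, rfl⟩ := hs
  exact h.union h1 h2

theorem Available.of_reflTransGen (h : 𝒯.Available α.supertile)
    (hs : ReflTransGen (𝒯.AttachStep 𝒯.Available) α β) : 𝒯.Available β.supertile := by
  induction hs with
  | refl => exact h
  | tail _ h ih => exact ih.of_attachStep h

/-- The tree of combinations becomes a linear sequence by following its left branch; the right
subtrees are the attached assemblies. -/
theorem Available.exists_init {s : Supertile} (h : 𝒯.Available s) (hα : α ∈ s) :
    ∃ α₀ : Assembly, α₀.supertile ∈ 𝒯.init ∧
      ReflTransGen (𝒯.AttachStep 𝒯.Available) α₀ α := by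
  induction h generalizing α with
  | init h =>
    refine ⟨α, ?_, ReflTransGen.refl⟩
    rwa [← (𝒯.init_stable _ h).eq_supertile hα]
  | attach ha hb hg iha _ =>
    obtain ⟨γ, hγ, δ, hδ, h, rfl⟩ := hg
    obtain ⟨u, rfl⟩ := hα
    have hγu : γ.translate u ∈ γ.supertile := translate_mem_supertile γ u
    rw [← ha.isStableSupertile.eq_supertile hγ] at hγu
    obtain ⟨α₀, h0, h1⟩ := iha hγu
    refine ⟨α₀, h0, h1.tail (AttachStep.translate ⟨δ, ?_, h, rfl⟩ u)⟩
    rwa [← hb.isStableSupertile.eq_supertile hδ]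

/-- The sequences constructed below take several attachments per stage and start at an available
assembly. Refining the stages and prepending a route from an initial supertile gives a sequence as
the definition demands. -/
theorem producible_of_chain (X : ℕ → Assembly) (h0 : 𝒯.Available (X 0).supertile)
    (h : ∀ i, ReflTransGen (𝒯.AttachStep 𝒯.Available) (X i) (X (i + 1)))
    (hr : IsResult X α) : α.supertile ∈ 𝒯.producible := by
  obtain ⟨α₀, hi, h1⟩ := h0.exists_init (mem_supertile_self _)
  let Y : ℕ → Assembly := fun i => Nat.casesOn i α₀ X
  have hY : ∀ i, ReflTransGen (𝒯.AttachStep 𝒯.Available) (Y i) (Y (i + 1)) := by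
    intro i
    cases i with
    | zero => exact h1
    | succ i => exact h i
  have hYr : IsResult Y α := isResult_of_refinement hr (fun i => ⟨i + 1, rfl⟩) (fun j => by
    cases j with
    | zero => exact ⟨0, sub_of_reflTransGen h1⟩
    | succ j => exact ⟨j, Sub.refl _⟩)
  obtain ⟨a, ha0, ha1, ha2, ha3⟩ := exists_refined_seq Y hY
  refine ⟨a, α, by rw [ha0]; exact hi, ha1, ?_, rfl⟩
  refine isResult_of_refinement hYr ha2 fun j => ?_
  obtain ⟨i, hi⟩ := ha3 j
  exact ⟨i, sub_of_reflTransGen hi⟩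

theorem Available.producible {s : Supertile} (h : 𝒯.Available s) : s ∈ 𝒯.producible := by
  obtain ⟨α, h1, h2, h3, rfl⟩ := h.isStableSupertile
  exact producible_of_chain (fun _ => α) h (fun _ => ReflTransGen.refl)
    (isResult_const_of_le (fun _ => Sub.refl _) ⟨0, rfl⟩)

theorem _root_.TwoHAM.IsResult.translate {a : ℕ → Assembly} (h : IsResult a α) (u : ℤ × ℤ) :
    IsResult (fun i => (a i).translate u) (α.translate u) := by
  refine ⟨?_, fun i => (h.2 i).translate u⟩
  ext p
  rw [mem_dom_translate, h.1]
  simp [mem_dom_translate]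

/-- An assembly sequence of producible assemblies. -/
theorem exists_seq_of_producible {s : Supertile} (h : s ∈ 𝒯.producible) (hα : α ∈ s) :
    ∃ a : ℕ → Assembly, (a 0).supertile ∈ 𝒯.init ∧
      (∀ i, a (i + 1) = a i ∨ 𝒯.AttachStep 𝒯.Available (a i) (a (i + 1))) ∧
      (∀ i, 𝒯.Available (a i).supertile) ∧ (∀ i j, i ≤ j → (a i).Sub (a j)) ∧ IsResult a α := by
  obtain ⟨a, γ, h0, h1, hr, rfl⟩ := h
  obtain ⟨u, rfl⟩ := hα
  have h2 : ∀ i, (a (i + 1)).translate u = (a i).translate u ∨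
      𝒯.AttachStep 𝒯.Available ((a i).translate u) ((a (i + 1)).translate u) := by
    intro i
    rcases h1 i with h | h
    · exact Or.inl (by rw [h])
    · exact Or.inr (AttachStep.translate h u)
  refine ⟨fun i => (a i).translate u, by simpa using h0, h2, fun i => ?_, fun i j hij => ?_,
    hr.translate u⟩
  · induction i with
    | zero => exact Available.init (by simpa using h0)
    | succ i ih =>
      rcases h2 i with h | h
      · simp only [h]; exact ih
      · exact ih.of_attachStep h
  · induction hij with
    | refl => exact Sub.refl _
    | step _ ih =>
      rcases h2 _ with h | h
      · exact ih.trans fun p _ => (congrFun h p).symm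
      · exact ih.trans h.sub

/-- Stability passes to infinite unions: a cut of the union already separates two tiles of some
finite stage, which is stable and has fewer bonds. -/
theorem isStableAssembly_of_producible {s : Supertile} (h : s ∈ 𝒯.producible) (hα : α ∈ s) :
    IsStableAssembly 𝒯.tiles 𝒯.temp α := by
  obtain ⟨a, -, -, h2, h3, hr⟩ := exists_seq_of_producible h hα
  refine ⟨?_, fun p t hp => ?_, ?_⟩
  · obtain ⟨p, hp⟩ := (h2 0).isStableAssembly.nonempty
    exact ⟨p, (hr.2 0).dom_subset hp⟩
  · obtain ⟨i, hi⟩ := hr.exists_stage h3 hp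
    exact (h2 i).isStableAssembly.overT p t (hi i le_rfl)
  · rintro A ⟨p, hp, hpA⟩ ⟨q, hq, hqA⟩
    obtain ⟨t, ht⟩ := mem_dom_iff.1 hp
    obtain ⟨t', ht'⟩ := mem_dom_iff.1 hq
    obtain ⟨i, hi⟩ := hr.exists_stage h3 ht
    obtain ⟨j, hj⟩ := hr.exists_stage h3 ht'
    refine ((h2 (max i j)).isStableAssembly.stable A ⟨p, ?_, hpA⟩ ⟨q, ?_, hqA⟩).trans
      (cutWeight_mono (hr.2 _) A)
    · exact mem_dom_of_eq (hi _ (le_max_left i j))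
    · exact mem_dom_of_eq (hj _ (le_max_right i j))

theorem eq_supertile_of_producible {s : Supertile} (h : s ∈ 𝒯.producible) (hα : α ∈ s) :
    s = α.supertile := by
  obtain ⟨a, γ, h0, h1, hr, rfl⟩ := h
  exact (supertile_eq_of_mem hα).symm

theorem exists_mem_of_producible {s : Supertile} (h : s ∈ 𝒯.producible) :
    ∃ α, s = Assembly.supertile α := by
  obtain ⟨a, γ, h0, h1, hr, rfl⟩ := h
  exact ⟨γ, rfl⟩

theorem AttachStep.union_right (h : 𝒯.AttachStep 𝒯.Available α β)
    (hs : (α.union δ).Stable 𝒯.temp) (hα : α.dom.Nonempty) (hd : Disjoint β.dom δ.dom) :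
    𝒯.AttachStep 𝒯.Available (α.union δ) (β.union δ) := by
  obtain ⟨γ, h1, h2, rfl⟩ := h
  rw [dom_union, Set.disjoint_union_left] at hd
  refine ⟨γ, h1, canAttach_of_link hs h1.isStableAssembly.stable ?_ ?_, ?_⟩
  · rw [dom_union, Set.disjoint_union_left]
    exact ⟨h2.1, hd.2.symm⟩
  · exact (h2.link_le hα h1.isStableAssembly.nonempty).trans
      (link_mono sub_union_left (Sub.refl _))
  · rw [union_assoc, union_assoc, union_comm hd.2]

/-- Both assemblies may be infinite, whereas sequences only attach available ones. Finitely many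
bonds between them suffice, and these are all present from some stage on. Combining at that stage
and then continuing both sequences alternately yields the union. -/
theorem producible_union (hα : α.supertile ∈ 𝒯.producible) (hδ : δ.supertile ∈ 𝒯.producible)
    (h : α.CanAttach 𝒯.temp δ) : (α.union δ).supertile ∈ 𝒯.producible := by
  have hlink := h.link_le (isStableAssembly_of_producible hα (mem_supertile_self α)).nonempty
    (isStableAssembly_of_producible hδ (mem_supertile_self δ)).nonempty
  obtain ⟨a, -, ha1, ha2, ha3, har⟩ := exists_seq_of_producible hα (mem_supertile_self α)
  obtain ⟨d, -, hd1, hd2, hd3, hdr⟩ := exists_seq_of_producible hδ (mem_supertile_self δ)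
  obtain ⟨F, hF⟩ := exists_finset_le_sum _ hlink
  have hstage (e : (ℤ × ℤ) × Side) : ∃ n, ∀ j, n ≤ j →
      pairBond (α e.1) (δ (e.1 + e.2.vec)) e.2 ≤
        pairBond (a j e.1) (d j (e.1 + e.2.vec)) e.2 := by
    by_cases h0 : pairBond (α e.1) (δ (e.1 + e.2.vec)) e.2 = 0
    · exact ⟨0, fun j _ => by simp [h0]⟩
    · obtain ⟨s, t, hs, ht, -, -⟩ := pairBond_ne_zero h0
      obtain ⟨i, hi⟩ := har.exists_stage ha3 hs
      obtain ⟨i', hi'⟩ := hdr.exists_stage hd3 ht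
      refine ⟨max i i', fun j hj => ?_⟩
      rw [hi j (le_of_max_le_left hj), hi' j (le_of_max_le_right hj), hs, ht]
  choose n hn using hstage
  let N := F.sup n
  have hdisj (i j : ℕ) : Disjoint (a i).dom (d j).dom :=
    h.1.mono (har.2 i).dom_subset (hdr.2 j).dom_subset
  have hlinkN (i j : ℕ) (hi : N ≤ i) (hj : N ≤ j) : (𝒯.temp : ℝ≥0∞) ≤ link (a i) (d j) := by
    refine le_trans ?_ (link_mono (ha3 N i hi) (hd3 N j hj))
    refine le_trans ?_ (ENNReal.sum_le_tsum F)
    rw [← Nat.cast_sum]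
    exact Nat.cast_le.2 (hF.trans (Finset.sum_le_sum fun e he => hn e N (Finset.le_sup he)))
  have hatt (i j : ℕ) (hi : N ≤ i) (hj : N ≤ j) : (a i).CanAttach 𝒯.temp (d j) :=
    canAttach_of_link (ha2 i).isStableAssembly.stable (hd2 j).isStableAssembly.stable
      (hdisj i j) (hlinkN i j hi hj)
  refine producible_of_chain (fun i => (a (N + i)).union (d (N + i))) ?_ (fun i => ?_) ?_
  · exact (ha2 N).union (hd2 N) (hatt N N le_rfl le_rfl)
  · have e1 : ReflTransGen (𝒯.AttachStep 𝒯.Available) ((a (N + i)).union (d (N + i)))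
        ((a (N + (i + 1))).union (d (N + i))) := by
      rcases ha1 (N + i) with h | h
      · rw [← add_assoc, h]
      · exact ReflTransGen.single (h.union_right (hatt _ _ (by omega) (by omega)).2
          (ha2 _).isStableAssembly.nonempty (hdisj _ _))
    refine e1.trans ?_
    rw [union_comm (hdisj _ _), union_comm (hdisj _ _)]
    rcases hd1 (N + i) with h | h
    · rw [← add_assoc N i 1, h]
    · exact ReflTransGen.single (h.union_right (hatt _ _ (by omega) (by omega)).symm.2
          (hd2 _).isStableAssembly.nonempty (hdisj _ _).symm)
  · have hsub (i : ℕ) : ((a (N + i)).union (d (N + i))).Sub (α.union δ) :=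
      union_sub ((har.2 _).trans sub_union_left) ((hdr.2 _).trans (sub_union_right h.1))
    refine ⟨subset_antisymm ?_ (Set.iUnion_subset fun i => (hsub i).dom_subset), hsub⟩
    intro p hp
    rw [Set.mem_iUnion]
    simp only [dom_union, Set.mem_union] at hp ⊢
    rcases hp with hp | hp
    · rw [har.1, Set.mem_iUnion] at hp
      obtain ⟨i, hi⟩ := hp
      exact ⟨i, Or.inl ((ha3 i (N + i) (by omega)).dom_subset hi)⟩
    · rw [hdr.1, Set.mem_iUnion] at hp
      obtain ⟨i, hi⟩ := hp
      exact ⟨i, Or.inr ((hd3 i (N + i) (by omega)).dom_subset hi)⟩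

theorem grows_of_reflTransGen (h : ReflTransGen (𝒯.AttachStep (· ∈ 𝒯.producible)) α β) :
    𝒯.Grows α.supertile β.supertile := by
  let X : ℕ → Assembly := fun i => Nat.casesOn i α fun _ => β
  obtain ⟨a, ha0, ha1, ha2, ha3⟩ := exists_refined_seq (r := 𝒯.AttachStep (· ∈ 𝒯.producible)) X
    (fun i => by
      cases i with
      | zero => exact h
      | succ i => exact ReflTransGen.refl)
  refine ⟨a, β, by rw [ha0]; rfl, ha1, isResult_const_of_le (fun i => ?_) (ha2 1), rfl⟩
  obtain ⟨j, hj⟩ := ha3 i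
  cases j with
  | zero => exact (sub_of_reflTransGen hj).trans (sub_of_reflTransGen h)
  | succ j => exact sub_of_reflTransGen hj

theorem producible_of_reflTransGen
    (h : ReflTransGen (𝒯.AttachStep (· ∈ 𝒯.producible)) α β)
    (hα : α.supertile ∈ 𝒯.producible) : β.supertile ∈ 𝒯.producible := by
  induction h with
  | refl => exact hα
  | tail _ h ih =>
    obtain ⟨γ, h1, h2, rfl⟩ := h
    exact producible_union ih h1 h2

end TAS

end TwoHAM

end

/-! ### The universal tiles, and stability of assemblies made of 2 × 2 cells -/

noncomputable section

namespace TwoHAM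

open Assembly Relation

/-! ### Glue kinds and the universal tile set -/

/-- The special glue kinds: axis, port, lock, index. -/
abbrev SpecialKind := Bool × Bool × Fin 3 × Bool

/-- The glue kinds: the null glue `none`, the inner glue `some none` and the special glues. -/
abbrev GlueKind := Option (Option SpecialKind)

/-- The strength of each glue kind at temperature `τ`. -/
def kindStrength (τ : ℕ) : GlueKind → ℕ
  | none => 0
  | some none => (τ + 1) / 2
  | some (some z) => if z.2.2.1 = 1 then (if z.2.2.2 then Nat.sqrt τ else 1) else (τ + 1) / 2

instance : Infinite String :=
  Infinite.of_injective String.ofList fun a b h => by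
    have := congrArg String.toList h
    simpa using this

/-- Distinct labels for the glue kinds. -/
def kindLabel (κ : GlueKind) : String := Infinite.natEmbedding String (Encodable.encode κ)

/-- The glue of a given kind. -/
def kindGlue (τ : ℕ) (κ : GlueKind) : Glue := ⟨kindLabel κ, kindStrength τ κ⟩

theorem kindGlue_injective (τ : ℕ) : Function.Injective (kindGlue τ) := by
  intro κ κ' h
  have h' : kindLabel κ = kindLabel κ' := congrArg Glue.label h
  exact Encodable.encode_injective ((Infinite.natEmbedding String).injective h')

/-- No attachment can rest on a single glue. In particular two free tiles, which meet along one side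
only, never combine. -/
theorem kindStrength_lt {τ : ℕ} (h : 2 ≤ τ) (κ : GlueKind) : kindStrength τ κ < τ := by
  rcases κ with _ | _ | z
  · simp only [kindStrength]; omega
  · simp only [kindStrength]; omega
  · simp only [kindStrength]
    have := Nat.sqrt_lt_self (n := τ) (by omega)
    split_ifs <;> omega

/-- At most one of the four glues is special. -/
def AtMostOneSpecial (f : Side → GlueKind) : Prop :=
  ∀ d d' z z', f d = some (some z) → f d' = some (some z') → d = d'

open Classical in
/-- The universal tile set at temperature `τ`. -/
def universalTiles (τ : ℕ) : Finset TileType :=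
  (Finset.univ.filter AtMostOneSpecial).image fun f d => kindGlue τ (f d)

theorem mem_universalTiles {τ : ℕ} {t : TileType} :
    t ∈ universalTiles τ ↔ ∃ f, AtMostOneSpecial f ∧ t = fun d => kindGlue τ (f d) := by
  simp [universalTiles, eq_comm]

theorem card_universalTiles_le (τ : ℕ) :
    (universalTiles τ).card ≤ Fintype.card (Side → GlueKind) := by
  classical
  exact Finset.card_image_le.trans (Finset.card_le_univ _)

/-! ### Coordinates -/

/-- The plane with the two coordinates swapped if `a`. -/
def ax (a : Bool) (p : ℤ × ℤ) : ℤ × ℤ := if a then (p.2, p.1) else p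

/-- The positive side along an axis. -/
def plus (a : Bool) : Side := if a then .north else .east

/-- The positive side across an axis. -/
def cross (a : Bool) : Side := plus !a

/-- Scaling of a position. -/
def scale (n : ℤ) (p : ℤ × ℤ) : ℤ × ℤ := (n * p.1, n * p.2)

/-- The cell of side length two of a position. -/
def cell (p : ℤ × ℤ) : ℤ × ℤ := (p.1 / 2, p.2 / 2)

@[simp] theorem scale_zero (n : ℤ) : scale n 0 = 0 := by simp [scale]

theorem scale_add (n : ℤ) (p q : ℤ × ℤ) : scale n (p + q) = scale n p + scale n q := by
  simp [scale, mul_add]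

theorem scale_sub (n : ℤ) (p q : ℤ × ℤ) : scale n (p - q) = scale n p - scale n q := by
  simp [scale, mul_sub]

theorem scale_neg (n : ℤ) (p : ℤ × ℤ) : scale n (-p) = -scale n p := by
  simp [scale]

theorem scale_injective {n : ℤ} (hn : 0 < n) : Function.Injective (scale n) := by
  intro p q h
  simp only [scale, Prod.mk.injEq] at h
  exact Prod.ext (mul_left_cancel₀ hn.ne' h.1) (mul_left_cancel₀ hn.ne' h.2)

theorem cell_add_scale (p q : ℤ × ℤ) (n : ℤ) :
    cell (p + scale (2 * n) q) = cell p + scale n q := by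
  simp only [cell, scale, Prod.fst_add, Prod.snd_add, Prod.mk_add_mk, Prod.mk.injEq]
  constructor
  · rw [mul_assoc, Int.add_mul_ediv_left _ _ two_ne_zero]
  · rw [mul_assoc, Int.add_mul_ediv_left _ _ two_ne_zero]

/-! ### Tied squares -/

section Squares

variable {τ s : ℕ} {α : Assembly}

theorem le_cutWeight_of_two {A : Set (ℤ × ℤ)} (hs : τ ≤ s + s) {e e' : (ℤ × ℤ) × Side}
    (hne : e ≠ e') (he : e.1 ∈ A ∧ e.1 + e.2.vec ∉ A) (he' : e'.1 ∈ A ∧ e'.1 + e'.2.vec ∉ A)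
    (hb : s ≤ α.bond e.1 e.2) (hb' : s ≤ α.bond e'.1 e'.2) : (τ : ℝ≥0∞) ≤ α.cutWeight A := by
  classical
  unfold cutWeight
  refine le_trans ?_ (ENNReal.sum_le_tsum {e, e'})
  rw [Finset.sum_pair hne, if_pos he, if_pos he', ← Nat.cast_add]
  exact Nat.cast_le.2 (by omega)

theorem bond_comm (p : ℤ × ℤ) (d : Side) : α.bond (p + d.vec) d.opposite = α.bond p d := by
  rw [bond_eq, bond_eq, pairBond_comm]
  simp

theorem exists_crossing {A : Set (ℤ × ℤ)} {p : ℤ × ℤ} {d : Side} (h : ¬ (p ∈ A ↔ p + d.vec ∈ A))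
    (hb : s ≤ α.bond p d) : ∃ e : (ℤ × ℤ) × Side, (e.1 ∈ A ∧ e.1 + e.2.vec ∉ A) ∧
      s ≤ α.bond e.1 e.2 ∧ (e = (p, d) ∨ e = (p + d.vec, d.opposite)) := by
  by_cases hp : p ∈ A
  · exact ⟨(p, d), ⟨hp, fun h' => h (iff_of_true hp h')⟩, hb, Or.inl rfl⟩
  · refine ⟨(p + d.vec, d.opposite), ⟨?_, by simpa using hp⟩, ?_, Or.inr rfl⟩
    · by_contra h'
      exact h (iff_of_false hp h')
    · simpa [bond_comm] using hb

theorem vec_ne_zero (d : Side) : d.vec ≠ 0 := by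
  cases d <;> simp [Side.vec]

theorem opposite_ne (d : Side) : d.opposite ≠ d := by
  cases d <;> simp [Side.opposite]

theorem Side.opposite_injective : Function.Injective Side.opposite :=
  fun d d' h => by rw [← Side.opposite_opposite d, h, Side.opposite_opposite]

/-- A cut that separates two neighbors on a four-cycle crosses a second edge of the cycle, and two
edges of strength `s` weigh at least `τ`. The remaining work is to see that the two crossed edges
are different. -/
theorem tied_square (hs : τ ≤ s + s)
    (hb : ∀ p d, p ∈ α.dom → p + Side.vec d ∈ α.dom → s ≤ α.bond p d) {p : ℤ × ℤ} {d d' : Side}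
    (h1 : d ≠ d') (h2 : d ≠ d'.opposite) (hp : p ∈ α.dom) (hpd : p + d.vec ∈ α.dom)
    (hpd' : p + d'.vec ∈ α.dom) (hpdd : p + d.vec + d'.vec ∈ α.dom) :
    Tied τ α p (p + d.vec) := by
  intro A hA
  obtain ⟨e, he, hbe, hee⟩ := exists_crossing hA (hb _ _ hp hpd)
  have hcomm : p + d'.vec + d.vec = p + d.vec + d'.vec := by abel
  by_cases c1 : p ∈ A ↔ p + d'.vec ∈ A
  · by_cases c2 : p + d.vec ∈ A ↔ p + d.vec + d'.vec ∈ A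
    · have c3 : ¬ (p + d'.vec ∈ A ↔ p + d'.vec + d.vec ∈ A) := by
        rw [hcomm]
        exact fun c3 => hA ((c1.trans c3).trans c2.symm)
      obtain ⟨e', he', hbe', hee'⟩ := exists_crossing c3 (hb _ _ hpd' (hcomm ▸ hpdd))
      refine le_cutWeight_of_two hs ?_ he he' hbe hbe'
      rintro rfl
      rcases hee with rfl | rfl <;> rcases hee' with h | h
      · exact vec_ne_zero d' (by simpa using congrArg Prod.fst h)
      · exact opposite_ne d (congrArg Prod.snd h).symm
      · exact opposite_ne d (congrArg Prod.snd h)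
      · exact vec_ne_zero d' (by simpa [add_comm, add_left_comm] using congrArg Prod.fst h)
    · obtain ⟨e', he', hbe', hee'⟩ := exists_crossing c2 (hb _ _ hpd hpdd)
      refine le_cutWeight_of_two hs ?_ he he' hbe hbe'
      rintro rfl
      rcases hee with rfl | rfl <;> rcases hee' with h | h <;> have h := congrArg Prod.snd h
      · exact h1 h
      · exact h2 h
      · exact h2 (by rw [← show d.opposite = d' from h, Side.opposite_opposite])
      · exact h1 (Side.opposite_injective h)
  · obtain ⟨e', he', hbe', hee'⟩ := exists_crossing c1 (hb _ _ hp hpd')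
    refine le_cutWeight_of_two hs ?_ he he' hbe hbe'
    rintro rfl
    rcases hee with rfl | rfl <;> rcases hee' with h | h <;> have h := congrArg Prod.snd h
    · exact h1 h
    · exact h2 h
    · exact h2 (by rw [← show d.opposite = d' from h, Side.opposite_opposite])
    · exact h1 (Side.opposite_injective h)

/-- An assembly that consists of full cells, with bonds of strength at least `s` inside. -/
structure IsCellular (s : ℕ) (C : Set (ℤ × ℤ)) (α : Assembly) : Prop where
  mem_dom : ∀ p, p ∈ α.dom ↔ cell p ∈ C
  bond : ∀ p d, p ∈ α.dom → p + Side.vec d ∈ α.dom → s ≤ α.bond p d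

/-- The corners of two cells are tied. -/
def CellTied (τ : ℕ) (α : Assembly) (c c' : ℤ × ℤ) : Prop := Tied τ α (scale 2 c) (scale 2 c')

theorem CellTied.trans {c c' c'' : ℤ × ℤ} (h : CellTied τ α c c') (h' : CellTied τ α c' c'') :
    CellTied τ α c c'' := Tied.trans h h'

theorem CellTied.symm {c c' : ℤ × ℤ} (h : CellTied τ α c c') : CellTied τ α c' c := Tied.symm h

variable {C : Set (ℤ × ℤ)}

theorem IsCellular.tied_corner (h : IsCellular s C α) (hs : τ ≤ s + s) {p : ℤ × ℤ}
    (hp : p ∈ α.dom) : Tied τ α p (scale 2 (cell p)) := by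
  have hc := (h.mem_dom p).1 hp
  have key (q : ℤ × ℤ) (hq : q.1 / 2 = p.1 / 2 ∧ q.2 / 2 = p.2 / 2) : q ∈ α.dom := by
    rw [h.mem_dom, cell, hq.1, hq.2]; exact hc
  obtain ⟨x, y⟩ := p
  simp only at key
  have hx : x = 2 * (x / 2) ∨ x = 2 * (x / 2) + 1 := by omega
  have hy : y = 2 * (y / 2) ∨ y = 2 * (y / 2) + 1 := by omega
  set X := x / 2
  set Y := y / 2
  have e1 : Tied τ α (2 * X, 2 * Y) (2 * X + 1, 2 * Y) := by
    have := tied_square (p := (2 * X, 2 * Y)) (d := .east) (d' := .north) hs h.bond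
      (by simp) (by simp [Side.opposite]) (key _ (by constructor <;> simp))
      (key _ (by constructor <;> simp [Side.vec]; omega))
      (key _ (by constructor <;> simp [Side.vec]; omega))
      (key _ (by constructor <;> simp [Side.vec] <;> omega))
    simpa [Side.vec] using this
  have e2 : Tied τ α (2 * X, 2 * Y) (2 * X, 2 * Y + 1) := by
    have := tied_square (p := (2 * X, 2 * Y)) (d := .north) (d' := .east) hs h.bond
      (by simp) (by simp [Side.opposite]) (key _ (by constructor <;> simp))
      (key _ (by constructor <;> simp [Side.vec]; omega))
      (key _ (by constructor <;> simp [Side.vec]; omega))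
      (key _ (by constructor <;> simp [Side.vec] <;> omega))
    simpa [Side.vec] using this
  have e3 : Tied τ α (2 * X + 1, 2 * Y) (2 * X + 1, 2 * Y + 1) := by
    have := tied_square (p := (2 * X + 1, 2 * Y)) (d := .north) (d' := .west) hs h.bond
      (by simp) (by simp [Side.opposite]) (key _ (by constructor <;> simp; omega))
      (key _ (by constructor <;> simp [Side.vec] <;> omega))
      (key _ (by constructor <;> simp [Side.vec]))
      (key _ (by constructor <;> simp [Side.vec]; omega))
    simpa [Side.vec] using this
  have hcell : scale 2 (cell (x, y)) = (2 * X, 2 * Y) := rfl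
  rw [hcell]
  rcases hx with hx | hx <;> rcases hy with hy | hy <;> rw [hx, hy]
  · exact Tied.refl _
  · exact e2.symm
  · exact e1.symm
  · exact (e1.trans e3).symm

/-- Adjacent cells are tied by the square that straddles their common border. This is the reason for
cells of side two: stability becomes connectedness by cells. -/
theorem IsCellular.cellTied_succ (h : IsCellular s C α) (hs : τ ≤ s + s) (a : Bool) {x y : ℤ}
    (h1 : ax a (x, y) ∈ C) (h2 : ax a (x + 1, y) ∈ C) :
    CellTied τ α (ax a (x, y)) (ax a (x + 1, y)) := by
  have key (q : ℤ × ℤ) (hq : cell q = ax a (x, y) ∨ cell q = ax a (x + 1, y)) : q ∈ α.dom := by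
    rw [h.mem_dom]
    rcases hq with hq | hq <;> rw [hq] <;> assumption
  have e0 : Tied τ α (scale 2 (ax a (x, y)) + (plus a).vec) (scale 2 (ax a (x + 1, y))) := by
    have := tied_square (p := scale 2 (ax a (x, y)) + (plus a).vec) (d := plus a) (d' := cross a)
      hs h.bond
      (by cases a <;> simp [plus, cross]) (by cases a <;> simp [plus, cross, Side.opposite])
      (key _ (by cases a <;> simp [cell, scale, ax, plus, Side.vec] <;> omega))
      (key _ (by cases a <;> simp [cell, scale, ax, plus, Side.vec] <;> omega))
      (key _ (by cases a <;> simp [cell, scale, ax, plus, cross, Side.vec] <;> omega))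
      (key _ (by cases a <;> simp [cell, scale, ax, plus, cross, Side.vec] <;> omega))
    convert this using 1
    cases a <;> simp [scale, ax, plus, Side.vec, Prod.ext_iff] <;> ring
  refine Tied.trans (q := scale 2 (ax a (x, y)) + (plus a).vec) ?_ e0
  have := h.tied_corner hs (p := scale 2 (ax a (x, y)) + (plus a).vec)
    (key _ (by cases a <;> simp [cell, scale, ax, plus, Side.vec] <;> omega))
  convert this.symm using 2
  cases a <;> simp [cell, scale, ax, plus, Side.vec] <;> omega

theorem IsCellular.cellTied_line (h : IsCellular s C α) (hs : τ ≤ s + s) (a : Bool) {x x' y : ℤ}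
    (hx : x ≤ x') (hC : ∀ i, x ≤ i → i ≤ x' → ax a (i, y) ∈ C) :
    CellTied τ α (ax a (x, y)) (ax a (x', y)) := by
  induction x', hx using Int.leInduction with
  | base => exact Tied.refl _
  | succ n hn ih =>
    exact (ih fun i h1 h2 => hC i h1 (by omega)).trans
      (h.cellTied_succ hs a (hC n hn (by omega)) (hC (n + 1) (by omega) le_rfl))

theorem ax_not (a : Bool) (x y : ℤ) : ax (!a) (x, y) = ax a (y, x) := by
  cases a <;> rfl

theorem IsCellular.cellTied_line' (h : IsCellular s C α) (hs : τ ≤ s + s) (a : Bool) {x y y' : ℤ}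
    (hx : y ≤ y') (hC : ∀ i, y ≤ i → i ≤ y' → ax a (x, i) ∈ C) :
    CellTied τ α (ax a (x, y)) (ax a (x, y')) := by
  simpa only [ax_not] using h.cellTied_line hs (!a) (x := y) (x' := y') (y := x) hx
    (by simpa only [ax_not] using hC)

theorem IsCellular.stable (h : IsCellular s C α) (hs : τ ≤ s + s) (o : ℤ × ℤ)
    (hC : ∀ c ∈ C, CellTied τ α c o) : α.Stable τ :=
  stable_of_tied (scale 2 o) fun p hp =>
    (h.tied_corner hs hp).trans (hC _ ((h.mem_dom p).1 hp))

end Squares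

end TwoHAM

end

/-! ### Geometry of macrotiles: bodies, pads, locks and special glues -/

noncomputable section

namespace TwoHAM

open Assembly Relation

/-! ### The geometry of macrotiles -/

/-- The parameters of the macrotile construction: temperature, width and height of the locks,
and the codes of the glue labels. -/
structure Kit where
  τ : ℕ
  two_le : 2 ≤ τ
  w : ℤ
  H : ℤ
  three_le_w : 3 ≤ w
  two_le_H : 2 ≤ H
  labels : Set Glue
  bit : Glue → ℤ → ℤ → Prop
  -- Bit row 0 lies entirely in the left part, so that every column has a place for a special glue
  -- above it. Bit row 1 has its only gap in column 1 and fixes the horizontal position. The further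
  -- rows carry the code.
  bit_zero : ∀ A x, bit A x 0
  bit_one : ∀ A x, bit A x 1 ↔ x ≠ 1
  separated : ∀ A ∈ labels, ∀ B ∈ labels,
    (∀ x i, 0 < x → x < w → 2 ≤ i → i < H → bit A x i → bit B x i) → A = B
  capacity : ∀ n, n ≤ (τ + 1) / 2 → ((n / Nat.sqrt τ + n % Nat.sqrt τ : ℕ) : ℤ) < w

/-- The building blocks: the body of a macrotile for a tile type, and the pads. The pad
`pad a k j A` belongs to port `k` of the border between two macrotiles that are neighbors along
the axis `a`, is mounted on the lower (`j = false`) or the upper one, and codes the glue `A`. -/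
inductive Piece
  | body (t : TileType)
  | pad (a k j : Bool) (A : Glue)

namespace Kit

variable (K : Kit)

/-- The upper end of the core of a macrotile. -/
def b : ℤ := K.w + 6 * K.H

/-- The side length of a macrotile in cells. -/
def M : ℤ := 3 * K.w + 6 * K.H - 1

/-- Where a lock begins along the axis. -/
def lockX (l : Fin 3) : ℤ := K.b - 1 + if l = 0 then 0 else if l = 1 then K.w else 2 * K.w

/-- Where a port begins across the axis. -/
def portY (k : Bool) : ℤ := if k then K.w + 3 * K.H else K.w

theorem lockX_cases (l : Fin 3) : (l = 0 ∧ K.lockX l = K.b - 1) ∨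
    (l = 1 ∧ K.lockX l = K.b - 1 + K.w) ∨ (l = 2 ∧ K.lockX l = K.b - 1 + 2 * K.w) := by
  fin_cases l <;> simp [lockX]

theorem portY_cases (k : Bool) :
    (k = false ∧ K.portY k = K.w) ∨ (k = true ∧ K.portY k = K.w + 3 * K.H) := by
  cases k <;> simp [portY]

/-- The cell at given coordinates of a lock. -/
def cellAt (a k : Bool) (l : Fin 3) (x y : ℤ) : ℤ × ℤ := ax a (K.lockX l + x, K.portY k + y)

theorem M_pos : 0 < K.M := by
  have := K.three_le_w; have := K.two_le_H; simp only [M]; omega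

/-- The remainders need only lie within distance `M` of each other, not in `[0, M)`, because the
locks of a border reach across the boundary of the macrotile. -/
theorem eq_of_mul_add_eq {M q r q' r' : ℤ} (h : M * q + r = M * q' + r') (h1 : r - r' < M)
    (h2 : r' - r < M) : q = q' ∧ r = r' := by
  have hM : 0 < M := by omega
  have h3 : M * (q - q') = r' - r := by linarith
  have h4 : q - q' < 1 := by
    by_contra hc
    have : M * 1 ≤ M * (q - q') := mul_le_mul_of_nonneg_left (by omega) hM.le
    omega
  have h5 : -1 < q - q' := by
    by_contra hc
    have : M * (q - q') ≤ M * (-1) := mul_le_mul_of_nonneg_left (by omega) hM.le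
    omega
  have h6 : q = q' := by omega
  subst h6
  exact ⟨rfl, by omega⟩

/-- The coordinates that belong to a lock; the first column of lock `0` belongs to the core. -/
def InLock (l : Fin 3) (x y : ℤ) : Prop :=
  0 ≤ x ∧ x < K.w ∧ (l = 0 → 0 < x) ∧ 0 ≤ y ∧ y < 3 * K.H

theorem cellAt_injective {q q' : ℤ × ℤ} {a a' k k' : Bool} {l l' : Fin 3} {x x' y y' : ℤ}
    (h : scale K.M q + K.cellAt a k l x y = scale K.M q' + K.cellAt a' k' l' x' y')
    (h1 : K.InLock l x y) (h2 : K.InLock l' x' y') :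
    q = q' ∧ a = a' ∧ k = k' ∧ l = l' ∧ x = x' ∧ y = y' := by
  obtain ⟨hx, hxw, hx0, hy, hyH⟩ := h1
  obtain ⟨hx', hxw', hx0', hy', hyH'⟩ := h2
  have hw := K.three_le_w
  have hH := K.two_le_H
  have hb : K.b = K.w + 6 * K.H := rfl
  have hM : K.M = 3 * K.w + 6 * K.H - 1 := rfl
  have e1 := congrArg Prod.fst h
  have e2 := congrArg Prod.snd h
  have ky := K.portY_cases k
  have ky' := K.portY_cases k'
  have lx : K.b ≤ K.lockX l + x ∧ K.lockX l + x < K.b + 3 * K.w - 1 := by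
    rcases K.lockX_cases l with ⟨h, hl⟩ | ⟨h, hl⟩ | ⟨h, hl⟩ <;> simp only [h, true_implies] at hx0
      <;> omega
  have lx' : K.b ≤ K.lockX l' + x' ∧ K.lockX l' + x' < K.b + 3 * K.w - 1 := by
    rcases K.lockX_cases l' with ⟨h, hl⟩ | ⟨h, hl⟩ | ⟨h, hl⟩ <;>
      simp only [h, true_implies] at hx0' <;> omega
  have py : K.w ≤ K.portY k + y ∧ K.portY k + y < K.b := by omega
  have py' : K.w ≤ K.portY k' + y' ∧ K.portY k' + y' < K.b := by omega
  have fin (e : K.lockX l + x = K.lockX l' + x') (e' : K.portY k + y = K.portY k' + y') :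
      k = k' ∧ l = l' ∧ x = x' ∧ y = y' := by
    have hk : k = k' := by
      rcases ky with ⟨rfl, h⟩ | ⟨rfl, h⟩ <;> rcases ky' with ⟨rfl, h'⟩ | ⟨rfl, h'⟩ <;>
        first | rfl | (exfalso; omega)
    subst hk
    have hl : l = l' := by
      rcases K.lockX_cases l with ⟨rfl, h⟩ | ⟨rfl, h⟩ | ⟨rfl, h⟩ <;>
        rcases K.lockX_cases l' with ⟨rfl, h'⟩ | ⟨rfl, h'⟩ | ⟨rfl, h'⟩ <;>
        first | rfl | (exfalso; omega)
    subst hl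
    exact ⟨rfl, rfl, by omega, by omega⟩
  -- Along its axis a lock starts at `b` or later, while across its axis it stays below `b`. Locks
  -- of different axes are therefore disjoint.
  cases a <;> cases a' <;> simp only [cellAt, ax, scale, Prod.fst_add, Prod.snd_add, if_true,
    if_false, Bool.false_eq_true] at e1 e2
  · obtain ⟨f1, g1⟩ := eq_of_mul_add_eq e1 (by omega) (by omega)
    obtain ⟨f2, g2⟩ := eq_of_mul_add_eq e2 (by omega) (by omega)
    exact ⟨Prod.ext f1 f2, rfl, fin g1 g2⟩
  · obtain ⟨f1, g1⟩ := eq_of_mul_add_eq e1 (by omega) (by omega)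
    omega
  · obtain ⟨f1, g1⟩ := eq_of_mul_add_eq e1 (by omega) (by omega)
    omega
  · obtain ⟨f1, g1⟩ := eq_of_mul_add_eq e1 (by omega) (by omega)
    obtain ⟨f2, g2⟩ := eq_of_mul_add_eq e2 (by omega) (by omega)
    exact ⟨Prod.ext f1 f2, rfl, fin g2 g1⟩

/-- The core of a macrotile. -/
def InCore (c : ℤ × ℤ) : Prop := (K.w ≤ c.1 ∧ c.1 < K.b) ∧ K.w ≤ c.2 ∧ c.2 < K.b

theorem core_injective {q q' c c' : ℤ × ℤ} (h : scale K.M q + c = scale K.M q' + c')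
    (h1 : K.InCore c) (h2 : K.InCore c') : q = q' ∧ c = c' := by
  obtain ⟨⟨_, _⟩, _, _⟩ := h1
  obtain ⟨⟨_, _⟩, _, _⟩ := h2
  have hw := K.three_le_w
  have hb : K.b = K.w + 6 * K.H := rfl
  have hM : K.M = 3 * K.w + 6 * K.H - 1 := rfl
  obtain ⟨f1, g1⟩ := eq_of_mul_add_eq (congrArg Prod.fst h) (by omega) (by omega)
  obtain ⟨f2, g2⟩ := eq_of_mul_add_eq (congrArg Prod.snd h) (by omega) (by omega)
  exact ⟨Prod.ext f1 f2, Prod.ext g1 g2⟩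

theorem core_ne_cellAt {q q' c : ℤ × ℤ} {a k : Bool} {l : Fin 3} {x y : ℤ} (h1 : K.InCore c)
    (h2 : K.InLock l x y) : scale K.M q + c ≠ scale K.M q' + K.cellAt a k l x y := by
  intro h
  obtain ⟨⟨_, _⟩, _, _⟩ := h1
  obtain ⟨hx, hxw, hx0, hy, hyH⟩ := h2
  have hw := K.three_le_w
  have hH := K.two_le_H
  have hb : K.b = K.w + 6 * K.H := rfl
  have hM : K.M = 3 * K.w + 6 * K.H - 1 := rfl
  have e1 := congrArg Prod.fst h
  have e2 := congrArg Prod.snd h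
  have lx : K.b ≤ K.lockX l + x ∧ K.lockX l + x < K.b + 3 * K.w - 1 := by
    rcases K.lockX_cases l with ⟨h, hl⟩ | ⟨h, hl⟩ | ⟨h, hl⟩ <;> simp only [h, true_implies] at hx0
      <;> omega
  cases a <;> simp only [cellAt, ax, scale, Prod.fst_add, Prod.snd_add, if_true,
    if_false, Bool.false_eq_true] at e1 e2
  · obtain ⟨f1, g1⟩ := eq_of_mul_add_eq e1 (by omega) (by omega)
    omega
  · obtain ⟨f1, g1⟩ := eq_of_mul_add_eq e2 (by omega) (by omega)
    omega

/-- The cells of a lock that belong to its left part if it codes the glue `A`. -/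
def IsLeft (A : Glue) (x y : ℤ) : Prop := y % 3 = 2 ∨ (y % 3 = 0 ∧ K.bit A x (y / 3))

/-- The piece `π` contains the left (`r = false`) or right part of the lock `l` of port `k` along
the axis `a`, with code `A`, where the border starts at macrotile `-o`. -/
def HasFace (π : Piece) (r a k : Bool) (l : Fin 3) (A : Glue) (o : ℤ × ℤ) : Prop :=
  match π with
  | .body t => (r = false ∧ l = 0 ∧ A = t (plus a) ∧ o = 0) ∨
      (r = true ∧ l = 2 ∧ A = t (plus a).opposite ∧ o = (plus a).vec)
  | .pad a' k' j A' => a = a' ∧ k = k' ∧ A = A' ∧ o = 0 ∧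
      l = if j then (if r then 1 else 2) else (if r then 0 else 1)

/-- The cells of one part of a lock. -/
def FaceMem (r a k : Bool) (l : Fin 3) (A : Glue) (c : ℤ × ℤ) : Prop :=
  ∃ x y, c = K.cellAt a k l x y ∧ 0 < x ∧ x < K.w ∧ 0 ≤ y ∧ y < 3 * K.H ∧
    (K.IsLeft A x y ↔ r = false)

/-- The cells of a piece that do not belong to locks. -/
def BaseMem (π : Piece) (c : ℤ × ℤ) : Prop :=
  match π with
  | .body _ => K.InCore c
  | .pad a k j _ => ∃ y, c = K.cellAt a k (if j then 2 else 1) 0 y ∧ 0 ≤ y ∧ y < 3 * K.H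

/-- The cells of a piece. -/
def cells (π : Piece) : Set (ℤ × ℤ) :=
  {c | K.BaseMem π c ∨ ∃ r a k l A o, HasFace π r a k l A o ∧ K.FaceMem r a k l A (c + scale K.M o)}

theorem mem_cells_cases {π : Piece} {q c : ℤ × ℤ} (h : c - scale K.M q ∈ K.cells π) :
    (∃ t d, π = .body t ∧ c = scale K.M q + d ∧ K.InCore d) ∨
    (∃ a k j A y, π = .pad a k j A ∧ c = scale K.M q + K.cellAt a k (if j then 2 else 1) 0 y ∧
      0 ≤ y ∧ y < 3 * K.H) ∨
    ∃ r a k l A o x y, HasFace π r a k l A o ∧ c = scale K.M (q - o) + K.cellAt a k l x y ∧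
      0 < x ∧ x < K.w ∧ 0 ≤ y ∧ y < 3 * K.H ∧ (K.IsLeft A x y ↔ r = false) := by
  rcases h with h | ⟨r, a, k, l, A, o, hf, x, y, hc, h⟩
  · cases π with
    | body t => exact Or.inl ⟨t, _, rfl, by abel, h⟩
    | pad a k j A =>
      obtain ⟨y, hc, h⟩ := h
      exact Or.inr (Or.inl ⟨a, k, j, A, y, rfl, by rw [← hc]; abel, h⟩)
  · refine Or.inr (Or.inr ⟨r, a, k, l, A, o, x, y, hf, ?_, h⟩)
    rw [← hc, scale_sub]
    abel

theorem hasFace_eq {π π' : Piece} {r a k : Bool} {l : Fin 3} {A A' : Glue} {o o' : ℤ × ℤ}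
    (h : HasFace π r a k l A o) (h' : HasFace π' r a k l A' o') :
    ((∃ t t', π = .body t ∧ π' = .body t') ∨
      ∃ a k j A A', π = .pad a k j A ∧ π' = .pad a k j A') ∧ o = o' := by
  cases π with
  | body t => cases π' with
    | body t' =>
      refine ⟨Or.inl ⟨t, t', rfl, rfl⟩, ?_⟩
      rcases h with ⟨rfl, rfl, h1, h2⟩ | ⟨rfl, rfl, h1, h2⟩ <;>
      rcases h' with ⟨h3, h4, h5, h6⟩ | ⟨h3, h4, h5, h6⟩ <;> simp_all
    | pad a' k' j B =>
      exfalso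
      obtain ⟨-, -, -, -, h'⟩ := h'
      rcases h with ⟨rfl, rfl, h1, h2⟩ | ⟨rfl, rfl, h1, h2⟩ <;> cases j <;> simp at h'
  | pad a₁ k₁ j₁ B => cases π' with
    | body t' =>
      exfalso
      obtain ⟨-, -, -, -, h⟩ := h
      rcases h' with ⟨rfl, rfl, h1, h2⟩ | ⟨rfl, rfl, h1, h2⟩ <;> cases j₁ <;> simp at h
    | pad a₂ k₂ j₂ B₂ =>
      obtain ⟨rfl, rfl, rfl, rfl, h⟩ := h
      obtain ⟨rfl, rfl, rfl, rfl, h'⟩ := h'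
      have : j₁ = j₂ := by
        rw [h] at h'
        cases r <;> cases j₁ <;> cases j₂ <;> simp at h' ⊢
      subst this
      exact ⟨Or.inr ⟨_, _, _, _, _, rfl, rfl⟩, rfl⟩

/-- How two placed pieces can overlap. -/
theorem overlap_cases {π π' : Piece} {q q' c : ℤ × ℤ} (h : c - scale K.M q ∈ K.cells π)
    (h' : c - scale K.M q' ∈ K.cells π') :
    (q = q' ∧ ((∃ t t', π = .body t ∧ π' = .body t') ∨
      ∃ a k j A A', π = .pad a k j A ∧ π' = .pad a k j A')) ∨
    ∃ r r' a k l A A' o o', HasFace π r a k l A o ∧ HasFace π' r' a k l A' o' ∧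
      q - o = q' - o' ∧ r ≠ r' ∧ A ≠ A' := by
  have hw := K.three_le_w
  rcases K.mem_cells_cases h with ⟨t, d, rfl, hc, hd⟩ | ⟨a, k, j, A, y, rfl, hc, hy, hyH⟩ |
    ⟨r, a, k, l, A, o, x, y, hf, hc, hx, hxw, hy, hyH, hl⟩ <;>
  rcases K.mem_cells_cases h' with ⟨t', d', rfl, hc', hd'⟩ |
    ⟨a', k', j', A', y', rfl, hc', hy', hyH'⟩ |
    ⟨r', a', k', l', A', o', x', y', hf', hc', hx', hxw', hy', hyH', hl'⟩ <;> rw [hc] at hc'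
  · exact Or.inl ⟨(K.core_injective hc' hd hd').1, Or.inl ⟨t, t', rfl, rfl⟩⟩
  · exact absurd hc' (K.core_ne_cellAt hd ⟨by omega, by omega, by cases j' <;> simp, hy', hyH'⟩)
  · exact absurd hc' (K.core_ne_cellAt hd ⟨by omega, by omega, fun _ => hx', hy', hyH'⟩)
  · exact absurd hc'.symm (K.core_ne_cellAt hd' ⟨by omega, by omega, by cases j <;> simp, hy, hyH⟩)
  · obtain ⟨rfl, rfl, rfl, h, -, -⟩ := K.cellAt_injective hc'
      ⟨by omega, by omega, by cases j <;> simp, hy, hyH⟩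
      ⟨by omega, by omega, by cases j' <;> simp, hy', hyH'⟩
    have : j = j' := by cases j <;> cases j' <;> simp at h ⊢
    subst this
    exact Or.inl ⟨rfl, Or.inr ⟨_, _, _, _, _, rfl, rfl⟩⟩
  · obtain ⟨-, -, -, -, h, -⟩ := K.cellAt_injective hc'
      ⟨by omega, by omega, by cases j <;> simp, hy, hyH⟩
      ⟨by omega, by omega, fun _ => hx', hy', hyH'⟩
    omega
  · exact absurd hc'.symm (K.core_ne_cellAt hd' ⟨by omega, by omega, fun _ => hx, hy, hyH⟩)
  · obtain ⟨-, -, -, -, h, -⟩ := K.cellAt_injective hc'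
      ⟨by omega, by omega, fun _ => hx, hy, hyH⟩
      ⟨by omega, by omega, by cases j' <;> simp, hy', hyH'⟩
    omega
  · obtain ⟨hq, rfl, rfl, rfl, rfl, rfl⟩ := K.cellAt_injective hc'
      ⟨by omega, by omega, fun _ => hx, hy, hyH⟩
      ⟨by omega, by omega, fun _ => hx', hy', hyH'⟩
    -- Equal parts of one lock determine the kind of the piece and its place. Opposite parts with
    -- the same code would be complementary and could not share a cell.
    by_cases hr : r = r'
    · subst hr
      obtain ⟨h1, rfl⟩ := hasFace_eq hf hf'
      exact Or.inl ⟨by simpa using hq, h1⟩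
    · refine Or.inr ⟨r, r', a, k, l, A, A', o, o', hf, hf', hq, hr, ?_⟩
      rintro rfl
      rw [hl] at hl'
      cases r <;> cases r' <;> simp_all

/-! ### Tiles of the pieces -/

/-- The strength of the share of port `k` in the bond of a glue. -/
def share (k : Bool) (A : Glue) : ℕ :=
  if k then (min A.strength K.τ) / 2 else (min A.strength K.τ + 1) / 2

/-- The index of the special glue in column `x` of a lock. -/
def slot (l : Fin 3) (k : Bool) (A : Glue) (x : ℤ) : Option Bool :=
  if l = 1 then
    -- The share is divided by `√τ`: the quotient counts the glues of strength `√τ`, which come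
    -- first, and the remainder counts those of strength 1.
    if x ≤ (K.share k A / Nat.sqrt K.τ : ℕ) then some true
    else if x ≤ (K.share k A / Nat.sqrt K.τ + K.share k A % Nat.sqrt K.τ : ℕ) then some false
    else none
  else if x = 1 then some false else if x = 2 then some true else none

/-- The position of the left one of the two tiles that carry the special glue in column `x` of a
lock. -/
def slotPos (a k : Bool) (l : Fin 3) (x : ℤ) : ℤ × ℤ :=
  ax a (2 * (K.lockX l + x), 2 * K.portY k + 1)

/-- The tile of the piece `π` at `p` has a special glue of kind `z` on side `d`. -/
def SpecialAt (π : Piece) (p : ℤ × ℤ) (d : Side) (z : SpecialKind) : Prop :=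
  ∃ r A o x, HasFace π r z.1 z.2.1 z.2.2.1 A o ∧ 0 < x ∧ x < K.w ∧
    K.slot z.2.2.1 z.2.1 A x = some z.2.2.2 ∧
    d = (if r then (cross z.1).opposite else cross z.1) ∧
    p + scale (2 * K.M) o = K.slotPos z.1 z.2.1 z.2.2.1 x + (if r then (cross z.1).vec else 0)

open Classical in
/-- The kind of the glue on side `d` of the tile of `π` at `p`. -/
def kindAt (π : Piece) (p : ℤ × ℤ) (d : Side) : GlueKind :=
  if cell (p + d.vec) ∈ K.cells π then some none
  else if h : ∃ z, K.SpecialAt π p d z then some (some h.choose) else none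

open Classical in
/-- The assembly of a piece. -/
def asm (π : Piece) : Assembly := fun p =>
  if cell p ∈ K.cells π then some fun d => kindGlue K.τ (K.kindAt π p d) else none

theorem mem_dom_asm {π : Piece} {p : ℤ × ℤ} : p ∈ (K.asm π).dom ↔ cell p ∈ K.cells π := by
  by_cases h : cell p ∈ K.cells π <;> simp [dom, asm, h]

theorem asm_eq_some {π : Piece} {p : ℤ × ℤ} {t : TileType} (h : K.asm π p = some t) :
    cell p ∈ K.cells π ∧ t = fun d => kindGlue K.τ (K.kindAt π p d) := by
  by_cases hc : cell p ∈ K.cells π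
  · rw [asm, if_pos hc, Option.some.injEq] at h
    exact ⟨hc, h.symm⟩
  · rw [asm, if_neg hc] at h; simp at h

theorem slot_of_ne {l : Fin 3} {k : Bool} {A : Glue} {x : ℤ} {i : Bool} (hl : l ≠ 1)
    (h : K.slot l k A x = some i) : x = if i then 2 else 1 := by
  rw [slot, if_neg hl] at h
  split_ifs at h with h1 h2
  · simp at h; subst h; simpa using h1
  · simp at h; subst h; simpa using h2

theorem HasFace.offset_eq {π : Piece} {r a k k' : Bool} {l l' : Fin 3} {A A' : Glue}
    {o o' : ℤ × ℤ} (h : HasFace π r a k l A o) (h' : HasFace π r a k' l' A' o') :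
    l = l' ∧ A = A' ∧ o = o' := by
  cases π with
  | body t =>
    rcases h with ⟨rfl, rfl, rfl, rfl⟩ | ⟨rfl, rfl, rfl, rfl⟩ <;>
    rcases h' with ⟨h3, h4, h5, h6⟩ | ⟨h3, h4, h5, h6⟩ <;> simp_all
  | pad a₁ k₁ j B =>
    obtain ⟨rfl, rfl, rfl, rfl, rfl⟩ := h
    obtain ⟨-, -, rfl, rfl, rfl⟩ := h'
    exact ⟨rfl, rfl, rfl⟩

theorem slotPos_injective {a k k' : Bool} {l : Fin 3} {x x' : ℤ}
    (h : K.slotPos a k l x = K.slotPos a k' l x') : k = k' ∧ x = x' := by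
  have hH := K.two_le_H
  have e1 := congrArg Prod.fst h
  have e2 := congrArg Prod.snd h
  cases a <;> simp only [slotPos, ax, if_true, if_false, Bool.false_eq_true] at e1 e2 <;>
    rcases K.portY_cases k with ⟨rfl, h⟩ | ⟨rfl, h⟩ <;>
    rcases K.portY_cases k' with ⟨rfl, h'⟩ | ⟨rfl, h'⟩ <;>
    constructor <;> first | rfl | omega

theorem SpecialAt.unique {π : Piece} {p : ℤ × ℤ} {d : Side} {z z' : SpecialKind}
    (h : K.SpecialAt π p d z) (h' : K.SpecialAt π p d z') : z = z' := by
  obtain ⟨a, k, l, i⟩ := z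
  obtain ⟨a', k', l', i'⟩ := z'
  obtain ⟨r, A, o, x, hf, hx, hxw, hs, hd, hp⟩ := h
  obtain ⟨r', A', o', x', hf', hx', hxw', hs', hd', hp'⟩ := h'
  simp only at *
  have hra : r = r' ∧ a = a' := by
    rw [hd] at hd'
    cases r <;> cases r' <;> cases a <;> cases a' <;> simp [cross, plus, Side.opposite] at hd' ⊢
  obtain ⟨rfl, rfl⟩ := hra
  obtain ⟨rfl, rfl, rfl⟩ := HasFace.offset_eq hf hf'
  rw [hp, add_left_inj] at hp'
  obtain ⟨rfl, rfl⟩ := K.slotPos_injective hp'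
  rw [hs, Option.some.injEq] at hs'
  rw [hs']

/-- Left parts carry their special glues on the upper row of tiles of a cell, right parts on the
lower row, and the faces of different axes lie apart. So a tile has at most one special glue, which
is what makes free tiles inert. -/
theorem SpecialAt.side_eq {π : Piece} {p : ℤ × ℤ} {d d' : Side} {z z' : SpecialKind}
    (h : K.SpecialAt π p d z) (h' : K.SpecialAt π p d' z') : d = d' := by
  obtain ⟨a, k, l, i⟩ := z
  obtain ⟨a', k', l', i'⟩ := z'
  obtain ⟨r, A, o, x, hf, hx, hxw, hs, hd, hp⟩ := h
  obtain ⟨r', A', o', x', hf', hx', hxw', hs', hd', hp'⟩ := h'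
  simp only at *
  have hw := K.three_le_w
  have hH := K.two_le_H
  have hb : K.b = K.w + 6 * K.H := rfl
  have hM : K.M = 3 * K.w + 6 * K.H - 1 := rfl
  have e1 := congrArg Prod.fst hp
  have e2 := congrArg Prod.snd hp
  have e1' := congrArg Prod.fst hp'
  have e2' := congrArg Prod.snd hp'
  have ky := K.portY_cases k
  have ky' := K.portY_cases k'
  have lx := K.lockX_cases l
  have lx' := K.lockX_cases l'
  cases π with
  | body t =>
    rcases hf with ⟨rfl, rfl, -, rfl⟩ | ⟨rfl, rfl, -, rfl⟩ <;>
    rcases hf' with ⟨rfl, rfl, -, rfl⟩ | ⟨rfl, rfl, -, rfl⟩ <;>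
    cases a <;> cases a' <;>
    simp [slotPos, ax, scale, plus, cross, Side.vec, Side.opposite] at e1 e2 e1' e2' lx lx' hd hd' <;>
    first | (rw [hd, hd']; done) | (exfalso; omega)
  | pad a₁ k₁ j B =>
    obtain ⟨rfl, rfl, -, rfl, hl⟩ := hf
    obtain ⟨rfl, rfl, -, rfl, hl'⟩ := hf'
    cases r <;> cases r' <;> cases a' <;>
    simp [slotPos, ax, scale, plus, cross, Side.vec, Side.opposite] at e1 e2 e1' e2' hd hd' <;>
    first | (rw [hd, hd']; done) | (exfalso; omega)

theorem kindAt_eq_inner {π : Piece} {p : ℤ × ℤ} {d : Side} :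
    K.kindAt π p d = some none ↔ cell (p + d.vec) ∈ K.cells π := by
  by_cases h : cell (p + d.vec) ∈ K.cells π
  · simp [kindAt, h]
  · by_cases h' : ∃ z, K.SpecialAt π p d z <;> simp [kindAt, h, h']

theorem SpecialAt.of_kindAt {π : Piece} {p : ℤ × ℤ} {d : Side} {z : SpecialKind}
    (h : K.kindAt π p d = some (some z)) : K.SpecialAt π p d z := by
  by_cases hc : cell (p + d.vec) ∈ K.cells π
  · simp [kindAt, hc] at h
  · by_cases h' : ∃ z, K.SpecialAt π p d z
    · rw [kindAt, if_neg hc, dif_pos h'] at h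
      simp only [Option.some.injEq] at h
      rw [← h]
      exact h'.choose_spec
    · simp [kindAt, hc, h'] at h

theorem SpecialAt.kindAt_eq {π : Piece} {p : ℤ × ℤ} {d : Side} {z : SpecialKind}
    (h : K.SpecialAt π p d z) (hc : cell (p + d.vec) ∉ K.cells π) :
    K.kindAt π p d = some (some z) := by
  have h' : ∃ z, K.SpecialAt π p d z := ⟨z, h⟩
  rw [kindAt, if_neg hc, dif_pos h', SpecialAt.unique K h'.choose_spec h]

theorem asm_over (π : Piece) : (K.asm π).Over (universalTiles K.τ) := by
  intro p t h
  obtain ⟨-, rfl⟩ := K.asm_eq_some h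
  refine mem_universalTiles.2 ⟨_, fun d d' z z' hz hz' => ?_, rfl⟩
  exact SpecialAt.side_eq K (SpecialAt.of_kindAt K hz) (SpecialAt.of_kindAt K hz')

end Kit

end TwoHAM

end

/-! ### Stability of the pieces and the bonds between two pieces -/

noncomputable section

namespace TwoHAM

open Assembly Relation

theorem ax_ax (a : Bool) (p : ℤ × ℤ) : ax a (ax a p) = p := by cases a <;> rfl

theorem ax_add (a : Bool) (p q : ℤ × ℤ) : ax a (p + q) = ax a p + ax a q := by cases a <;> rfl

theorem ax_sub (a : Bool) (p q : ℤ × ℤ) : ax a (p - q) = ax a p - ax a q := by cases a <;> rfl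

theorem ax_scale (a : Bool) (n : ℤ) (p : ℤ × ℤ) : ax a (scale n p) = scale n (ax a p) := by
  cases a <;> rfl

theorem vec_cross (a : Bool) : (cross a).vec = ax a (0, 1) := by cases a <;> rfl

theorem cell_scale_two (c : ℤ × ℤ) : cell (scale 2 c) = c := by
  simp [cell, scale]

theorem cell_sub_scale (p q : ℤ × ℤ) (n : ℤ) :
    cell (p - scale (2 * n) q) = cell p - scale n q := by
  rw [sub_eq_add_neg, ← scale_neg, cell_add_scale, scale_neg, sub_eq_add_neg]

theorem cell_ax (a : Bool) (p : ℤ × ℤ) : cell (ax a p) = ax a (cell p) := by cases a <;> rfl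

namespace Kit

variable (K : Kit)

theorem hs : K.τ ≤ (K.τ + 1) / 2 + (K.τ + 1) / 2 := by omega

/-! ### Stability of the pieces -/

theorem isCellular_asm (π : Piece) : IsCellular ((K.τ + 1) / 2) (K.cells π) (K.asm π) := by
  refine ⟨fun p => K.mem_dom_asm, fun p d hp hpd => ?_⟩
  obtain ⟨s, hs⟩ := mem_dom_iff.1 hp
  obtain ⟨t, ht⟩ := mem_dom_iff.1 hpd
  rw [bond_eq, hs, ht, pairBond_some]
  obtain ⟨hc, rfl⟩ := K.asm_eq_some hs
  obtain ⟨hc', rfl⟩ := K.asm_eq_some ht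
  have h1 : K.kindAt π p d = some none := K.kindAt_eq_inner.2 hc'
  have h2 : K.kindAt π (p + d.vec) d.opposite = some none := by
    rw [K.kindAt_eq_inner]; simpa using hc
  simp only [h1, h2, if_true]
  exact le_rfl

section Faces

variable {K} {s : ℕ} {C : Set (ℤ × ℤ)} {α : Assembly}

theorem cellTied_row (h : IsCellular s C α) (hs : K.τ ≤ s + s) {a k : Bool} {l : Fin 3}
    (u : ℤ × ℤ) {x x' y : ℤ} (hx : x ≤ x')
    (hC : ∀ i, x ≤ i → i ≤ x' → K.cellAt a k l i y - u ∈ C) :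
    CellTied K.τ α (K.cellAt a k l x y - u) (K.cellAt a k l x' y - u) := by
  have e (i : ℤ) : K.cellAt a k l i y - u =
      ax a (K.lockX l + i - (ax a u).1, K.portY k + y - (ax a u).2) := by
    cases a <;> rfl
  rw [e, e]
  refine h.cellTied_line hs a (by omega) fun i h1 h2 => ?_
  have := hC (i - K.lockX l + (ax a u).1) (by omega) (by omega)
  rw [e] at this
  convert this using 3
  ring

theorem cellTied_col (h : IsCellular s C α) (hs : K.τ ≤ s + s) {a k : Bool} {l : Fin 3}
    (u : ℤ × ℤ) {x y y' : ℤ} (hy : y ≤ y')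
    (hC : ∀ i, y ≤ i → i ≤ y' → K.cellAt a k l x i - u ∈ C) :
    CellTied K.τ α (K.cellAt a k l x y - u) (K.cellAt a k l x y' - u) := by
  have e (i : ℤ) : K.cellAt a k l x i - u =
      ax a (K.lockX l + x - (ax a u).1, K.portY k + i - (ax a u).2) := by
    cases a <;> rfl
  rw [e, e]
  refine h.cellTied_line' hs a (by omega) fun i h1 h2 => ?_
  have := hC (i - K.portY k + (ax a u).2) (by omega) (by omega)
  rw [e] at this
  convert this using 3
  ring

/-- Every cell of a part of a lock is tied to the column that bounds the lock on its side. -/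
theorem cellTied_face (h : IsCellular s C α) (hs : K.τ ≤ s + s) {r a k : Bool} {l : Fin 3}
    {A : Glue} (u : ℤ × ℤ) (hC : ∀ c, K.FaceMem r a k l A (c + u) → c ∈ C)
    (ht : ∀ y, 0 ≤ y → y < 3 * K.H → K.cellAt a k l (if r then K.w else 0) y - u ∈ C)
    {c : ℤ × ℤ} (hc : K.FaceMem r a k l A (c + u)) :
    ∃ y, 0 ≤ y ∧ y < 3 * K.H ∧
      CellTied K.τ α c (K.cellAt a k l (if r then K.w else 0) y - u) := by
  obtain ⟨x, y, hcu, hx, hxw, hy, hyH, hl⟩ := hc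
  obtain rfl : c = K.cellAt a k l x y - u := by rw [← hcu]; abel
  have mem (x y : ℤ) (hx : 0 < x) (hxw : x < K.w) (hy : 0 ≤ y) (hyH : y < 3 * K.H)
      (hl : K.IsLeft A x y ↔ r = false) : K.cellAt a k l x y - u ∈ C :=
    hC _ ⟨x, y, by abel, hx, hxw, hy, hyH, hl⟩
  cases r
  · simp only [iff_true, Bool.false_eq_true, if_false] at hl ht mem ⊢
    -- Complete rows lead to the bounding column: those congruent to 2 modulo 3, and row 0. A bit
    -- cell in another row rests on the complete row just below it.
    have row (y : ℤ) (hy : 0 ≤ y) (hyH : y < 3 * K.H)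
        (hl : ∀ i, 0 < i → i ≤ x → K.IsLeft A i y) :
        CellTied K.τ α (K.cellAt a k l x y - u) (K.cellAt a k l 0 y - u) := by
      refine (cellTied_row h hs u hx.le fun i h1 h2 => ?_).symm
      rcases h1.eq_or_lt with rfl | h1
      · exact ht y hy hyH
      · exact mem i y h1 (by omega) hy hyH (hl i h1 h2)
    rcases hl with hl | ⟨hl, hbit⟩
    · exact ⟨y, hy, hyH, row y hy hyH fun i _ _ => Or.inl hl⟩
    · by_cases hy0 : y = 0
      · subst hy0
        exact ⟨0, hy, hyH, row 0 hy hyH fun i _ _ => Or.inr ⟨rfl, K.bit_zero A i⟩⟩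
      · have h1 := row (y - 1) (by omega) (by omega) fun i _ _ => Or.inl (by omega)
        refine ⟨y - 1, by omega, by omega, CellTied.trans (CellTied.symm ?_) h1⟩
        refine cellTied_col h hs u (by omega) fun i h1 h2 => ?_
        have : i = y - 1 ∨ i = y := by omega
        rcases this with rfl | rfl
        · exact mem x _ hx hxw (by omega) (by omega) (Or.inl (by omega))
        · exact mem x _ hx hxw (by omega) (by omega) (Or.inr ⟨hl, hbit⟩)
  · simp only [if_true] at ht ⊢
    simp only [Bool.true_eq_false, iff_false] at hl mem
    -- The right part is the mirror case: its complete rows are congruent to 1 modulo 3, and a bit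
    -- cell hangs from the complete row just above it.
    have row (y : ℤ) (hy : 0 ≤ y) (hyH : y < 3 * K.H) (hl : y % 3 = 1) :
        CellTied K.τ α (K.cellAt a k l x y - u) (K.cellAt a k l K.w y - u) := by
      refine cellTied_row h hs u hxw.le fun i h1 h2 => ?_
      rcases h2.eq_or_lt with rfl | h2
      · exact ht y hy hyH
      · exact mem i y (by omega) h2 hy hyH (by simp only [IsLeft]; omega)
    by_cases hy1 : y % 3 = 1
    · exact ⟨y, hy, hyH, row y hy hyH hy1⟩
    · have hy0 : y % 3 = 0 := by
        by_contra hc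
        exact hl (Or.inl (by omega))
      have h1 := row (y + 1) (by omega) (by omega) (by omega)
      refine ⟨y + 1, by omega, by omega, CellTied.trans ?_ h1⟩
      refine cellTied_col h hs u (by omega) fun i h1 h2 => ?_
      have : i = y ∨ i = y + 1 := by omega
      rcases this with rfl | rfl
      · exact mem x _ hx hxw (by omega) (by omega) hl
      · exact mem x _ hx hxw (by omega) (by omega) (by simp only [IsLeft]; omega)

end Faces

theorem mem_cells_of_face {π : Piece} {r a k : Bool} {l : Fin 3} {A : Glue} {o : ℤ × ℤ}
    (h : HasFace π r a k l A o) {x y : ℤ} (hx : 0 < x) (hxw : x < K.w) (hy : 0 ≤ y)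
    (hyH : y < 3 * K.H) (hl : K.IsLeft A x y ↔ r = false) :
    K.cellAt a k l x y - scale K.M o ∈ K.cells π :=
  Or.inr ⟨r, a, k, l, A, o, h, x, y, by abel, hx, hxw, hy, hyH, hl⟩

theorem mem_cells_of_faceMem {π : Piece} {r a k : Bool} {l : Fin 3} {A : Glue} {o c : ℤ × ℤ}
    (h : HasFace π r a k l A o) (hc : K.FaceMem r a k l A (c + scale K.M o)) : c ∈ K.cells π :=
  Or.inr ⟨r, a, k, l, A, o, h, hc⟩

theorem inCore_left (a k : Bool) {y : ℤ} (hy : 0 ≤ y) (hyH : y < 3 * K.H) :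
    K.InCore (K.cellAt a k 0 0 y) := by
  have hw := K.three_le_w
  have hb : K.b = K.w + 6 * K.H := rfl
  have ky := K.portY_cases k
  cases a <;> simp only [InCore, cellAt, ax, lockX, if_true, if_false, Bool.false_eq_true] <;> omega

theorem inCore_right (a k : Bool) {y : ℤ} (hy : 0 ≤ y) (hyH : y < 3 * K.H) :
    K.InCore (K.cellAt a k 2 K.w y - scale K.M (plus a).vec) := by
  have hw := K.three_le_w
  have hb : K.b = K.w + 6 * K.H := rfl
  have hM : K.M = 3 * K.w + 6 * K.H - 1 := rfl
  have ky := K.portY_cases k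
  have l2 : K.lockX 2 = K.b - 1 + 2 * K.w := by simp [lockX]
  cases a <;> simp [InCore, cellAt, ax, l2, plus, Side.vec, scale] <;> omega

/-- The column that bounds a lock on the right is the first column of the next lock. It is the trunk
of a pad, which carries the right part of one lock and the left part of the next. -/
theorem cellAt_succ (a k j : Bool) (y : ℤ) :
    K.cellAt a k (if j then 1 else 0) K.w y = K.cellAt a k (if j then 2 else 1) 0 y := by
  cases j <;> simp [cellAt, lockX]
  ring_nf

/-- All cells are tied to one cell: the core or the trunk is connected by lines, and each tooth
reaches it by `cellTied_face`. -/
theorem asm_stable (π : Piece) : (K.asm π).Stable K.τ := by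
  have hcell := K.isCellular_asm π
  have hw := K.three_le_w
  have hH := K.two_le_H
  have hb : K.b = K.w + 6 * K.H := rfl
  cases π with
  | body t =>
    have core : ∀ c, K.InCore c → c ∈ K.cells (.body t) := fun c hc => Or.inl hc
    have tcore : ∀ c, K.InCore c → CellTied K.τ (K.asm (.body t)) c (K.w, K.w) := by
      rintro ⟨X, Y⟩ ⟨⟨h1, h2⟩, h3, h4⟩
      simp only at h1 h2 h3 h4
      have e1 := hcell.cellTied_line K.hs false (x := K.w) (x' := X) (y := Y) h1
        fun i h5 h6 => core _ (by simp only [InCore, ax]; simp; omega)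
      have e2 := hcell.cellTied_line' K.hs false (x := K.w) (y := K.w) (y' := Y) h3
        fun i h5 h6 => core _ (by simp only [InCore, ax]; simp; omega)
      exact CellTied.symm (CellTied.trans e2 e1)
    refine hcell.stable K.hs (K.w, K.w) fun c hc => ?_
    rcases hc with hc | ⟨r, a, k, l, A, o, hf, hc⟩
    · exact tcore c hc
    · have hf' := hf
      rcases hf with ⟨rfl, rfl, rfl, rfl⟩ | ⟨rfl, rfl, rfl, rfl⟩
      · obtain ⟨y, hy, hyH, h⟩ := cellTied_face hcell K.hs _
          (fun c => K.mem_cells_of_faceMem hf')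
          (fun y hy hyH => core _ (by simpa using K.inCore_left a k hy hyH)) hc
        exact h.trans (tcore _ (by simpa using K.inCore_left a k hy hyH))
      · obtain ⟨y, hy, hyH, h⟩ := cellTied_face hcell K.hs _
          (fun c => K.mem_cells_of_faceMem hf')
          (fun y hy hyH => core _ (K.inCore_right a k hy hyH)) hc
        exact h.trans (tcore _ (K.inCore_right a k hy hyH))
  | pad a k j A =>
    have trunk (y : ℤ) (hy : 0 ≤ y) (hyH : y < 3 * K.H) :
        K.cellAt a k (if j then 2 else 1) 0 y ∈ K.cells (.pad a k j A) :=
      Or.inl ⟨y, rfl, hy, hyH⟩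
    have ttrunk (y : ℤ) (hy : 0 ≤ y) (hyH : y < 3 * K.H) :
        CellTied K.τ (K.asm (.pad a k j A)) (K.cellAt a k (if j then 2 else 1) 0 y)
          (K.cellAt a k (if j then 2 else 1) 0 0) := by
      have := cellTied_col hcell K.hs (a := a) (k := k) (l := if j then 2 else 1) 0 (x := 0) hy
        fun i h1 h2 => by simpa using trunk i h1 (by omega)
      simpa using CellTied.symm this
    refine hcell.stable K.hs (K.cellAt a k (if j then 2 else 1) 0 0) fun c hc => ?_
    rcases hc with ⟨y, rfl, hy, hyH⟩ | ⟨r, a, k, l, A, o, hf, hc⟩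
    · exact ttrunk y hy hyH
    · have hf' := hf
      obtain ⟨rfl, rfl, rfl, rfl, rfl⟩ := hf
      cases r
      · obtain ⟨y, hy, hyH, h⟩ := cellTied_face hcell K.hs _
          (fun c => K.mem_cells_of_faceMem hf')
          (fun y hy hyH => by simpa using trunk y hy hyH) hc
        refine h.trans ?_
        simpa using ttrunk y hy hyH
      · simp only [if_true] at hf' hc
        obtain ⟨y, hy, hyH, h⟩ := cellTied_face hcell K.hs _
          (fun c => K.mem_cells_of_faceMem hf')
          (fun y hy hyH => by simpa [K.cellAt_succ] using trunk y hy hyH) hc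
        refine h.trans ?_
        simpa [K.cellAt_succ] using ttrunk y hy hyH

theorem exists_mem_cells (π : Piece) : ∃ c, c ∈ K.cells π := by
  have hw := K.three_le_w
  have hH := K.two_le_H
  cases π with
  | body t => exact ⟨_, Or.inl (K.inCore_left false false le_rfl (by omega))⟩
  | pad a k j A => exact ⟨_, Or.inl ⟨0, rfl, le_rfl, by omega⟩⟩

theorem scale_mem_dom {π : Piece} {c : ℤ × ℤ} (h : c ∈ K.cells π) : scale 2 c ∈ (K.asm π).dom := by
  rwa [mem_dom_asm, cell_scale_two]

theorem asm_nonempty (π : Piece) : (K.asm π).dom.Nonempty := by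
  obtain ⟨c, hc⟩ := K.exists_mem_cells π
  exact ⟨_, K.scale_mem_dom hc⟩

/-! ### Extent of the pieces -/

theorem body_extent {t : TileType} {c : ℤ × ℤ} (h : c ∈ K.cells (.body t)) :
    (0 ≤ c.1 ∧ c.1 < K.M) ∧ 0 ≤ c.2 ∧ c.2 < K.M := by
  have hw := K.three_le_w
  have hH := K.two_le_H
  have hb : K.b = K.w + 6 * K.H := rfl
  have hM : K.M = 3 * K.w + 6 * K.H - 1 := rfl
  rcases h with ⟨⟨h1, h2⟩, h3, h4⟩ | ⟨r, a, k, l, A, o, hf, x, y, hc, hx, hxw, hy, hyH, -⟩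
  · omega
  · have ky := K.portY_cases k
    have lx := K.lockX_cases l
    have e1 := congrArg Prod.fst hc
    have e2 := congrArg Prod.snd hc
    rcases hf with ⟨rfl, rfl, -, rfl⟩ | ⟨rfl, rfl, -, rfl⟩ <;> cases a <;>
      simp [cellAt, ax, scale, plus, Side.vec] at e1 e2 lx <;> omega

theorem pad_extent {a k j : Bool} {A : Glue} {c : ℤ × ℤ} (h : c ∈ K.cells (.pad a k j A)) :
    ((if j then K.b + K.w else K.b) ≤ (ax a c).1 ∧
      (ax a c).1 < (if j then K.M + K.w else K.M)) ∧ 0 ≤ (ax a c).2 ∧ (ax a c).2 < K.M := by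
  have hw := K.three_le_w
  have hH := K.two_le_H
  have hb : K.b = K.w + 6 * K.H := rfl
  have hM : K.M = 3 * K.w + 6 * K.H - 1 := rfl
  rcases h with ⟨y, rfl, hy, hyH⟩ | ⟨r, a, k, l, A, o, hf, x, y, hc, hx, hxw, hy, hyH, -⟩
  · have ky := K.portY_cases k
    rw [cellAt, ax_ax]
    cases j <;> simp [lockX] <;> omega
  · obtain ⟨rfl, rfl, rfl, rfl, rfl⟩ := hf
    have ky := K.portY_cases k
    simp only [scale_zero, add_zero] at hc
    rw [hc, cellAt, ax_ax]
    cases j <;> cases r <;> simp [lockX] <;> omega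

theorem asm_finite (π : Piece) : (K.asm π).dom.Finite := by
  have hw := K.three_le_w
  have hb : K.b = K.w + 6 * K.H := rfl
  have hH := K.two_le_H
  have hM : K.M = 3 * K.w + 6 * K.H - 1 := rfl
  refine ((Set.finite_Icc (0 : ℤ) (4 * K.M)).prod (Set.finite_Icc (0 : ℤ) (4 * K.M))).subset ?_
  intro p hp
  rw [mem_dom_asm] at hp
  simp only [Set.mem_prod, Set.mem_Icc]
  cases π with
  | body t =>
    have := K.body_extent hp
    simp only [cell] at this
    omega
  | pad a k j A =>
    have := K.pad_extent hp
    cases a <;> cases j <;> simp [cell, ax] at this <;> omega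

/-! ### Matching glues -/

/-- The codes of all glues of the piece are separated. -/
def Coded (π : Piece) : Prop := ∀ r a k l A o, HasFace π r a k l A o → A ∈ K.labels

theorem cell_slotPos (a k : Bool) (l : Fin 3) (x : ℤ) :
    cell (K.slotPos a k l x) = K.cellAt a k l x 0 := by
  rw [slotPos, cell_ax, cellAt]
  congr 1
  simp only [cell, Prod.mk.injEq]
  omega

theorem cell_slotPos_add (a k : Bool) (l : Fin 3) (x : ℤ) :
    cell (K.slotPos a k l x + (cross a).vec) = K.cellAt a k l x 1 := by
  rw [slotPos, vec_cross, ← ax_add, cell_ax, cellAt]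
  congr 1
  simp only [cell, Prod.mk_add_mk, Prod.mk.injEq]
  omega

theorem slotPos_sub (a k : Bool) (l : Fin 3) (x x' : ℤ) :
    K.slotPos a k l x - K.slotPos a k l x' = scale 2 (K.cellAt a k l x 0 - K.cellAt a k l x' 0) := by
  simp only [slotPos, cellAt, ← ax_sub, ← ax_scale]
  congr 1
  simp [scale]
  ring

/-- A bit of `A` that is missing in `B` would put a cell of the left part for `A` on a cell of the
right part for `B`. Containment of the bits in one direction is enough, as the codes are separated.
-/
theorem label_eq_of_disjoint {π π' : Piece} {a k : Bool} {l : Fin 3} {A B : Glue} {o o' : ℤ × ℤ}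
    (hf : HasFace π false a k l A o) (hf' : HasFace π' true a k l B o')
    (hA : A ∈ K.labels) (hB : B ∈ K.labels)
    (hd : Disjoint (K.asm π).dom ((K.asm π').translate (scale (2 * K.M) (o' - o))).dom) :
    A = B := by
  refine K.separated A hA B hB fun x i hx hxw hi hiH hb => ?_
  by_contra hb'
  have h3 : 3 * i % 3 = 0 := by omega
  have h3' : 3 * i / 3 = i := by omega
  have m1 := K.mem_cells_of_face hf hx hxw (y := 3 * i) (by omega) (by omega)
    (iff_of_true (Or.inr ⟨h3, by rwa [h3']⟩) rfl)
  have m2 := K.mem_cells_of_face hf' hx hxw (y := 3 * i) (by omega) (by omega)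
    (iff_of_false (by simp only [IsLeft, h3, h3']; simp [hb']) (by simp))
  refine Set.disjoint_left.1 hd (K.scale_mem_dom m1) ?_
  rw [mem_dom_translate, mem_dom_asm, cell_sub_scale, cell_scale_two]
  convert m2 using 1
  rw [scale_sub]
  abel

/-- In a middle lock the same special glue occurs in many columns, so two pads might bind while
shifted along the lock. The geometry excludes this for either direction of the shift. -/
theorem shift_eq_of_disjoint {a k : Bool} {A B : Glue} {x x' : ℤ} (hx : 0 < x) (hxw : x < K.w)
    (hx' : 0 < x') (hxw' : x' < K.w)
    (hd : Disjoint (K.asm (.pad a k false A)).dom ((K.asm (.pad a k true B)).translate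
      (K.slotPos a k 1 x - K.slotPos a k 1 x')).dom) : x = x' := by
  have hH := K.two_le_H
  have hfA : HasFace (.pad a k false A) false a k 1 A 0 := ⟨rfl, rfl, rfl, rfl, rfl⟩
  have hfB : HasFace (.pad a k true B) true a k 1 B 0 := ⟨rfl, rfl, rfl, rfl, rfl⟩
  have key (c c' : ℤ × ℤ) (h : c ∈ K.cells (.pad a k false A))
      (h' : c' ∈ K.cells (.pad a k true B))
      (he : c - c' = K.cellAt a k 1 x 0 - K.cellAt a k 1 x' 0) : False := by
    refine Set.disjoint_left.1 hd (K.scale_mem_dom h) ?_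
    rw [mem_dom_translate, slotPos_sub, ← he, ← scale_sub, sub_sub_cancel]
    exact K.scale_mem_dom h'
  have hsub (x y x' y' : ℤ) : K.cellAt a k 1 x y - K.cellAt a k 1 x' y' = ax a (x - x', y - y') := by
    simp only [cellAt, ← ax_sub, Prod.mk_sub_mk]
    congr 2 <;> ring
  rcases lt_trichotomy x x' with h | h | h
  · exfalso
    -- The upper pad is shifted toward the lower one, and its trunk hits row 2, which is complete in
    -- the left part.
    have m1 := K.mem_cells_of_face hfA (x := K.w + x - x') (y := 2) (by omega) (by omega)
      (by omega) (by omega) (iff_of_true (Or.inl rfl) rfl)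
    have m2 : K.cellAt a k 1 K.w 2 ∈ K.cells (.pad a k true B) := by
      rw [show K.cellAt a k 1 K.w 2 = K.cellAt a k 2 0 2 from K.cellAt_succ a k true 2]
      exact Or.inl ⟨2, rfl, by omega, by omega⟩
    refine key _ _ m1 m2 ?_
    rw [scale_zero, sub_zero, hsub, hsub]
    congr 2
    ring
  · exact h
  · exfalso
    -- The upper pad is shifted away. Its cell in column 1 of the alignment row `y = 3` no longer
    -- meets the gap of the lower pad.
    have m1 := K.mem_cells_of_face hfA (x := 1 + (x - x')) (y := 3) (by omega) (by omega)
      (by omega) (by omega) (iff_of_true (Or.inr ⟨rfl, (K.bit_one A _).2 (by omega)⟩) rfl)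
    have m2 := K.mem_cells_of_face hfB (x := 1) (y := 3) (by omega) (by omega)
      (by omega) (by omega) (iff_of_false (by
        rintro (h | ⟨-, h⟩)
        · omega
        · exact (K.bit_one B 1).1 h rfl) (by simp))
    refine key _ _ m1 m2 ?_
    simp only [scale_zero, sub_zero, hsub]
    congr 2
    ring

/-- An inner glue always faces a cell of its own piece, so disjoint pieces can bind by special glues
only. -/
theorem exists_special_of_match {π π' : Piece} {u p : ℤ × ℤ} {d : Side}
    (hd : Disjoint (K.asm π).dom ((K.asm π').translate u).dom) {s t : TileType}
    (hs : K.asm π p = some s) (ht : K.asm π' (p + d.vec - u) = some t)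
    (hst : s d = t d.opposite) (h0 : (s d).strength ≠ 0) :
    ∃ z, s d = kindGlue K.τ (some (some z)) ∧ K.SpecialAt π p d z ∧
      K.SpecialAt π' (p + d.vec - u) d.opposite z := by
  have hp' : p + d.vec ∉ (K.asm π).dom := fun h =>
    Set.disjoint_left.1 hd h (mem_dom_translate.2 (mem_dom_of_eq ht))
  obtain ⟨-, rfl⟩ := K.asm_eq_some hs
  obtain ⟨-, rfl⟩ := K.asm_eq_some ht
  simp only at hst h0
  have hk := kindGlue_injective _ hst
  rcases hκ : K.kindAt π p d with _ | _ | z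
  · rw [hκ] at h0
    exact absurd rfl h0
  · rw [kindAt_eq_inner, ← mem_dom_asm] at hκ
    exact absurd hκ hp'
  · exact ⟨z, by simp only [hκ], SpecialAt.of_kindAt K hκ,
      SpecialAt.of_kindAt K (hk.symm.trans hκ)⟩

/-- If two disjoint placed pieces bind, then they fit together in a lock, at the position of a
special glue. -/
theorem match_cases {π π' : Piece} {u p : ℤ × ℤ} {a : Bool} (hπ : K.Coded π) (hπ' : K.Coded π')
    (hd : Disjoint (K.asm π).dom ((K.asm π').translate u).dom) {s t : TileType}
    (hs : K.asm π p = some s) (ht : K.asm π' (p + (cross a).vec - u) = some t)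
    (hst : s (cross a) = t (cross a).opposite) (h0 : (s (cross a)).strength ≠ 0) :
    ∃ k l A o o' x i, HasFace π false a k l A o ∧ HasFace π' true a k l A o' ∧
      u = scale (2 * K.M) (o' - o) ∧ 0 < x ∧ x < K.w ∧ K.slot l k A x = some i ∧
      p + scale (2 * K.M) o = K.slotPos a k l x ∧
      (s (cross a)).strength = kindStrength K.τ (some (some (a, k, l, i))) := by
  obtain ⟨⟨a', k, l, i⟩, hz, h1, h2⟩ := K.exists_special_of_match hd hs ht hst h0
  obtain ⟨r, A, o, x, hf, hx, hxw, hsl, hdr, hp⟩ := h1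
  obtain ⟨r', B, o', x', hf', hx', hxw', hsl', hdr', hp'⟩ := h2
  simp only at *
  obtain ⟨rfl, rfl⟩ : r = false ∧ a = a' := by
    cases r <;> cases a <;> cases a' <;> simp [cross, plus, Side.opposite] at hdr ⊢
  obtain rfl : r' = true := by
    cases r' <;> cases a <;> simp [cross, plus, Side.opposite] at hdr' ⊢
  simp only [Bool.false_eq_true, if_false, add_zero, if_true] at hp hp'
  have hu : u = (K.slotPos a k l x - K.slotPos a k l x') + scale (2 * K.M) (o' - o) := by
    rw [← hp, eq_sub_of_add_eq hp'.symm, scale_sub]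
    abel
  -- In an outer lock the index of the glue determines its column; in the middle lock the alignment
  -- row does.
  have hxx : x = x' := by
    by_cases hl : l = 1
    · subst hl
      cases π with
      | body t => rcases hf with ⟨-, h, -⟩ | ⟨-, h, -⟩ <;> simp at h
      | pad a₁ k₁ j A₁ =>
        obtain ⟨rfl, rfl, rfl, rfl, h⟩ := hf
        obtain rfl : j = false := by cases j <;> simp at h ⊢
        cases π' with
        | body t => rcases hf' with ⟨-, h, -⟩ | ⟨-, h, -⟩ <;> simp at h
        | pad a₂ k₂ j B₁ =>
          obtain ⟨rfl, rfl, rfl, rfl, h'⟩ := hf'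
          obtain rfl : j = true := by cases j <;> simp at h' ⊢
          rw [hu, sub_zero, scale_zero, add_zero] at hd
          exact K.shift_eq_of_disjoint hx hxw hx' hxw' hd
    · rw [K.slot_of_ne hl hsl, K.slot_of_ne hl hsl']
  subst hxx
  rw [sub_self, zero_add] at hu
  subst hu
  obtain rfl := K.label_eq_of_disjoint hf hf' (hπ _ _ _ _ _ _ hf) (hπ' _ _ _ _ _ _ hf') hd
  exact ⟨k, l, A, o, o', x, i, hf, hf', rfl, hx, hxw, hsl, hp, by rw [hz]; rfl⟩

theorem pairBond_slot {π π' : Piece} {a k : Bool} {l : Fin 3} {A : Glue} {o o' u : ℤ × ℤ}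
    (hf : HasFace π false a k l A o) (hf' : HasFace π' true a k l A o')
    (hu : u = scale (2 * K.M) (o' - o)) {x : ℤ} {i : Bool} (hx : 0 < x) (hxw : x < K.w)
    (hsl : K.slot l k A x = some i)
    (hd : Disjoint (K.asm π).dom ((K.asm π').translate u).dom) {p : ℤ × ℤ}
    (hp : p + scale (2 * K.M) o = K.slotPos a k l x) :
    pairBond (K.asm π p) (K.asm π' (p + (cross a).vec - u)) (cross a) =
      kindStrength K.τ (some (some (a, k, l, i))) := by
  have hH := K.two_le_H
  obtain rfl := eq_sub_of_add_eq hp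
  set p := K.slotPos a k l x - scale (2 * K.M) o with hpd
  have hpu : p + (cross a).vec - u =
      K.slotPos a k l x + (cross a).vec - scale (2 * K.M) o' := by
    rw [hu, hpd, scale_sub]; abel
  have m1 : p ∈ (K.asm π).dom := by
    rw [mem_dom_asm, hpd, cell_sub_scale, cell_slotPos]
    exact K.mem_cells_of_face hf hx hxw le_rfl (by omega)
      (iff_of_true (Or.inr ⟨rfl, K.bit_zero A x⟩) rfl)
  have m2 : p + (cross a).vec - u ∈ (K.asm π').dom := by
    rw [hpu, mem_dom_asm, cell_sub_scale, cell_slotPos_add]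
    exact K.mem_cells_of_face hf' hx hxw (by omega) (by omega)
      (iff_of_false (by simp only [IsLeft]; omega) (by simp))
  obtain ⟨s, hs⟩ := mem_dom_iff.1 m1
  obtain ⟨t, ht⟩ := mem_dom_iff.1 m2
  rw [hs, ht, pairBond_some]
  obtain ⟨-, rfl⟩ := K.asm_eq_some hs
  obtain ⟨-, rfl⟩ := K.asm_eq_some ht
  have k1 : K.kindAt π p (cross a) = some (some (a, k, l, i)) := by
    refine SpecialAt.kindAt_eq K ⟨false, A, o, x, hf, hx, hxw, hsl, rfl, ?_⟩ ?_
    · simp [hpd]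
    · rw [← mem_dom_asm]
      exact fun h => Set.disjoint_left.1 hd h m2
  have k2 : K.kindAt π' (p + (cross a).vec - u) (cross a).opposite =
      some (some (a, k, l, i)) := by
    refine SpecialAt.kindAt_eq K ⟨true, A, o', x, hf', hx, hxw, hsl, rfl, ?_⟩ ?_
    · simp [hpu]
    · rw [← mem_dom_asm]
      refine fun h => Set.disjoint_left.1 hd m1 (mem_dom_translate.2 ?_)
      convert h using 1
      simp only [Side.vec_opposite]
      abel
  simp only [k1, k2, if_true]
  rfl

/-- A piece with the left part and a piece with the right part of an outer lock bind with
strength at least `τ`. -/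
theorem mount_link {π π' : Piece} {a k : Bool} {l : Fin 3} {A : Glue} {o o' : ℤ × ℤ} (hl : l ≠ 1)
    (hf : HasFace π false a k l A o) (hf' : HasFace π' true a k l A o')
    (hd : Disjoint (K.asm π).dom ((K.asm π').translate (scale (2 * K.M) (o' - o))).dom) :
    (K.τ : ℝ≥0∞) ≤ link (K.asm π) ((K.asm π').translate (scale (2 * K.M) (o' - o))) := by
  classical
  have hw := K.three_le_w
  have s1 : K.slot l k A 1 = some false := by simp [slot, hl]
  have s2 : K.slot l k A 2 = some true := by simp [slot, hl]
  have b1 := K.pairBond_slot hf hf' rfl (by omega) (by omega) s1 hd (sub_add_cancel _ _)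
  have b2 := K.pairBond_slot hf hf' rfl (by omega) (by omega) s2 hd (sub_add_cancel _ _)
  have hst (i : Bool) : kindStrength K.τ (some (some (a, k, l, i))) = (K.τ + 1) / 2 := by
    simp [kindStrength, hl]
  rw [hst] at b1 b2
  refine le_trans ?_ (ENNReal.sum_le_tsum {(K.slotPos a k l 1 - scale (2 * K.M) o, cross a),
    (K.slotPos a k l 2 - scale (2 * K.M) o, cross a)})
  rw [Finset.sum_pair]
  · simp only [translate_apply, b1, b2]
    rw [← Nat.cast_add]
    exact Nat.cast_le.2 K.hs
  · intro h
    have h := congrArg Prod.fst h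
    simp only [sub_left_inj] at h
    simpa using (K.slotPos_injective h).2

/-! ### The bodies determine the tile types -/

theorem mem_cells_body_left {t : TileType} {a : Bool} {x y : ℤ} (hx : 0 < x) (hxw : x < K.w)
    (hy : 0 ≤ y) (hyH : y < 3 * K.H) :
    K.cellAt a false 0 x y ∈ K.cells (.body t) ↔ K.IsLeft (t (plus a)) x y := by
  constructor
  · intro h
    have h : K.cellAt a false 0 x y - scale K.M 0 ∈ K.cells (.body t) := by simpa using h
    rcases K.mem_cells_cases h with ⟨t', d, -, hc, hd⟩ | ⟨a', k', j', A', y', h', -⟩ |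
      ⟨r', a', k', l', A', o', x', y', hf', hc', hx', hxw', hy', hyH', hl'⟩
    · refine absurd hc.symm (?_ : _ ≠ _)
      have := K.core_ne_cellAt (q := 0) (q' := 0) (a := a) (k := false) (l := 0) (x := x) (y := y)
        hd ⟨by omega, by omega, by omega, hy, hyH⟩
      simpa using this
    · simp at h'
    · have hc : scale K.M 0 + K.cellAt a false 0 x y =
        scale K.M (0 - o') + K.cellAt a' k' l' x' y' := by rw [← hc']; simp
      obtain ⟨-, rfl, rfl, rfl, rfl, rfl⟩ := K.cellAt_injective hc
        ⟨by omega, by omega, fun _ => hx, hy, hyH⟩ ⟨by omega, by omega, fun _ => hx', hy', hyH'⟩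
      rcases hf' with ⟨rfl, -, rfl, -⟩ | ⟨-, h, -⟩
      · exact hl'.2 rfl
      · simp at h
  · intro h
    have := K.mem_cells_of_face (π := .body t) (r := false) (a := a) (k := false) (l := 0)
      (A := t (plus a)) (o := 0) (Or.inl ⟨rfl, rfl, rfl, rfl⟩) hx hxw hy hyH (iff_of_true h rfl)
    simpa using this

theorem mem_cells_body_right {t : TileType} {a : Bool} {x y : ℤ} (hx : 0 < x) (hxw : x < K.w)
    (hy : 0 ≤ y) (hyH : y < 3 * K.H) :
    K.cellAt a false 2 x y - scale K.M (plus a).vec ∈ K.cells (.body t) ↔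
      ¬ K.IsLeft (t (plus a).opposite) x y := by
  constructor
  · intro h
    have h : K.cellAt a false 2 x y - scale K.M (plus a).vec - scale K.M 0 ∈ K.cells (.body t) := by
      simpa using h
    rcases K.mem_cells_cases h with ⟨t', d, -, hc, hd⟩ | ⟨a', k', j', A', y', h', -⟩ |
      ⟨r', a', k', l', A', o', x', y', hf', hc', hx', hxw', hy', hyH', hl'⟩
    · have := K.core_ne_cellAt (q := 0) (q' := -(plus a).vec) (a := a) (k := false) (l := 2)
        (x := x) (y := y) hd ⟨by omega, by omega, by omega, hy, hyH⟩
      refine absurd ?_ this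
      rw [← hc, scale_neg]
      abel
    · simp at h'
    · have hc : scale K.M (-(plus a).vec) + K.cellAt a false 2 x y =
        scale K.M (0 - o') + K.cellAt a' k' l' x' y' := by rw [← hc', scale_neg]; abel
      obtain ⟨-, rfl, rfl, rfl, rfl, rfl⟩ := K.cellAt_injective hc
        ⟨by omega, by omega, fun _ => hx, hy, hyH⟩ ⟨by omega, by omega, fun _ => hx', hy', hyH'⟩
      rcases hf' with ⟨-, h, -⟩ | ⟨rfl, -, rfl, -⟩
      · simp at h
      · exact fun h => by simpa using hl'.1 h
  · intro h
    exact K.mem_cells_of_face (π := .body t) (r := true) (a := a) (k := false) (l := 2)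
      (A := t (plus a).opposite) (o := (plus a).vec) (Or.inr ⟨rfl, rfl, rfl, rfl⟩) hx hxw hy hyH
      (iff_of_false h (by simp))

/-- A tile shows by an inner glue whether the next cell belongs to its own piece. This information
survives when other pieces fill the surroundings. -/
theorem mem_cells_iff_of_asm_eq {π π' : Piece} {p : ℤ × ℤ} (hp : p ∈ (K.asm π).dom)
    (h : K.asm π p = K.asm π' p) (d : Side) :
    cell (p + d.vec) ∈ K.cells π ↔ cell (p + d.vec) ∈ K.cells π' := by
  obtain ⟨s, hs⟩ := mem_dom_iff.1 hp
  have hs' := h ▸ hs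
  obtain ⟨-, rfl⟩ := K.asm_eq_some hs
  obtain ⟨-, h'⟩ := K.asm_eq_some hs'
  have := kindGlue_injective _ (congrFun h' d)
  rw [← kindAt_eq_inner, ← kindAt_eq_inner, this]

/-- Occupied positions alone do not determine the body inside a configuration, because pads may fill
the gaps of its teeth. The code is read from the inner glues of the complete rows that adjoin the
bit rows. -/
theorem body_eq_of_sub {t t' : TileType} (ht : K.Coded (.body t)) (ht' : K.Coded (.body t'))
    {α : Assembly} (h : (K.asm (.body t)).Sub α) (h' : (K.asm (.body t')).Sub α) : t = t' := by
  have hl (t : TileType) (ht : K.Coded (.body t)) (a : Bool) : t (plus a) ∈ K.labels :=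
    ht false a false 0 _ 0 (Or.inl ⟨rfl, rfl, rfl, rfl⟩)
  have hr (t : TileType) (ht : K.Coded (.body t)) (a : Bool) : t (plus a).opposite ∈ K.labels :=
    ht true a false 2 _ _ (Or.inr ⟨rfl, rfl, rfl, rfl⟩)
  have key {p : ℤ × ℤ} (hp : cell p ∈ K.cells (.body t)) (hp' : cell p ∈ K.cells (.body t'))
      (d : Side) : cell (p + d.vec) ∈ K.cells (.body t) ↔ cell (p + d.vec) ∈ K.cells (.body t') :=
    K.mem_cells_iff_of_asm_eq (K.mem_dom_asm.2 hp)
      ((h p (K.mem_dom_asm.2 hp)).trans (h' p (K.mem_dom_asm.2 hp')).symm) d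
  have h1 (a : Bool) : t (plus a) = t' (plus a) := by
    refine K.separated _ (hl t ht a) _ (hl t' ht' a) fun x i hx hxw hi hiH hb => ?_
    have i0 : 3 * i % 3 = 0 := by omega
    have i1 : 3 * i / 3 = i := by omega
    -- This is the upper row of tiles of a cell in row `3 * i - 1`, which is complete in both
    -- bodies. The next tile across lies in bit row `i`.
    have hc : cell (scale 2 (K.cellAt a false 0 x (3 * i - 1)) + (cross a).vec) =
        K.cellAt a false 0 x (3 * i - 1) := by
      cases a <;> simp [cellAt, scale, ax, cell, cross, plus, Side.vec] <;> omega
    have hc' : cell (scale 2 (K.cellAt a false 0 x (3 * i - 1)) + (cross a).vec + (cross a).vec) =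
        K.cellAt a false 0 x (3 * i) := by
      cases a <;> simp [cellAt, scale, ax, cell, cross, plus, Side.vec] <;> omega
    have := @key (scale 2 (K.cellAt a false 0 x (3 * i - 1)) + (cross a).vec)
      (by rw [hc, K.mem_cells_body_left hx hxw (by omega) (by omega)]; exact Or.inl (by omega))
      (by rw [hc, K.mem_cells_body_left hx hxw (by omega) (by omega)]; exact Or.inl (by omega))
      (cross a)
    rw [hc', K.mem_cells_body_left hx hxw (by omega) (by omega),
      K.mem_cells_body_left hx hxw (by omega) (by omega)] at this
    rcases this.1 (Or.inr ⟨i0, by rwa [i1]⟩) with h2 | ⟨-, h2⟩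
    · omega
    · rwa [i1] at h2
  have h2 (a : Bool) : t (plus a).opposite = t' (plus a).opposite := by
    -- The right part has its cells where the bits are absent, so the containment of bits is used
    -- with the two tiles exchanged.
    symm
    refine K.separated _ (hr t' ht' a) _ (hr t ht a) fun x i hx hxw hi hiH hb => ?_
    have i0 : 3 * i % 3 = 0 := by omega
    have i1 : 3 * i / 3 = i := by omega
    have hc' : cell (scale 2 (K.cellAt a false 2 x (3 * i + 1) - scale K.M (plus a).vec) +
        (cross a).opposite.vec) = K.cellAt a false 2 x (3 * i) - scale K.M (plus a).vec := by
      cases a <;> simp [cellAt, scale, ax, cell, cross, plus, Side.vec, Side.opposite] <;> omega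
    have := @key (scale 2 (K.cellAt a false 2 x (3 * i + 1) - scale K.M (plus a).vec))
      (by rw [cell_scale_two, K.mem_cells_body_right hx hxw (by omega) (by omega)]
          simp only [IsLeft]; omega)
      (by rw [cell_scale_two, K.mem_cells_body_right hx hxw (by omega) (by omega)]
          simp only [IsLeft]; omega)
      (cross a).opposite
    rw [hc', K.mem_cells_body_right hx hxw (by omega) (by omega),
      K.mem_cells_body_right hx hxw (by omega) (by omega), not_iff_not] at this
    rcases this.2 (Or.inr ⟨i0, by rwa [i1]⟩) with h2 | ⟨-, h2⟩
    · omega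
    · rwa [i1] at h2
  funext d
  cases d
  · exact h1 true
  · exact h1 false
  · exact h2 true
  · exact h2 false

/-- On a north side this glue belongs to the left part of lock 0, which only bodies have, and
outside the middle lock the index fixes the column. It locates bodies exactly. -/
theorem marker_unique {π : Piece} {p : ℤ × ℤ}
    (h : K.SpecialAt π p .north (false, false, 0, false)) :
    (∃ t, π = .body t) ∧ p = K.slotPos false false 0 1 := by
  obtain ⟨r, A, o, x, hf, hx, hxw, hsl, hdr, hp⟩ := h
  simp only at *
  obtain rfl : r = false := by
    cases r <;> simp [cross, plus, Side.opposite] at hdr ⊢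
  have hx1 := K.slot_of_ne (by simp) hsl
  simp only [Bool.false_eq_true, if_false] at hx1
  subst hx1
  cases π with
  | body t =>
    rcases hf with ⟨-, -, -, rfl⟩ | ⟨h, -⟩
    · exact ⟨⟨t, rfl⟩, by simpa using hp⟩
    · simp at h
  | pad a₁ k₁ j A₁ =>
    obtain ⟨-, -, -, -, h⟩ := hf
    cases j <;> simp at h

theorem marker_body (t : TileType) :
    K.slotPos false false 0 1 ∈ (K.asm (.body t)).dom ∧
      K.kindAt (.body t) (K.slotPos false false 0 1) .north =
        some (some (false, false, 0, false)) := by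
  have hw := K.three_le_w
  have hH := K.two_le_H
  constructor
  · rw [mem_dom_asm, cell_slotPos, K.mem_cells_body_left (by omega) (by omega) le_rfl (by omega)]
    exact Or.inr ⟨rfl, K.bit_zero _ _⟩
  · refine SpecialAt.kindAt_eq K ⟨false, t .east, 0, 1, Or.inl ⟨rfl, rfl, rfl, rfl⟩, by omega,
      by omega, by simp [slot], rfl, by simp⟩ ?_
    have := K.cell_slotPos_add false false 0 1
    rw [show (cross false) = Side.north from rfl] at this
    rw [this, K.mem_cells_body_left (by omega) (by omega) (by omega) (by omega)]
    simp only [IsLeft]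
    omega

end Kit

end TwoHAM

end

/-! ### Configurations of bodies and mounted pads -/

noncomputable section

namespace TwoHAM

open Assembly Relation

theorem Assembly.union_eq_some_iff {α β : Assembly} (hd : Disjoint α.dom β.dom) {p : ℤ × ℤ}
    {t : TileType} : α.union β p = some t ↔ α p = some t ∨ β p = some t :=
  ⟨union_eq_some, fun h => h.elim sub_union_left.apply_eq_some
    (sub_union_right hd).apply_eq_some⟩

/-! ### Configurations -/

/-- A set of positions of pads: macrotile position, axis, port, and which of the two pads. -/
abbrev PadSet := Set ((ℤ × ℤ) × Bool × Bool × Bool)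

/-- The position of the macrotile on which a pad is mounted. -/
def owner (q : ℤ × ℤ) (a j : Bool) : ℤ × ℤ := if j then q + (plus a).vec else q

/-- The side of its macrotile on which a pad is mounted. -/
def padSide (a j : Bool) : Side := if j then (plus a).opposite else plus a

/-- The pads in `P` are mounted on tiles of `β`, and opposite pads have equal labels. -/
structure Consistent (β : Assembly) (P : PadSet) : Prop where
  owner_mem : ∀ q a k j, (q, a, k, j) ∈ P → owner q a j ∈ β.dom
  agree : ∀ q a k t t', (q, a, k, false) ∈ P → (q, a, k, true) ∈ P → β q = some t →
    β (q + (plus a).vec) = some t' → t (plus a) = t' (plus a).opposite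

/-- The placed pieces of a configuration. -/
def Placed (β : Assembly) (P : PadSet) : Set (Piece × ℤ × ℤ) :=
  {x | (∃ t, x.1 = .body t ∧ β x.2 = some t) ∨
    ∃ a k j t, x.1 = .pad a k j (t (padSide a j)) ∧ (x.2, a, k, j) ∈ P ∧
      β (owner x.2 a j) = some t}

/-- The translate of a set of pads. -/
def PadSet.shift (P : PadSet) (v : ℤ × ℤ) : PadSet := {x | (x.1 - v, x.2) ∈ P}

theorem owner_sub (q v : ℤ × ℤ) (a j : Bool) : owner (q - v) a j = owner q a j - v := by
  cases j <;> simp [owner]; abel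

theorem Consistent.mono {β : Assembly} {P P' : PadSet} (h : Consistent β P') (hP : P ⊆ P') :
    Consistent β P :=
  ⟨fun q a k j hq => h.owner_mem q a k j (hP hq),
    fun q a k t t' h1 h2 => h.agree q a k t t' (hP h1) (hP h2)⟩

theorem Consistent.translate {β : Assembly} {P : PadSet} (h : Consistent β P) (v : ℤ × ℤ) :
    Consistent (β.translate v) (P.shift v) := by
  refine ⟨fun q a k j hq => ?_, fun q a k t t' h1 h2 h3 h4 => ?_⟩
  · have := h.owner_mem _ _ _ _ hq
    rwa [owner_sub] at this
  · refine h.agree (q - v) a k t t' h1 h2 h3 ?_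
    rw [← h4, translate_apply]
    congr 1
    abel

theorem Placed.mono {β β' : Assembly} {P P' : PadSet} (hβ : β.Sub β') (hP : P ⊆ P') :
    Placed β P ⊆ Placed β' P' := by
  rintro x (⟨t, h1, h2⟩ | ⟨a, k, j, t, h1, h2, h3⟩)
  · exact Or.inl ⟨t, h1, hβ.apply_eq_some h2⟩
  · exact Or.inr ⟨a, k, j, t, h1, hP h2, hβ.apply_eq_some h3⟩

theorem mem_placed_face {β : Assembly} {P : PadSet} {x : Piece × ℤ × ℤ}
    (hx : x ∈ Placed β P) {r a k : Bool} {l : Fin 3} {A : Glue} {o : ℤ × ℤ}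
    (hf : Kit.HasFace x.1 r a k l A o) :
    (∃ t, x.1 = .body t ∧ β x.2 = some t ∧
      ((r = false ∧ l = 0 ∧ A = t (plus a) ∧ o = 0) ∨
        (r = true ∧ l = 2 ∧ A = t (plus a).opposite ∧ o = (plus a).vec))) ∨
    ∃ j t, x.1 = .pad a k j A ∧ (x.2, a, k, j) ∈ P ∧ β (owner x.2 a j) = some t ∧
      A = t (padSide a j) ∧ o = 0 ∧
      l = if j then (if r then 1 else 2) else (if r then 0 else 1) := by
  rcases hx with ⟨t, h1, h2⟩ | ⟨a', k', j, t, h1, h2, h3⟩ <;> rw [h1] at hf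
  · exact Or.inl ⟨t, h1, h2, hf⟩
  · obtain ⟨rfl, rfl, rfl, rfl, hl⟩ := hf
    exact Or.inr ⟨j, t, h1, h2, h3, rfl, rfl, hl⟩

namespace Kit

variable (K : Kit)

/-- All glues of the tiles of `β` are coded by separated codes. -/
def Labeled (β : Assembly) : Prop := ∀ q t d, β q = some t → t d ∈ K.labels

variable {K}

theorem Labeled.coded {β : Assembly} (h : K.Labeled β) {P : PadSet} {x : Piece × ℤ × ℤ}
    (hx : x ∈ Placed β P) : K.Coded x.1 := by
  intro r a k l A o hf
  rcases hx with ⟨t, h1, h2⟩ | ⟨a', k', j, t, h1, h2, h3⟩ <;> rw [h1] at hf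
  · rcases hf with ⟨-, -, rfl, -⟩ | ⟨-, -, rfl, -⟩ <;> exact h _ _ _ h2
  · obtain ⟨-, -, rfl, -⟩ := hf
    exact h _ _ _ h3

theorem Labeled.translate {β : Assembly} (h : K.Labeled β) (v : ℤ × ℤ) :
    K.Labeled (β.translate v) := fun q => h (q - v)

variable (K)

/-- The assembly of a placed piece. -/
def placedAsm (x : Piece × ℤ × ℤ) : Assembly := (K.asm x.1).translate (scale (2 * K.M) x.2)

theorem mem_dom_placedAsm {x : Piece × ℤ × ℤ} {p : ℤ × ℤ} :
    p ∈ (K.placedAsm x).dom ↔ cell p - scale K.M x.2 ∈ K.cells x.1 := by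
  rw [placedAsm, mem_dom_translate, mem_dom_asm, cell_sub_scale]

theorem placedAsm_nonempty (x : Piece × ℤ × ℤ) : (K.placedAsm x).dom.Nonempty :=
  nonempty_translate.2 (K.asm_nonempty x.1)

theorem placedAsm_stable (x : Piece × ℤ × ℤ) : (K.placedAsm x).Stable K.τ :=
  (K.asm_stable x.1).translate _

theorem disjoint_placedAsm_iff {x y : Piece × ℤ × ℤ} :
    Disjoint (K.placedAsm x).dom (K.placedAsm y).dom ↔
      Disjoint (K.asm x.1).dom ((K.asm y.1).translate (scale (2 * K.M) (y.2 - x.2))).dom := by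
  unfold placedAsm
  rw [← disjoint_translate (α := K.asm x.1) (u := scale (2 * K.M) x.2), translate_translate,
    ← scale_add, sub_add_cancel]

/-- Overlapping pieces are of the same kind at the same place, and then `β` determines them, or they
hold opposite parts of one lock with different codes. The latter is impossible: a pad has the code
of its owner, and opposite pads agree by consistency. -/
theorem placed_eq {β : Assembly} {P : PadSet} (hc : Consistent β P) {x y : Piece × ℤ × ℤ}
    (hx : x ∈ Placed β P) (hy : y ∈ Placed β P) {p : ℤ × ℤ} (hpx : p ∈ (K.placedAsm x).dom)
    (hpy : p ∈ (K.placedAsm y).dom) : x = y := by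
  rw [mem_dom_placedAsm] at hpx hpy
  rcases K.overlap_cases hpx hpy with ⟨hq, h⟩ | ⟨r, r', a, k, l, A, A', o, o', hf, hf', hq, hr, hA⟩
  · obtain ⟨π, q⟩ := x
    obtain ⟨π', q'⟩ := y
    simp only at hq h
    subst hq
    rcases h with ⟨t, t', rfl, rfl⟩ | ⟨a, k, j, A, A', rfl, rfl⟩
    · rcases hx with ⟨s, h1, h2⟩ | ⟨_, _, _, _, h1, -⟩ <;> simp only [Piece.body.injEq,
        reduceCtorEq] at h1
      rcases hy with ⟨s', h1', h2'⟩ | ⟨_, _, _, _, h1', -⟩ <;> simp only [Piece.body.injEq,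
        reduceCtorEq] at h1'
      simp only [h2, Option.some.injEq] at h2'
      rw [h1, h1', h2']
    · rcases hx with ⟨s, h1, h2⟩ | ⟨_, _, _, _, h1, -, h2⟩ <;> simp only [Piece.pad.injEq,
        reduceCtorEq] at h1
      rcases hy with ⟨s', h1', h2'⟩ | ⟨_, _, _, _, h1', -, h2'⟩ <;> simp only [Piece.pad.injEq,
        reduceCtorEq] at h1'
      obtain ⟨rfl, rfl, rfl, rfl⟩ := h1
      obtain ⟨rfl, rfl, rfl, rfl⟩ := h1'
      simp only [h2, Option.some.injEq] at h2'
      rw [h2']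
  · exfalso
    apply hA
    have key {x y : Piece × ℤ × ℤ} (hx : x ∈ Placed β P) (hy : y ∈ Placed β P) {A A' : Glue}
        {o o' : ℤ × ℤ} (hf : HasFace x.1 false a k l A o) (hf' : HasFace y.1 true a k l A' o')
        (hq : x.2 - o = y.2 - o') : A = A' := by
      rcases mem_placed_face hx hf with ⟨t, h1, h2, h3⟩ | ⟨j, t, h1, h2, h3, rfl, rfl, h4⟩ <;>
      rcases mem_placed_face hy hf' with
        ⟨t', h1', h2', h3'⟩ | ⟨j', t', h1', h2', h3', rfl, rfl, h4'⟩
      · rcases h3 with ⟨-, rfl, rfl, rfl⟩ | ⟨h, -⟩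
        · rcases h3' with ⟨h, -⟩ | ⟨-, h, -⟩ <;> simp at h
        · simp at h
      · rcases h3 with ⟨-, rfl, rfl, rfl⟩ | ⟨h, -⟩
        · obtain rfl : j' = false := by cases j' <;> simp at h4' ⊢
          simp only [sub_zero] at hq
          simp only [owner, Bool.false_eq_true, if_false, ← hq, h2, Option.some.injEq] at h3'
          simp [padSide, h3']
        · simp at h
      · rcases h3' with ⟨h, -⟩ | ⟨-, rfl, rfl, rfl⟩
        · simp at h
        · obtain rfl : j = true := by cases j <;> simp at h4 ⊢
          simp only [sub_zero] at hq
          simp only [owner, if_true, hq, sub_add_cancel, h2', Option.some.injEq] at h3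
          simp [padSide, h3]
      · simp only [sub_zero] at hq
        obtain ⟨rfl, rfl⟩ : j = false ∧ j' = true := by
          rw [h4] at h4'
          cases j <;> cases j' <;> simp at h4' ⊢
        rw [← hq] at h2' h3'
        exact hc.agree _ a k t t' h2 h2' h3 h3'
    cases r <;> cases r'
    · simp at hr
    · exact key hx hy hf hf' hq
    · exact (key hy hx hf' hf hq.symm).symm
    · simp at hr

open Classical in
/-- The assembly of a configuration. -/
def render (β : Assembly) (P : PadSet) : Assembly := fun p =>
  if h : ∃ x ∈ Placed β P, p ∈ (K.placedAsm x).dom then K.placedAsm h.choose p else none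

theorem exists_placed {β : Assembly} {P : PadSet} {p : ℤ × ℤ} {t : TileType}
    (h : K.render β P p = some t) : ∃ x ∈ Placed β P, K.placedAsm x p = some t := by
  by_cases hx : ∃ x ∈ Placed β P, p ∈ (K.placedAsm x).dom
  · rw [render, dif_pos hx] at h
    exact ⟨_, hx.choose_spec.1, h⟩
  · rw [render, dif_neg hx] at h
    simp at h

theorem render_eq_some {β : Assembly} {P : PadSet} (hc : Consistent β P) {p : ℤ × ℤ}
    {t : TileType} : K.render β P p = some t ↔ ∃ x ∈ Placed β P, K.placedAsm x p = some t := by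
  refine ⟨K.exists_placed, fun ⟨x, hx, h⟩ => ?_⟩
  have hx' : ∃ x ∈ Placed β P, p ∈ (K.placedAsm x).dom := ⟨x, hx, mem_dom_of_eq h⟩
  rw [render, dif_pos hx', ← h]
  rw [K.placed_eq hc hx'.choose_spec.1 hx hx'.choose_spec.2 (mem_dom_of_eq h)]

theorem placedAsm_sub_render {β : Assembly} {P : PadSet} (hc : Consistent β P)
    {x : Piece × ℤ × ℤ} (hx : x ∈ Placed β P) : (K.placedAsm x).Sub (K.render β P) :=
  sub_iff.2 fun _ _ h => (K.render_eq_some hc).2 ⟨x, hx, h⟩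

theorem render_mono {β β' : Assembly} {P P' : PadSet} (hc' : Consistent β' P') (hβ : β.Sub β')
    (hP : P ⊆ P') : (K.render β P).Sub (K.render β' P') :=
  sub_iff.2 fun _ _ h => by
    obtain ⟨x, hx, h⟩ := K.exists_placed h
    exact (K.render_eq_some hc').2 ⟨x, Placed.mono hβ hP hx, h⟩

theorem render_translate {β : Assembly} {P : PadSet} (hc : Consistent β P) (v : ℤ × ℤ) :
    (K.render β P).translate (scale (2 * K.M) v) = K.render (β.translate v) (P.shift v) := by
  refine ext_some fun p t => ?_
  rw [translate_apply, K.render_eq_some hc, K.render_eq_some (hc.translate v)]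
  constructor
  · rintro ⟨x, hx, h⟩
    refine ⟨(x.1, x.2 + v), ?_, ?_⟩
    · rcases hx with ⟨s, h1, h2⟩ | ⟨a, k, j, s, h1, h2, h3⟩
      · exact Or.inl ⟨s, h1, by simpa using h2⟩
      · exact Or.inr ⟨a, k, j, s, h1, by simpa [PadSet.shift] using h2,
          by simpa [← owner_sub] using h3⟩
    · rw [← h]
      simp only [placedAsm, translate_apply, scale_add]
      congr 1
      abel
  · rintro ⟨x, hx, h⟩
    refine ⟨(x.1, x.2 - v), ?_, ?_⟩
    · rcases hx with ⟨s, h1, h2⟩ | ⟨a, k, j, s, h1, h2, h3⟩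
      · exact Or.inl ⟨s, h1, by simpa using h2⟩
      · exact Or.inr ⟨a, k, j, s, h1, by simpa [PadSet.shift] using h2,
          by simpa [owner_sub] using h3⟩
    · rw [← h]
      simp only [placedAsm, translate_apply, scale_sub]
      congr 1
      abel

theorem body_mem_placed {β : Assembly} (P : PadSet) {q : ℤ × ℤ} {t : TileType}
    (h : β q = some t) : (Piece.body t, q) ∈ Placed β P := Or.inl ⟨t, rfl, h⟩

theorem pad_mem_placed {β : Assembly} {P : PadSet} {q : ℤ × ℤ} {a k j : Bool} {t : TileType}
    (h : (q, a, k, j) ∈ P) (ht : β (owner q a j) = some t) :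
    (Piece.pad a k j (t (padSide a j)), q) ∈ Placed β P := Or.inr ⟨a, k, j, t, rfl, h, ht⟩

theorem render_disjoint_of_consistent {β β' : Assembly} {P P' : PadSet}
    (h : Consistent (β.union β') (P ∪ P')) (hd : Disjoint β.dom β'.dom) :
    Disjoint (K.render β P).dom (K.render β' P').dom := by
  rw [Set.disjoint_left]
  intro p hp hp'
  obtain ⟨t, ht⟩ := mem_dom_iff.1 hp
  obtain ⟨t', ht'⟩ := mem_dom_iff.1 hp'
  obtain ⟨x, hx, hxp⟩ := K.exists_placed ht
  obtain ⟨y, hy, hyp⟩ := K.exists_placed ht'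
  obtain rfl := K.placed_eq h (Placed.mono sub_union_left Set.subset_union_left hx)
    (Placed.mono (sub_union_right hd) Set.subset_union_right hy) (mem_dom_of_eq hxp)
    (mem_dom_of_eq hyp)
  rcases hx with ⟨s, h1, h2⟩ | ⟨a, k, j, s, h1, -, h2⟩ <;>
  rcases hy with ⟨s', h1', h2'⟩ | ⟨a', k', j', s', h1', -, h2'⟩ <;> rw [h1] at h1'
  · exact Set.disjoint_left.1 hd (mem_dom_of_eq h2) (mem_dom_of_eq h2')
  · simp at h1'
  · simp at h1'
  · simp only [Piece.pad.injEq] at h1'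
    obtain ⟨rfl, rfl, rfl, -⟩ := h1'
    exact Set.disjoint_left.1 hd (mem_dom_of_eq h2) (mem_dom_of_eq h2')

theorem render_union {β β' : Assembly} {P P' : PadSet} (h1 : Consistent β P)
    (h2 : Consistent β' P') (h : Consistent (β.union β') (P ∪ P'))
    (hd : Disjoint β.dom β'.dom) :
    (K.render β P).union (K.render β' P') = K.render (β.union β') (P ∪ P') := by
  refine ext_some fun p t => ?_
  rw [union_eq_some_iff (K.render_disjoint_of_consistent h hd), K.render_eq_some h1,
    K.render_eq_some h2, K.render_eq_some h]
  constructor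
  · rintro (⟨x, hx, hp⟩ | ⟨x, hx, hp⟩)
    · exact ⟨x, Placed.mono sub_union_left Set.subset_union_left hx, hp⟩
    · exact ⟨x, Placed.mono (sub_union_right hd) Set.subset_union_right hx, hp⟩
  · rintro ⟨x, ⟨s, h3, h4⟩ | ⟨a, k, j, s, h3, h5 | h5, h4⟩, hp⟩
    · rcases union_eq_some h4 with h4 | h4
      · exact Or.inl ⟨x, Or.inl ⟨s, h3, h4⟩, hp⟩
      · exact Or.inr ⟨x, Or.inl ⟨s, h3, h4⟩, hp⟩
    · rw [union_of_mem (h1.owner_mem _ _ _ _ h5)] at h4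
      exact Or.inl ⟨x, Or.inr ⟨a, k, j, s, h3, h5, h4⟩, hp⟩
    · rw [union_of_mem_right hd (h2.owner_mem _ _ _ _ h5)] at h4
      exact Or.inr ⟨x, Or.inr ⟨a, k, j, s, h3, h5, h4⟩, hp⟩

theorem render_insert {β : Assembly} {P : PadSet} {q : ℤ × ℤ} {a k j : Bool} {t : TileType}
    (hc : Consistent β (insert (q, a, k, j) P)) (hn : (q, a, k, j) ∉ P)
    (ht : β (owner q a j) = some t) :
    Disjoint (K.render β P).dom (K.placedAsm (.pad a k j (t (padSide a j)), q)).dom ∧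
    K.render β (insert (q, a, k, j) P) =
      (K.render β P).union (K.placedAsm (.pad a k j (t (padSide a j)), q)) := by
  have hmem := pad_mem_placed (β := β) (Set.mem_insert (q, a, k, j) P) ht
  have hd : Disjoint (K.render β P).dom (K.placedAsm (.pad a k j (t (padSide a j)), q)).dom := by
    rw [Set.disjoint_left]
    intro p hp hp'
    obtain ⟨s, hs⟩ := mem_dom_iff.1 hp
    obtain ⟨x, hx, hxp⟩ := K.exists_placed hs
    obtain rfl := K.placed_eq hc (Placed.mono (Sub.refl _) (Set.subset_insert _ _) hx) hmem
      (mem_dom_of_eq hxp) hp'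
    rcases hx with ⟨s', h1, -⟩ | ⟨a', k', j', s', h1, h2, -⟩
    · simp at h1
    · simp only [Piece.pad.injEq] at h1
      obtain ⟨rfl, rfl, rfl, -⟩ := h1
      exact hn h2
  refine ⟨hd, ext_some fun p s => ?_⟩
  rw [union_eq_some_iff hd, K.render_eq_some hc,
    K.render_eq_some (hc.mono (Set.subset_insert _ _))]
  constructor
  · rintro ⟨x, ⟨s', h3, h4⟩ | ⟨a', k', j', s', h3, h5 | h5, h4⟩, hp⟩
    · exact Or.inl ⟨x, Or.inl ⟨s', h3, h4⟩, hp⟩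
    · simp only [Prod.mk.injEq] at h5
      obtain ⟨rfl, rfl, rfl, rfl⟩ := h5
      rw [ht, Option.some.injEq] at h4
      subst h4
      exact Or.inr (by rw [← h3]; exact hp)
    · exact Or.inl ⟨x, Or.inr ⟨a', k', j', s', h3, h5, h4⟩, hp⟩
  · rintro (⟨x, hx, hp⟩ | hp)
    · exact ⟨x, Placed.mono (Sub.refl _) (Set.subset_insert _ _) hx, hp⟩
    · exact ⟨_, hmem, hp⟩

theorem mem_dom_body_core (t : TileType) (q : ℤ × ℤ) :
    scale 2 (K.cellAt false false 0 0 0 + scale K.M q) ∈ (K.placedAsm (.body t, q)).dom := by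
  have := K.two_le_H
  rw [mem_dom_placedAsm, cell_scale_two, add_sub_cancel_right]
  exact Or.inl (K.inCore_left false false le_rfl (by omega))

theorem disjoint_of_render {β β' : Assembly} {P P' : PadSet} (h1 : Consistent β P)
    (h2 : Consistent β' P') (hd : Disjoint (K.render β P).dom (K.render β' P').dom) :
    Disjoint β.dom β'.dom := by
  rw [Set.disjoint_left] at hd ⊢
  intro q hq hq'
  obtain ⟨t, ht⟩ := mem_dom_iff.1 hq
  obtain ⟨t', ht'⟩ := mem_dom_iff.1 hq'
  exact hd ((K.placedAsm_sub_render h1 (body_mem_placed P ht)).dom_subset (K.mem_dom_body_core t q))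
    ((K.placedAsm_sub_render h2 (body_mem_placed P' ht')).dom_subset (K.mem_dom_body_core t' q))

/-- Passing to unions commutes with forming configurations, since each piece depends on a single pad
position and a single tile, both present from some stage on. -/
theorem isResult_render {β : ℕ → Assembly} {P : ℕ → PadSet} {γ : Assembly}
    (hβ : IsResult β γ) (hm : ∀ i j, i ≤ j → (β i).Sub (β j)) (hP : ∀ i j, i ≤ j → P i ⊆ P j)
    (hc : ∀ i, Consistent (β i) (P i)) :
    Consistent γ (⋃ i, P i) ∧ IsResult (fun i => K.render (β i) (P i)) (K.render γ (⋃ i, P i)) := by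
  have hcγ : Consistent γ (⋃ i, P i) := by
    refine ⟨fun q a k j hq => ?_, fun q a k t t' h1 h2 h3 h4 => ?_⟩
    · obtain ⟨i, hi⟩ := Set.mem_iUnion.1 hq
      exact (hβ.2 i).dom_subset ((hc i).owner_mem _ _ _ _ hi)
    · obtain ⟨i, hi⟩ := Set.mem_iUnion.1 h1
      obtain ⟨j, hj⟩ := Set.mem_iUnion.1 h2
      have m1 := hP i (max i j) (le_max_left _ _) hi
      have m2 := hP j (max i j) (le_max_right _ _) hj
      have o1 := (hc _).owner_mem _ _ _ _ m1
      have o2 := (hc _).owner_mem _ _ _ _ m2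
      simp only [owner, Bool.false_eq_true, if_false, if_true] at o1 o2
      refine (hc (max i j)).agree q a k t t' m1 m2 ?_ ?_
      · rw [hβ.2 _ _ o1, h3]
      · rw [hβ.2 _ _ o2, h4]
  refine ⟨hcγ, ?_⟩
  have hsub : ∀ i, (K.render (β i) (P i)).Sub (K.render γ (⋃ i, P i)) := fun i =>
    K.render_mono hcγ (hβ.2 i) (Set.subset_iUnion P i)
  refine ⟨subset_antisymm ?_ (Set.iUnion_subset fun i => (hsub i).dom_subset), hsub⟩
  intro p hp
  obtain ⟨t, ht⟩ := mem_dom_iff.1 hp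
  obtain ⟨x, hx, hxp⟩ := K.exists_placed ht
  rw [Set.mem_iUnion]
  rcases hx with ⟨s, h1, h2⟩ | ⟨a, k, j, s, h1, h2, h3⟩
  · obtain ⟨i, hi⟩ := hβ.exists_stage hm h2
    exact ⟨i, mem_dom_of_eq ((K.render_eq_some (hc i)).2
      ⟨x, Or.inl ⟨s, h1, hi i le_rfl⟩, hxp⟩)⟩
  · obtain ⟨i, hi⟩ := Set.mem_iUnion.1 h2
    refine ⟨i, mem_dom_of_eq ((K.render_eq_some (hc i)).2
      ⟨x, Or.inr ⟨a, k, j, s, h1, hi, ?_⟩, hxp⟩)⟩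
    rw [hβ.2 i _ ((hc i).owner_mem _ _ _ _ hi), h3]

end Kit

end TwoHAM

end

/-! ### Bonds between configurations and between the assemblies they represent -/

noncomputable section

namespace TwoHAM

open Assembly Relation

namespace Kit

variable (K : Kit)

/-! ### The strength of a port -/

/-- The strength of the special glue in column `x` of a middle lock. -/
def slotStrength (k : Bool) (A : Glue) (x : ℤ) : ℕ :=
  (K.slot 1 k A x).elim 0 fun i => if i then Nat.sqrt K.τ else 1

theorem slotStrength_eq {a k : Bool} {A : Glue} {x : ℤ} {i : Bool} (h : K.slot 1 k A x = some i) :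
    K.slotStrength k A x = kindStrength K.τ (some (some (a, k, 1, i))) := by
  simp [slotStrength, h, kindStrength]

theorem card_filter_Ioo_le {n w : ℤ} (h : n < w) (hn : 0 ≤ n) :
    (((Finset.Ioo 0 w).filter (· ≤ n)).card : ℤ) = n := by
  have : (Finset.Ioo 0 w).filter (· ≤ n) = Finset.Icc 1 n := by
    ext x
    simp only [Finset.mem_filter, Finset.mem_Ioo, Finset.mem_Icc]
    omega
  rw [this, Int.card_Icc]
  omega

theorem sum_slotStrength (k : Bool) (A : Glue) :
    ∑ x ∈ Finset.Ioo 0 K.w, K.slotStrength k A x = K.share k A := by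
  have h2 := K.two_le
  have hc := K.capacity (K.share k A) (by
    simp only [share]
    split_ifs <;> have := min_le_right A.strength K.τ <;> omega)
  have hdm := Nat.div_add_mod (K.share k A) (Nat.sqrt K.τ)
  set n := K.share k A with hn
  set v := Nat.sqrt K.τ
  -- The strength is counted in two layers: `v - 1` on the first `n / v` columns and `1` on the
  -- first `n / v + n % v` columns. The capacity of the kit ensures that these columns exist.
  have e (x : ℤ) : K.slotStrength k A x =
      (if x ≤ ((n / v : ℕ) : ℤ) then v - 1 else 0) +
        (if x ≤ ((n / v + n % v : ℕ) : ℤ) then 1 else 0) := by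
    have hv : 0 < v := Nat.sqrt_pos.2 (by omega)
    have h1 : ((n / v : ℕ) : ℤ) ≤ ((n / v + n % v : ℕ) : ℤ) := by push_cast; omega
    simp only [slotStrength, slot, if_true, ← hn]
    by_cases hx : x ≤ ((n / v : ℕ) : ℤ)
    · rw [if_pos hx, if_pos hx, if_pos (hx.trans h1)]
      simp only [Option.elim_some, if_true]
      change v = _
      omega
    · rw [if_neg hx, if_neg hx]
      split_ifs <;> simp
  have hv : 0 < v := Nat.sqrt_pos.2 (by omega)
  have c1 := card_filter_Ioo_le (n := ((n / v : ℕ) : ℤ)) (w := K.w) (by push_cast at hc ⊢; omega)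
    (by positivity)
  have c2 := card_filter_Ioo_le (n := ((n / v + n % v : ℕ) : ℤ)) (w := K.w) hc (by positivity)
  rw [Nat.cast_inj] at c1 c2
  rw [Finset.sum_congr rfl fun x _ => e x, Finset.sum_add_distrib, ← Finset.sum_filter,
    ← Finset.sum_filter, Finset.sum_const, Finset.sum_const, c1, c2]
  obtain ⟨v', hv'⟩ : ∃ v', v = v' + 1 := ⟨v - 1, by omega⟩
  rw [hv'] at hdm ⊢
  simp only [smul_eq_mul, add_tsub_cancel_right, mul_one]
  nlinarith

theorem share_add_share (A : Glue) :
    K.share false A + K.share true A = min A.strength K.τ := by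
  simp only [share, if_true, if_false, Bool.false_eq_true]
  omega

/-- The positions of the special glues of the middle locks: the lower macrotile, the port and the
column. -/
abbrev Slots := (ℤ × ℤ) × Bool × {x : ℤ // x ∈ Finset.Ioo 0 K.w}

/-- The position of a special glue of a middle lock. -/
def slotsPos (a : Bool) (j : K.Slots) : ℤ × ℤ :=
  K.slotPos a j.2.1 1 j.2.2 + scale (2 * K.M) j.1

theorem slotsPos_injective (a : Bool) : Function.Injective (K.slotsPos a) := by
  rintro ⟨ρ, k, x, hx⟩ ⟨ρ', k', x', hx'⟩ h
  have hH := K.two_le_H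
  rw [Finset.mem_Ioo] at hx hx'
  have h := congrArg cell h
  simp only [slotsPos, cell_add_scale, cell_slotPos] at h
  rw [add_comm, add_comm _ (scale K.M ρ')] at h
  obtain ⟨rfl, -, rfl, -, rfl, -⟩ := K.cellAt_injective h
    ⟨by omega, by omega, by simp, by omega, by omega⟩ ⟨by omega, by omega, by simp, by omega, by omega⟩
  rfl

theorem tsum_slotStrength (A : Glue) :
    (∑' kx : Bool × {x : ℤ // x ∈ Finset.Ioo 0 K.w}, (K.slotStrength kx.1 A kx.2 : ℝ≥0∞)) =
      (min A.strength K.τ : ℕ) := by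
  have h (k : Bool) : (∑ x : {x : ℤ // x ∈ Finset.Ioo 0 K.w}, K.slotStrength k A x) =
      K.share k A := by
    rw [← K.sum_slotStrength]
    exact Finset.sum_coe_sort (Finset.Ioo 0 K.w) (K.slotStrength k A)
  rw [tsum_fintype, ← Nat.cast_sum, Fintype.sum_prod_type, Fintype.sum_bool, h, h, add_comm,
    share_add_share]

/-! ### Bonds between configurations -/

variable {K} {β β' : Assembly} {P P' : PadSet}

/-- Disjoint configurations bind only in middle locks. A bond in an outer lock would join a pad of
one configuration to a body of the other that stands at the position of the owner of the pad, so
both assemblies would occupy that position. -/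
theorem bond_cases (h : Consistent β P) (h' : Consistent β' P') (hl : K.Labeled β)
    (hl' : K.Labeled β') (hd : Disjoint (K.render β P).dom (K.render β' P').dom) {a : Bool}
    {p : ℤ × ℤ}
    (h0 : pairBond (K.render β P p) (K.render β' P' (p + (cross a).vec)) (cross a) ≠ 0) :
    ∃ (j : K.Slots) (t t' : TileType), p = K.slotsPos a j ∧ β j.1 = some t ∧
      β' (j.1 + (plus a).vec) = some t' ∧ t (plus a) = t' (plus a).opposite ∧
      pairBond (K.render β P p) (K.render β' P' (p + (cross a).vec)) (cross a) =
        K.slotStrength j.2.1 (t (plus a)) j.2.2 := by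
  have hdβ := K.disjoint_of_render h h' hd
  obtain ⟨s, s', hs, hs', hss, hval⟩ := pairBond_ne_zero h0
  rw [hval] at h0 ⊢
  obtain ⟨y, hy, hsy⟩ := K.exists_placed hs
  obtain ⟨y', hy', hsy'⟩ := K.exists_placed hs'
  have hdy : Disjoint (K.asm y.1).dom
      ((K.asm y'.1).translate (scale (2 * K.M) (y'.2 - y.2))).dom := by
    rw [← disjoint_placedAsm_iff]
    exact hd.mono (K.placedAsm_sub_render h hy).dom_subset
      (K.placedAsm_sub_render h' hy').dom_subset
  have hsy'' : K.asm y'.1 (p - scale (2 * K.M) y.2 + (cross a).vec -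
      scale (2 * K.M) (y'.2 - y.2)) = some s' := by
    rw [← hsy', placedAsm, translate_apply, scale_sub]
    congr 1
    abel
  obtain ⟨k, l, A, o, o', x, i, hf, hf', hu, hx, hxw, hsl, hp, hst⟩ :=
    K.match_cases (hl.coded hy) (hl'.coded hy') hdy hsy hsy'' hss h0
  have hq : y'.2 - y.2 = o' - o := scale_injective (by have := K.M_pos; omega) hu
  have no : ∀ q, q ∈ β.dom → q ∈ β'.dom → False := fun q h1 h2 =>
    Set.disjoint_left.1 hdβ h1 h2
  rcases mem_placed_face hy hf with ⟨t, h1, h2, h3⟩ | ⟨j, t, h1, h2, h3, h4, h5, h6⟩ <;>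
  rcases mem_placed_face hy' hf' with
    ⟨t', h1', h2', h3'⟩ | ⟨j', t', h1', h2', h3', h4', h5', h6'⟩
  · rcases h3 with ⟨-, h4, -⟩ | ⟨h, -⟩
    · rcases h3' with ⟨h, -⟩ | ⟨-, h4', -⟩
      · simp at h
      · rw [h4] at h4'; simp at h4'
    · simp at h
  · exfalso
    rcases h3 with ⟨-, h4, -, rfl⟩ | ⟨h, -⟩
    · obtain rfl : j' = false := by
        rw [h4] at h6'
        cases j' <;> simp at h6' ⊢
      rw [h5', sub_zero, sub_eq_zero] at hq
      refine no y.2 (mem_dom_of_eq h2) (mem_dom_of_eq (t := t') ?_)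
      simpa [owner, hq] using h3'
    · simp at h
  · exfalso
    rcases h3' with ⟨h, -⟩ | ⟨-, h4', -, rfl⟩
    · simp at h
    · obtain rfl : j = true := by
        rw [h4'] at h6
        cases j <;> simp at h6 ⊢
      rw [h5, sub_zero, sub_eq_iff_eq_add'] at hq
      refine no y'.2 (mem_dom_of_eq (t := t) ?_) (mem_dom_of_eq h2')
      simpa [owner, hq] using h3
  · obtain ⟨rfl, rfl⟩ : j = false ∧ j' = true := by
      rw [h6] at h6'
      cases j <;> cases j' <;> simp at h6' ⊢
    obtain rfl : l = 1 := by simpa using h6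
    rw [h5, h5', sub_zero, sub_eq_zero] at hq
    simp only [owner, padSide, if_true, if_false, Bool.false_eq_true, hq] at h3 h3' h4 h4'
    refine ⟨⟨y.2, k, x, Finset.mem_Ioo.2 ⟨hx, hxw⟩⟩, t, t', ?_, h3, h3', h4.symm.trans h4', ?_⟩
    · rw [h5, scale_zero, add_zero] at hp
      rw [slotsPos, ← hp, sub_add_cancel]
    · rw [hst, ← h4, K.slotStrength_eq hsl]

/-- Each bond is charged to its slot. The slots of one border sum to the strength of its glue capped
at the temperature, whichever of its pads are present. -/
theorem halfLink_render_le (h : Consistent β P) (h' : Consistent β' P') (hl : K.Labeled β)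
    (hl' : K.Labeled β') (hd : Disjoint (K.render β P).dom (K.render β' P').dom) (a : Bool) :
    halfLink (K.render β P) (K.render β' P') (cross a) ≤ halfLink β β' (plus a) := by
  classical
  let g (j : K.Slots) : ℝ≥0∞ :=
    match β j.1, β' (j.1 + (plus a).vec) with
    | some t, some t' =>
      if t (plus a) = t' (plus a).opposite then (K.slotStrength j.2.1 (t (plus a)) j.2.2 : ℝ≥0∞)
      else 0
    | _, _ => 0
  calc halfLink (K.render β P) (K.render β' P') (cross a)
      ≤ ∑' p : ℤ × ℤ, ∑' j : K.Slots, if p = K.slotsPos a j then g j else 0 := by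
        refine ENNReal.tsum_le_tsum fun p => ?_
        by_cases h0 : pairBond (K.render β P p) (K.render β' P' (p + (cross a).vec)) (cross a) = 0
        · simp [h0]
        · obtain ⟨j, t, t', hp, ht, ht', htt, hv⟩ := bond_cases h h' hl hl' hd h0
          refine le_trans ?_ (ENNReal.le_tsum j)
          rw [if_pos hp, hv]
          simp only [g, ht, ht', if_pos htt, le_refl]
    _ = ∑' j : K.Slots, g j := by
        rw [ENNReal.tsum_comm]
        exact tsum_congr fun j => tsum_ite_eq _ _
    _ = ∑' ρ : ℤ × ℤ, ∑' kx, g (ρ, kx) := ENNReal.tsum_prod'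
    _ ≤ halfLink β β' (plus a) := by
        refine ENNReal.tsum_le_tsum fun ρ => ?_
        rcases ht : β ρ with _ | t
        · simp [g, ht]
        rcases ht' : β' (ρ + (plus a).vec) with _ | t'
        · simp [g, ht, ht']
        by_cases htt : t (plus a) = t' (plus a).opposite
        · simp only [g, ht, ht', if_pos htt, pairBond_some]
          rw [K.tsum_slotStrength]
          exact Nat.cast_le.2 (min_le_left _ _)
        · simp [g, ht, ht', htt]

theorem link_eq_axes (α β : Assembly) :
    link α β = (halfLink α β (plus true) + halfLink β α (plus true)) +
      (halfLink α β (plus false) + halfLink β α (plus false)) := link_eq α β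

theorem link_eq_cross (α β : Assembly) :
    link α β = (halfLink α β (cross true) + halfLink β α (cross true)) +
      (halfLink α β (cross false) + halfLink β α (cross false)) := by
  rw [link_eq, _root_.add_comm]; rfl

theorem link_render_le (h : Consistent β P) (h' : Consistent β' P') (hl : K.Labeled β)
    (hl' : K.Labeled β') (hd : Disjoint (K.render β P).dom (K.render β' P').dom) :
    link (K.render β P) (K.render β' P') ≤ link β β' := by
  rw [link_eq_axes β, link_eq_cross]
  exact add_le_add (add_le_add (halfLink_render_le h h' hl hl' hd _)
    (halfLink_render_le h' h hl' hl hd.symm _)) (add_le_add (halfLink_render_le h h' hl hl' hd _)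
    (halfLink_render_le h' h hl' hl hd.symm _))

theorem le_halfLink_render (h : Consistent β P) (h' : Consistent β' P')
    (hd : Disjoint (K.render β P).dom (K.render β' P').dom) (a : Bool) (g : ℤ × ℤ → ℕ)
    (hg : ∀ ρ, g ρ ≤ min (pairBond (β ρ) (β' (ρ + (plus a).vec)) (plus a)) K.τ)
    (hP : ∀ ρ k, g ρ ≠ 0 → (ρ, a, k, false) ∈ P ∧ (ρ, a, k, true) ∈ P') :
    ∑' ρ, (g ρ : ℝ≥0∞) ≤ halfLink (K.render β P) (K.render β' P') (cross a) := by
  classical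
  let f (p : ℤ × ℤ) : ℝ≥0∞ :=
    (pairBond (K.render β P p) (K.render β' P' (p + (cross a).vec)) (cross a) : ℝ≥0∞)
  calc ∑' ρ, (g ρ : ℝ≥0∞) ≤ ∑' ρ, ∑' kx, f (K.slotsPos a (ρ, kx)) := by
        refine ENNReal.tsum_le_tsum fun ρ => ?_
        by_cases h0 : g ρ = 0
        · simp [h0]
        have hgρ := hg ρ
        have hb : pairBond (β ρ) (β' (ρ + (plus a).vec)) (plus a) ≠ 0 := by
          intro hb
          rw [hb] at hgρ
          omega
        obtain ⟨t, t', ht, ht', htt, hv⟩ := pairBond_ne_zero hb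
        rw [hv] at hgρ
        refine (Nat.cast_le.2 hgρ).trans ?_
        rw [← K.tsum_slotStrength]
        refine ENNReal.tsum_le_tsum fun ⟨k, x, hx⟩ => ?_
        rw [Finset.mem_Ioo] at hx
        rcases hsl : K.slot 1 k (t (plus a)) x with _ | i
        · simp [slotStrength, hsl]
        obtain ⟨hp1, hp2⟩ := hP ρ k h0
        have m1 := pad_mem_placed (β := β) hp1 (t := t) ht
        have m2 := pad_mem_placed (β := β') hp2 (t := t') ht'
        simp only [padSide, if_true, if_false, Bool.false_eq_true, ← htt] at m1 m2
        have hd1 : Disjoint (K.asm (.pad a k false (t (plus a)))).dom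
            ((K.asm (.pad a k true (t (plus a)))).translate (scale (2 * K.M) (ρ - ρ))).dom := by
          have := K.disjoint_placedAsm_iff (x := (.pad a k false (t (plus a)), ρ))
            (y := (.pad a k true (t (plus a)), ρ))
          rw [← this]
          exact hd.mono (K.placedAsm_sub_render h m1).dom_subset
            (K.placedAsm_sub_render h' m2).dom_subset
        have hb := K.pairBond_slot (π := .pad a k false (t (plus a)))
          (π' := .pad a k true (t (plus a))) (l := 1) (o := 0) (o' := 0)
          (u := scale (2 * K.M) (ρ - ρ)) ⟨rfl, rfl, rfl, rfl, rfl⟩ ⟨rfl, rfl, rfl, rfl, rfl⟩ (by simp)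
          hx.1 hx.2 hsl hd1 (p := K.slotPos a k 1 x) (by simp)
        have hmono := pairBond_mono (d := cross a)
          (K.placedAsm_sub_render h m1 |> fun hh z => hh.apply_eq_some
            (p := K.slotsPos a (ρ, k, ⟨x, Finset.mem_Ioo.2 hx⟩)) (t := z))
          (K.placedAsm_sub_render h' m2 |> fun hh z => hh.apply_eq_some
            (p := K.slotsPos a (ρ, k, ⟨x, Finset.mem_Ioo.2 hx⟩) + (cross a).vec) (t := z))
        rw [K.slotStrength_eq (a := a) hsl, ← hb]
        refine Nat.cast_le.2 (le_trans (le_of_eq ?_) hmono)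
        simp only [placedAsm, translate_apply, slotsPos]
        congr 2 <;> simp
        abel
    _ = ∑' j : K.Slots, f (K.slotsPos a j) :=
        (ENNReal.tsum_prod' (f := fun j : K.Slots => f (K.slotsPos a j))).symm
    _ ≤ ∑' p, f p := ENNReal.tsum_comp_le_tsum_of_injective (K.slotsPos_injective a) f

/-- The strength of the bond between a tile of one of two assemblies and a tile of the other. The
edge is given by its lower end, its axis, and whether the lower end belongs to the second one. -/
def edgeBond (β β' : Assembly) (e : (ℤ × ℤ) × Bool × Bool) : ℕ :=
  if e.2.2 then pairBond (β' e.1) (β (e.1 + (plus e.2.1).vec)) (plus e.2.1)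
  else pairBond (β e.1) (β' (e.1 + (plus e.2.1).vec)) (plus e.2.1)

theorem tsum_edges (f : (ℤ × ℤ) × Bool × Bool → ℝ≥0∞) :
    ∑' e, f e = (∑' ρ, f (ρ, true, false) + ∑' ρ, f (ρ, true, true)) +
      (∑' ρ, f (ρ, false, false) + ∑' ρ, f (ρ, false, true)) := by
  rw [ENNReal.tsum_prod', ← ENNReal.tsum_add, ← ENNReal.tsum_add, ← ENNReal.tsum_add]
  refine tsum_congr fun ρ => ?_
  rw [tsum_fintype, Fintype.sum_prod_type, Fintype.sum_bool, Fintype.sum_bool, Fintype.sum_bool]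
  ring

theorem link_eq_tsum_edgeBond (β β' : Assembly) :
    link β β' = ∑' e, (edgeBond β β' e : ℝ≥0∞) := by
  rw [tsum_edges, link_eq_axes]
  simp [edgeBond, halfLink]

/-- Ports transmit strengths capped at the temperature. The cap is harmless: if it takes effect
anywhere, that single term already reaches the threshold. -/
theorem le_sum_min {X : Type*} (F : Finset X) (f : X → ℕ) {n : ℕ} (h : n ≤ ∑ e ∈ F, f e) :
    n ≤ ∑ e ∈ F, min (f e) n := by
  by_cases hc : ∃ e ∈ F, n ≤ f e
  · obtain ⟨e, he, hn⟩ := hc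
    refine le_trans (le_of_eq ?_) (Finset.single_le_sum (fun _ _ => Nat.zero_le _) he)
    rw [min_eq_right hn]
  · push Not at hc
    rwa [Finset.sum_congr rfl fun e he => min_eq_left (hc e he).le]

/-- Where all four pads of a border are present, two on each side, both ports bind and transmit the
whole capped strength. -/
theorem le_link_render (h : Consistent β P) (h' : Consistent β' P')
    (hd : Disjoint (K.render β P).dom (K.render β' P').dom) (F : Finset ((ℤ × ℤ) × Bool × Bool))
    (hF : K.τ ≤ ∑ e ∈ F, edgeBond β β' e)
    (hP : ∀ ρ a k j, (ρ, a, j) ∈ F → edgeBond β β' (ρ, a, j) ≠ 0 →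
      (ρ, a, k, j) ∈ P ∧ (ρ, a, k, !j) ∈ P') :
    (K.τ : ℝ≥0∞) ≤ link (K.render β P) (K.render β' P') := by
  classical
  let g (e : (ℤ × ℤ) × Bool × Bool) : ℕ := if e ∈ F then min (edgeBond β β' e) K.τ else 0
  have hg : ∀ e, g e ≤ min (edgeBond β β' e) K.τ := fun e => by
    simp only [g]; split_ifs <;> simp
  have hg0 : ∀ ρ a j, g (ρ, a, j) ≠ 0 → ∀ k, (ρ, a, k, j) ∈ P ∧ (ρ, a, k, !j) ∈ P' := by
    intro ρ a j h0 k
    have hm : (ρ, a, j) ∈ F := by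
      by_contra hm
      exact h0 (if_neg hm)
    refine hP ρ a k j hm fun hb => h0 ?_
    have := hg (ρ, a, j)
    rw [hb] at this
    omega
  have h1 : (K.τ : ℝ≥0∞) ≤ ∑' e, (g e : ℝ≥0∞) := by
    refine le_trans ?_ (ENNReal.sum_le_tsum F)
    rw [← Nat.cast_sum]
    refine Nat.cast_le.2 ((le_sum_min F _ hF).trans (le_of_eq ?_))
    exact Finset.sum_congr rfl fun e he => (if_pos he).symm
  rw [tsum_edges] at h1
  rw [link_eq_cross]
  exact h1.trans (add_le_add (add_le_add
    (le_halfLink_render h h' hd true _ (fun ρ => hg _) fun ρ k h0 => hg0 ρ true false h0 k)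
    (le_halfLink_render h' h hd.symm true _ (fun ρ => hg _) fun ρ k h0 =>
      (hg0 ρ true true h0 k).symm)) (add_le_add
    (le_halfLink_render h h' hd false _ (fun ρ => hg _) fun ρ k h0 => hg0 ρ false false h0 k)
    (le_halfLink_render h' h hd.symm false _ (fun ρ => hg _) fun ρ k h0 =>
      (hg0 ρ false true h0 k).symm)))

end Kit

end TwoHAM

end

/-! ### Which attachments are possible -/

noncomputable section

namespace TwoHAM

open Assembly Relation

/-! ### Assemblies over the universal tile set -/

theorem exists_bond_of_link {α β : Assembly} (h : link α β ≠ 0) :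
    ∃ a p, pairBond (α p) (β (p + (cross a).vec)) (cross a) ≠ 0 ∨
      pairBond (β p) (α (p + (cross a).vec)) (cross a) ≠ 0 := by
  by_contra! hc
  refine h ?_
  have h1 (a : Bool) : halfLink α β (cross a) = 0 :=
    ENNReal.tsum_eq_zero.2 fun p => by rw [(hc a p).1, Nat.cast_zero]
  have h2 (a : Bool) : halfLink β α (cross a) = 0 :=
    ENNReal.tsum_eq_zero.2 fun p => by rw [(hc a p).2, Nat.cast_zero]
  rw [Kit.link_eq_cross, h1, h1, h2, h2]
  simp

theorem strength_lt_of_mem {τ : ℕ} (h : 2 ≤ τ) {t : TileType} (ht : t ∈ universalTiles τ)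
    (d : Side) : (t d).strength < τ := by
  obtain ⟨f, -, rfl⟩ := mem_universalTiles.1 ht
  exact kindStrength_lt h _

theorem link_single_lt {τ : ℕ} (h : 2 ≤ τ) {t : TileType} (ht : t ∈ universalTiles τ)
    {γ : Assembly} (u : ℤ × ℤ)
    (hu : ∀ d d', pairBond (some t) (γ (u + d.vec)) d ≠ 0 →
      pairBond (some t) (γ (u + d'.vec)) d' ≠ 0 → d = d') :
    link ((single t).translate u) γ < τ := by
  have e (p : ℤ × ℤ) : (single t).translate u p = if p = u then some t else none := by
    simp [single, sub_eq_zero]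
  have h0 (e' : (ℤ × ℤ) × Side) (hp : e'.1 ≠ u) :
      (pairBond ((single t).translate u e'.1) (γ (e'.1 + e'.2.vec)) e'.2 : ℝ≥0∞) = 0 := by
    rw [e, if_neg hp, pairBond_none_left, Nat.cast_zero]
  by_cases hd : ∃ d, pairBond (some t) (γ (u + d.vec)) d ≠ 0
  · obtain ⟨d, hd⟩ := hd
    rw [link, tsum_eq_single (u, d)]
    · rw [e, if_pos rfl]
      obtain ⟨s, s', hs, -, -, hv⟩ := pairBond_ne_zero hd
      rw [hv]
      rw [Option.some.injEq] at hs
      subst hs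
      exact Nat.cast_lt.2 (strength_lt_of_mem h ht d)
    · rintro ⟨p, d'⟩ hne
      by_cases hp : p = u
      · subst hp
        by_contra hc
        simp only [e, if_pos, Nat.cast_eq_zero] at hc
        exact hne (by rw [hu d d' hd hc])
      · exact h0 _ hp
  · push Not at hd
    have : link ((single t).translate u) γ = 0 := by
      refine ENNReal.tsum_eq_zero.2 fun ⟨p, d⟩ => ?_
      by_cases hp : p = u
      · simp only [e, if_pos hp]
        rw [hp, hd d, Nat.cast_zero]
      · exact h0 _ hp
    rw [this]
    exact Nat.cast_pos.2 (by omega)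

/-- Inner glues of `γ` are not exposed. -/
def NoInnerExposed (τ : ℕ) (γ : Assembly) : Prop :=
  ∀ p t d, γ p = some t → t d = kindGlue τ (some none) → p + d.vec ∈ γ.dom

theorem NoInnerExposed.translate {τ : ℕ} {γ : Assembly} (h : NoInnerExposed τ γ) (u : ℤ × ℤ) :
    NoInnerExposed τ (γ.translate u) := by
  intro p t d hp ht
  rw [mem_dom_translate, add_sub_right_comm]
  exact h _ t d hp ht

/-- No inner glue of the partner is exposed, so the tile can bind only by its one special glue,
which is weaker than the temperature. -/
theorem link_single_lt_of_noInnerExposed {τ : ℕ} (h : 2 ≤ τ) {t : TileType}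
    (ht : t ∈ universalTiles τ) {γ : Assembly} (hγ : NoInnerExposed τ γ) {u : ℤ × ℤ}
    (hd : Disjoint ((single t).translate u).dom γ.dom) : link ((single t).translate u) γ < τ := by
  have hu : u ∉ γ.dom := by
    refine Set.disjoint_left.1 hd (mem_dom_of_eq (t := t) ?_)
    simp [single]
  obtain ⟨f, hf, rfl⟩ := mem_universalTiles.1 ht
  have special (d : Side)
      (hb : pairBond (some fun d => kindGlue τ (f d)) (γ (u + d.vec)) d ≠ 0) :
      ∃ z, f d = some (some z) := by
    obtain ⟨s, s', hs, hs', hss, hv⟩ := pairBond_ne_zero hb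
    rw [Option.some.injEq] at hs
    subst hs
    rw [hv] at hb
    rcases hκ : f d with _ | _ | z
    · simp only [hκ] at hb
      exact absurd rfl hb
    · simp only [hκ] at hss
      refine absurd (hγ _ _ _ hs' hss.symm) ?_
      rwa [Side.vec_opposite, add_neg_cancel_right]
    · exact ⟨z, rfl⟩
  refine link_single_lt h ht u fun d d' h1 h2 => ?_
  obtain ⟨z, hz⟩ := special d h1
  obtain ⟨z', hz'⟩ := special d' h2
  exact hf _ _ _ _ hz hz'

theorem Side.vec_injective : Function.Injective Side.vec := by
  intro d d' h
  cases d <;> cases d' <;> simp [Side.vec] at h ⊢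

theorem link_single_single_lt {τ : ℕ} (h : 2 ≤ τ) {t t' : TileType}
    (ht : t ∈ universalTiles τ) (u u' : ℤ × ℤ) :
    link ((single t).translate u) ((single t').translate u') < τ := by
  have key (d : Side)
      (hb : pairBond (some t) ((single t').translate u' (u + d.vec)) d ≠ 0) :
      u + d.vec = u' := by
    by_contra hc
    refine hb ?_
    rw [translate_apply, single, if_neg (by rwa [sub_eq_zero]), pairBond_none_right]
  refine link_single_lt h ht u fun d d' h1 h2 => Side.vec_injective ?_
  have := (key d h1).trans (key d' h2).symm
  exact add_left_cancel this

namespace Kit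

variable {K : Kit}

theorem noInnerExposed_asm (π : Piece) : NoInnerExposed K.τ (K.asm π) := by
  intro p t d hp ht
  obtain ⟨-, rfl⟩ := K.asm_eq_some hp
  rw [mem_dom_asm, ← kindAt_eq_inner]
  exact kindGlue_injective _ ht

theorem noInnerExposed_render {β : Assembly} {P : PadSet} (h : Consistent β P) :
    NoInnerExposed K.τ (K.render β P) := by
  intro p t d hp ht
  obtain ⟨x, hx, hxp⟩ := K.exists_placed hp
  exact (K.placedAsm_sub_render h hx).dom_subset
    ((noInnerExposed_asm x.1).translate _ p t d hxp ht)

theorem render_over {β : Assembly} {P : PadSet} : (K.render β P).Over (universalTiles K.τ) := by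
  intro p t hp
  obtain ⟨x, -, hxp⟩ := K.exists_placed hp
  exact K.asm_over x.1 _ t hxp

/-! ### Bonds between placed pieces -/

theorem match_translate {π π' : Piece} {v v' p : ℤ × ℤ} {a : Bool} (hπ : K.Coded π)
    (hπ' : K.Coded π')
    (hd : Disjoint ((K.asm π).translate v).dom ((K.asm π').translate v').dom)
    (h0 : pairBond ((K.asm π).translate v p) ((K.asm π').translate v' (p + (cross a).vec))
      (cross a) ≠ 0) :
    ∃ k l A o o' x i, HasFace π false a k l A o ∧ HasFace π' true a k l A o' ∧
      v' - v = scale (2 * K.M) (o' - o) ∧ 0 < x ∧ x < K.w ∧ K.slot l k A x = some i ∧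
      p - v + scale (2 * K.M) o = K.slotPos a k l x ∧
      pairBond ((K.asm π).translate v p) ((K.asm π').translate v' (p + (cross a).vec)) (cross a) =
        kindStrength K.τ (some (some (a, k, l, i))) := by
  obtain ⟨s, s', hs, hs', hss, hval⟩ := pairBond_ne_zero h0
  rw [hval] at h0 ⊢
  refine K.match_cases hπ hπ' (u := v' - v) ?_ hs ?_ hss h0
  · rw [← disjoint_translate (u := v), translate_translate, sub_add_cancel]
    exact hd
  · rw [← hs', translate_apply]
    congr 1
    abel

theorem coded_pad {a k j : Bool} {A : Glue} (hA : A ∈ K.labels) : K.Coded (.pad a k j A) := by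
  rintro r a' k' l A' o ⟨-, -, rfl, -⟩
  exact hA

theorem halfLink_pad_pad {a₁ k₁ j₁ a₂ k₂ j₂ : Bool} {A B : Glue} {v v' : ℤ × ℤ}
    (hA : A ∈ K.labels) (hB : B ∈ K.labels)
    (hd : Disjoint ((K.asm (.pad a₁ k₁ j₁ A)).translate v).dom
      ((K.asm (.pad a₂ k₂ j₂ B)).translate v').dom) (a : Bool) :
    halfLink ((K.asm (.pad a₁ k₁ j₁ A)).translate v) ((K.asm (.pad a₂ k₂ j₂ B)).translate v')
      (cross a) ≤ if a₁ = a ∧ a₂ = a ∧ j₁ = false ∧ j₂ = true then (K.share k₁ A : ℝ≥0∞) else 0 := by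
  classical
  have key (p : ℤ × ℤ) (h0 : pairBond ((K.asm (.pad a₁ k₁ j₁ A)).translate v p)
      ((K.asm (.pad a₂ k₂ j₂ B)).translate v' (p + (cross a).vec)) (cross a) ≠ 0) :
      (a₁ = a ∧ a₂ = a ∧ j₁ = false ∧ j₂ = true) ∧ ∃ x : {x : ℤ // x ∈ Finset.Ioo 0 K.w},
        p = K.slotPos a k₁ 1 x + v ∧ pairBond ((K.asm (.pad a₁ k₁ j₁ A)).translate v p)
          ((K.asm (.pad a₂ k₂ j₂ B)).translate v' (p + (cross a).vec)) (cross a) =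
          K.slotStrength k₁ A x := by
    obtain ⟨k, l, A', o, o', x, i, hf, hf', hu, hx, hxw, hsl, hp, hst⟩ :=
      match_translate (coded_pad hA) (coded_pad hB) hd h0
    obtain ⟨rfl, rfl, rfl, rfl, hl⟩ := hf
    obtain ⟨rfl, rfl, -, rfl, hl'⟩ := hf'
    have hj : j₁ = false ∧ j₂ = true := by
      rw [hl] at hl'
      cases j₁ <;> cases j₂ <;> simp at hl' ⊢
    obtain ⟨rfl, rfl⟩ := hj
    obtain rfl : l = 1 := by simpa using hl
    refine ⟨⟨rfl, rfl, rfl, rfl⟩, ⟨x, Finset.mem_Ioo.2 ⟨hx, hxw⟩⟩, ?_, ?_⟩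
    · rw [← hp]; simp
    · rw [hst, slotStrength_eq K hsl]
  split_ifs with hc
  · calc _ ≤ ∑' p : ℤ × ℤ, ∑' x : {x : ℤ // x ∈ Finset.Ioo 0 K.w},
          if p = K.slotPos a k₁ 1 x + v then (K.slotStrength k₁ A x : ℝ≥0∞) else 0 := by
          refine ENNReal.tsum_le_tsum fun p => ?_
          by_cases h0 : pairBond ((K.asm (.pad a₁ k₁ j₁ A)).translate v p)
            ((K.asm (.pad a₂ k₂ j₂ B)).translate v' (p + (cross a).vec)) (cross a) = 0
          · rw [h0]; simp
          · obtain ⟨-, x, hp, hv⟩ := key p h0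
            refine le_trans ?_ (ENNReal.le_tsum x)
            rw [if_pos hp, hv]
      _ = ∑' x : {x : ℤ // x ∈ Finset.Ioo 0 K.w}, (K.slotStrength k₁ A x : ℝ≥0∞) := by
          rw [ENNReal.tsum_comm]
          exact tsum_congr fun x => tsum_ite_eq _ _
      _ ≤ K.share k₁ A := by
          rw [tsum_fintype, ← Nat.cast_sum, ← K.sum_slotStrength]
          exact Nat.cast_le.2 (Finset.sum_coe_sort (Finset.Ioo 0 K.w) (K.slotStrength k₁ A)).le
  · refine (ENNReal.tsum_eq_zero.2 fun p => ?_).le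
    by_contra h0
    exact hc (key p (by exact_mod_cast h0)).1

theorem share_lt (k : Bool) (A : Glue) : K.share k A < K.τ := by
  have := K.two_le
  simp only [share]
  split_ifs <;> have := min_le_right A.strength K.τ <;> omega

/-- Two pads share at most one port, and a port carries at most about half of the temperature. This
is the reason for having two ports per border. -/
theorem link_pad_pad_lt {a₁ k₁ j₁ a₂ k₂ j₂ : Bool} {A B : Glue} {v v' : ℤ × ℤ}
    (hA : A ∈ K.labels) (hB : B ∈ K.labels)
    (hd : Disjoint ((K.asm (.pad a₁ k₁ j₁ A)).translate v).dom
      ((K.asm (.pad a₂ k₂ j₂ B)).translate v').dom) :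
    link ((K.asm (.pad a₁ k₁ j₁ A)).translate v) ((K.asm (.pad a₂ k₂ j₂ B)).translate v') <
      K.τ := by
  have h1 := halfLink_pad_pad hA hB hd
  have h2 := halfLink_pad_pad hB hA hd.symm
  have hs1 : (K.share k₁ A : ℝ≥0∞) < K.τ := Nat.cast_lt.2 (share_lt k₁ A)
  have hs2 : (K.share k₂ B : ℝ≥0∞) < K.τ := Nat.cast_lt.2 (share_lt k₂ B)
  have hτ : (0 : ℝ≥0∞) < K.τ := Nat.cast_pos.2 (by have := K.two_le; omega)
  rw [link_eq_cross]
  refine (add_le_add (add_le_add (h1 true) (h2 true))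
    (add_le_add (h1 false) (h2 false))).trans_lt ?_
  cases a₁ <;> cases a₂ <;> cases j₁ <;> cases j₂ <;> simp [hs1, hs2, hτ]

/-! ### Attachments of configurations -/

theorem label_eq_of_placed {x y : Piece × ℤ × ℤ} {a k : Bool} {l : Fin 3} {A B : Glue}
    {o o' : ℤ × ℤ} (hx : K.Coded x.1) (hy : K.Coded y.1) (hf : HasFace x.1 false a k l A o)
    (hf' : HasFace y.1 true a k l B o') (hq : x.2 - o = y.2 - o')
    (hd : Disjoint (K.placedAsm x).dom (K.placedAsm y).dom) : A = B := by
  refine K.label_eq_of_disjoint hf hf' (hx _ _ _ _ _ _ hf) (hy _ _ _ _ _ _ hf') ?_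
  rw [disjoint_placedAsm_iff] at hd
  rwa [show o' - o = y.2 - x.2 from by rw [sub_eq_sub_iff_add_eq_add] at hq ⊢; rw [add_comm, ← hq,
    add_comm]]

variable (K) in
/-- Every tile of `X` belongs to a placed piece with the property `Φ`. -/
def Composed (Φ : Piece → ℤ × ℤ → Prop) (X : Assembly) : Prop :=
  ∀ p t, X p = some t → ∃ π v, Φ π v ∧ K.Coded π ∧ ((K.asm π).translate v).Sub X ∧
    (K.asm π).translate v p = some t

theorem Composed.match {Φ Ψ : Piece → ℤ × ℤ → Prop} {X Y : Assembly} (hX : K.Composed Φ X)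
    (hY : K.Composed Ψ Y) (hd : Disjoint X.dom Y.dom) {a : Bool} {p : ℤ × ℤ}
    (h0 : pairBond (X p) (Y (p + (cross a).vec)) (cross a) ≠ 0) :
    ∃ π v π' v' k l A o o', Φ π v ∧ Ψ π' v' ∧ HasFace π false a k l A o ∧
      HasFace π' true a k l A o' ∧ v' - v = scale (2 * K.M) (o' - o) ∧
      (K.asm π).translate v p = X p ∧
      (K.asm π').translate v' (p + (cross a).vec) = Y (p + (cross a).vec) := by
  obtain ⟨s, s', hs, hs', -, -⟩ := pairBond_ne_zero h0
  obtain ⟨π, v, hΦ, hπ, hsub, hp⟩ := hX _ _ hs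
  obtain ⟨π', v', hΨ, hπ', hsub', hp'⟩ := hY _ _ hs'
  obtain ⟨k, l, A, o, o', x, i, hf, hf', hv, -⟩ := match_translate hπ hπ'
    (hd.mono hsub.dom_subset hsub'.dom_subset) (p := p) (a := a) (by rwa [hp, hp', ← hs, ← hs'])
  exact ⟨π, v, π', v', k, l, A, o, o', hΦ, hΨ, hf, hf', hv, hp.trans hs.symm, hp'.trans hs'.symm⟩

variable {β β' : Assembly} {P P' : PadSet}

theorem composed_render (h : Consistent β P) (hl : K.Labeled β) (u : ℤ × ℤ) :
    K.Composed (fun π v => ∃ q, (π, q) ∈ Placed β P ∧ v = scale (2 * K.M) q + u)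
      ((K.render β P).translate u) := by
  intro p t hp
  obtain ⟨x, hx, hxp⟩ := K.exists_placed hp
  refine ⟨x.1, _, ⟨x.2, hx, rfl⟩, hl.coded hx, ?_, ?_⟩
  · have := (K.placedAsm_sub_render h hx).translate u
    rwa [placedAsm, translate_translate] at this
  · rw [← hxp, ← translate_translate]
    rfl

theorem composed_asm {π : Piece} (hπ : K.Coded π) (u : ℤ × ℤ) :
    K.Composed (fun π' v => π' = π ∧ v = u) ((K.asm π).translate u) :=
  fun _ _ hp => ⟨π, u, ⟨rfl, rfl⟩, hπ, Sub.refl _, hp⟩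

theorem two_mul_M_pos : 0 < 2 * K.M := by have := K.M_pos; omega

theorem link_le_of_bonds {X X' Y Y' : Assembly}
    (h : ∀ a p, pairBond (X p) (Y (p + (cross a).vec)) (cross a) ≠ 0 →
      pairBond (X p) (Y (p + (cross a).vec)) (cross a) =
        pairBond (X' p) (Y' (p + (cross a).vec)) (cross a))
    (h' : ∀ a p, pairBond (Y p) (X (p + (cross a).vec)) (cross a) ≠ 0 →
      pairBond (Y p) (X (p + (cross a).vec)) (cross a) =
        pairBond (Y' p) (X' (p + (cross a).vec)) (cross a)) : link X Y ≤ link X' Y' := by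
  have key {X X' Y Y' : Assembly}
    (h : ∀ a p, pairBond (X p) (Y (p + (cross a).vec)) (cross a) ≠ 0 →
      pairBond (X p) (Y (p + (cross a).vec)) (cross a) =
        pairBond (X' p) (Y' (p + (cross a).vec)) (cross a)) (a : Bool) :
      halfLink X Y (cross a) ≤ halfLink X' Y' (cross a) := by
    refine ENNReal.tsum_le_tsum fun p => ?_
    by_cases h0 : pairBond (X p) (Y (p + (cross a).vec)) (cross a) = 0
    · simp [h0]
    · rw [h a p h0]
  rw [link_eq_cross, link_eq_cross]
  exact add_le_add (add_le_add (key h _) (key h' _)) (add_le_add (key h _) (key h' _))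

/-- If no bond mounts the pad on a body, every bond lies in a middle lock. The position of the new
pad then singles out one opposite pad that accounts for all bonds, and a pair of pads binds too
weakly. -/
theorem render_attach_pad_mounted (h : Consistent β P) (hl : K.Labeled β) {a k j : Bool} {A : Glue}
    (hA : A ∈ K.labels) {u : ℤ × ℤ}
    (hd : Disjoint (K.render β P).dom ((K.asm (.pad a k j A)).translate u).dom)
    (hτ : (K.τ : ℝ≥0∞) ≤ link (K.render β P) ((K.asm (.pad a k j A)).translate u)) :
    ∃ q t, u = scale (2 * K.M) q ∧ β (owner q a j) = some t ∧ A = t (padSide a j) := by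
  by_contra hn
  have cX : K.Composed (fun π v => ∃ q, (π, q) ∈ Placed β P ∧ v = scale (2 * K.M) q)
      (K.render β P) := by simpa using composed_render (K := K) h hl 0
  have cY := composed_asm (K := K) (coded_pad (a := a) (k := k) (j := j) hA) u
  set X := K.render β P with hXdef
  set Y := (K.asm (.pad a k j A)).translate u with hYdef
  have key1 (a' : Bool) (p : ℤ × ℤ)
      (h0 : pairBond (X p) (Y (p + (cross a').vec)) (cross a') ≠ 0) :
      ∃ q, u = scale (2 * K.M) q ∧ (Piece.pad a k (!j) A, q) ∈ Placed β P ∧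
        K.placedAsm (Piece.pad a k (!j) A, q) p = X p := by
    obtain ⟨π, v, π', v', k', l, A', o, o', ⟨q, hx, rfl⟩, ⟨rfl, rfl⟩, hf, hf', hv, hp, -⟩ :=
      cX.match cY hd h0
    obtain ⟨rfl, rfl, rfl, rfl, hlj⟩ := hf'
    rcases mem_placed_face hx hf with ⟨t, h1, h2, h3⟩ | ⟨j', t, h1, h2, h3, h4, h5, h6⟩
    · exfalso
      rcases h3 with ⟨-, h4, h5, h6⟩ | ⟨h3, -⟩
      · obtain rfl : j = false := by
          rw [h4] at hlj; cases j <;> simp at hlj ⊢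
        rw [h6, sub_zero, scale_zero, sub_eq_zero] at hv
        exact hn ⟨q, t, hv, h2, h5⟩
      · simp at h3
    · obtain ⟨rfl, rfl⟩ : j' = false ∧ j = true := by
        rw [h6] at hlj
        cases j <;> cases j' <;> simp at hlj ⊢
      rw [h5, sub_zero, scale_zero, sub_eq_zero] at hv
      simp only at h1
      subst h1
      exact ⟨q, hv, hx, hp⟩
  have key2 (a' : Bool) (p : ℤ × ℤ)
      (h0 : pairBond (Y p) (X (p + (cross a').vec)) (cross a') ≠ 0) :
      ∃ q, u = scale (2 * K.M) q ∧ (Piece.pad a k (!j) A, q) ∈ Placed β P ∧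
        K.placedAsm (Piece.pad a k (!j) A, q) (p + (cross a').vec) = X (p + (cross a').vec) := by
    obtain ⟨π', v', π, v, k', l, A', o', o, ⟨rfl, rfl⟩, ⟨q, hx, rfl⟩, hf', hf, hv, -, hp⟩ :=
      cY.match cX hd.symm h0
    obtain ⟨rfl, rfl, rfl, rfl, hlj⟩ := hf'
    rcases mem_placed_face hx hf with ⟨t, h1, h2, h3⟩ | ⟨j', t, h1, h2, h3, h4, h5, h6⟩
    · exfalso
      rcases h3 with ⟨h3, -⟩ | ⟨-, h4, h5, h6⟩
      · simp at h3
      · obtain rfl : j = true := by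
          rw [h4] at hlj; cases j <;> simp at hlj ⊢
        rw [h6, sub_zero, sub_eq_iff_eq_add, ← sub_eq_iff_eq_add', ← scale_sub] at hv
        refine hn ⟨q - (plus a').vec, t, hv.symm, ?_, h5⟩
        simpa [owner] using h2
    · obtain ⟨rfl, rfl⟩ : j' = true ∧ j = false := by
        rw [h6] at hlj
        cases j <;> cases j' <;> simp at hlj ⊢
      rw [h5, sub_zero, scale_zero, sub_eq_zero] at hv
      simp only at h1
      subst h1
      exact ⟨q, hv.symm, hx, hp⟩
  have h0 : link X Y ≠ 0 := by
    intro h0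
    rw [h0] at hτ
    have := K.two_le
    exact absurd (Nat.cast_le.1 (hτ.trans_eq Nat.cast_zero.symm)) (by omega)
  obtain ⟨q₀, hu, hq₀⟩ : ∃ q, u = scale (2 * K.M) q ∧ (Piece.pad a k (!j) A, q) ∈ Placed β P := by
    obtain ⟨a', p, h0 | h0⟩ := exists_bond_of_link h0
    · obtain ⟨q, h1, h2, -⟩ := key1 a' p h0
      exact ⟨q, h1, h2⟩
    · obtain ⟨q, h1, h2, -⟩ := key2 a' p h0
      exact ⟨q, h1, h2⟩
  have hlink : link X Y ≤ link (K.placedAsm (Piece.pad a k (!j) A, q₀)) Y := by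
    refine link_le_of_bonds (fun a' p hb => ?_) fun a' p hb => ?_
    · obtain ⟨q, h1, -, h3⟩ := key1 a' p hb
      rw [scale_injective two_mul_M_pos (hu.symm.trans h1), h3]
    · obtain ⟨q, h1, -, h3⟩ := key2 a' p hb
      rw [scale_injective two_mul_M_pos (hu.symm.trans h1), h3]
  exact absurd (hτ.trans hlink) (not_le.2 (link_pad_pad_lt hA hA
    (hd.mono_left (K.placedAsm_sub_render h hq₀).dom_subset)))

/-- Pads that have been attached to a configuration agree with those it has. -/
theorem consistent_insert (h : Consistent β P) (hl : K.Labeled β) {a k j : Bool} {q : ℤ × ℤ}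
    {t : TileType} (ht : β (owner q a j) = some t)
    (hd : Disjoint (K.render β P).dom (K.placedAsm (.pad a k j (t (padSide a j)), q)).dom) :
    (q, a, k, j) ∉ P ∧ Consistent β (insert (q, a, k, j) P) := by
  have hm {k' j' : Bool} {t' : TileType} (hq : (q, a, k', j') ∈ P)
      (ht' : β (owner q a j') = some t') :
      Disjoint (K.placedAsm (.pad a k' j' (t' (padSide a j')), q)).dom
        (K.placedAsm (.pad a k j (t (padSide a j)), q)).dom :=
    hd.mono_left (K.placedAsm_sub_render h (pad_mem_placed hq ht')).dom_subset
  have hnot : (q, a, k, j) ∉ P := by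
    intro hq
    have := hm hq ht
    rw [disjoint_self, Set.bot_eq_empty] at this
    exact (K.placedAsm_nonempty _).ne_empty this
  refine ⟨hnot, fun q' a' k' j' hq => ?_, fun q' a' k' t1 t2 h1 h2 ht1 ht2 => ?_⟩
  · rcases hq with hq | hq
    · simp only [Prod.mk.injEq] at hq
      obtain ⟨rfl, rfl, rfl, rfl⟩ := hq
      exact mem_dom_of_eq ht
    · exact h.owner_mem _ _ _ _ hq
  · have c1 := coded_pad (a := a) (k := k) (j := j) (hl _ _ (padSide a j) ht)
    rcases h1 with h1 | h1 <;> rcases h2 with h2 | h2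
    · simp only [Prod.mk.injEq] at h1 h2
      rw [← h1.2.2.2] at h2
      simp at h2
    · simp only [Prod.mk.injEq] at h1
      obtain ⟨rfl, rfl, rfl, rfl⟩ := h1
      obtain rfl : t = t1 := by
        simpa [owner, ht1] using ht.symm
      have hd' := hm h2 (t' := t2) (by simpa [owner] using ht2)
      exact label_eq_of_placed (l := 1) (o := 0) (o' := 0) (x := (.pad a' k' false _, q'))
        (y := (.pad a' k' true _, q')) c1 (coded_pad (hl _ _ _ ht2))
        ⟨rfl, rfl, rfl, rfl, rfl⟩ ⟨rfl, rfl, rfl, rfl, rfl⟩ rfl hd'.symm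
    · simp only [Prod.mk.injEq] at h2
      obtain ⟨rfl, rfl, rfl, rfl⟩ := h2
      obtain rfl : t = t2 := by
        simpa [owner, ht2] using ht.symm
      have hd' := hm h1 (t' := t1) (by simpa [owner] using ht1)
      exact label_eq_of_placed (l := 1) (o := 0) (o' := 0) (x := (.pad a' k' false _, q'))
        (y := (.pad a' k' true _, q')) (coded_pad (hl _ _ _ ht1)) c1
        ⟨rfl, rfl, rfl, rfl, rfl⟩ ⟨rfl, rfl, rfl, rfl, rfl⟩ rfl hd'
    · exact h.agree q' a' k' t1 t2 h1 h2 ht1 ht2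

/-- Opposite pads that come from different configurations hold the two parts of the same middle
lock, so disjointness alone forces equal labels. -/
theorem consistent_union (h : Consistent β P) (h' : Consistent β' P') (hl : K.Labeled β)
    (hl' : K.Labeled β') (hd : Disjoint (K.render β P).dom (K.render β' P').dom) :
    Consistent (β.union β') (P ∪ P') := by
  have hdβ := K.disjoint_of_render h h' hd
  refine ⟨fun q a k j hq => ?_, fun q a k t t' h1 h2 ht ht' => ?_⟩
  · rw [dom_union]
    exact hq.imp (h.owner_mem _ _ _ _) (h'.owner_mem _ _ _ _)
  have e1 {j : Bool} (hq : (q, a, k, j) ∈ P) : β.union β' (owner q a j) = β (owner q a j) :=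
    union_of_mem (h.owner_mem _ _ _ _ hq)
  have e2 {j : Bool} (hq : (q, a, k, j) ∈ P') : β.union β' (owner q a j) = β' (owner q a j) :=
    union_of_mem_right hdβ (h'.owner_mem _ _ _ _ hq)
  have ht : β.union β' (owner q a false) = some t := ht
  have ht' : β.union β' (owner q a true) = some t' := ht'
  rcases h1 with h1 | h1 <;> rcases h2 with h2 | h2
  · exact h.agree q a k t t' h1 h2 ((e1 h1).symm.trans ht) ((e1 h2).symm.trans ht')
  · have g1 := (e1 h1).symm.trans ht
    have g2 := (e2 h2).symm.trans ht'
    exact label_eq_of_placed (l := 1) (o := 0) (o' := 0) (x := (.pad a k false _, q))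
      (y := (.pad a k true _, q)) (coded_pad (hl _ _ _ g1))
      (coded_pad (hl' _ _ _ g2)) ⟨rfl, rfl, rfl, rfl, rfl⟩ ⟨rfl, rfl, rfl, rfl, rfl⟩ rfl
      (hd.mono (K.placedAsm_sub_render h (pad_mem_placed h1 g1)).dom_subset
        (K.placedAsm_sub_render h' (pad_mem_placed h2 g2)).dom_subset)
  · have g1 := (e2 h1).symm.trans ht
    have g2 := (e1 h2).symm.trans ht'
    exact label_eq_of_placed (l := 1) (o := 0) (o' := 0) (x := (.pad a k false _, q))
      (y := (.pad a k true _, q)) (coded_pad (hl' _ _ _ g1))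
      (coded_pad (hl _ _ _ g2)) ⟨rfl, rfl, rfl, rfl, rfl⟩ ⟨rfl, rfl, rfl, rfl, rfl⟩ rfl
      (hd.symm.mono (K.placedAsm_sub_render h' (pad_mem_placed h1 g1)).dom_subset
        (K.placedAsm_sub_render h (pad_mem_placed h2 g2)).dom_subset)
  · exact h'.agree q a k t t' h1 h2 ((e2 h1).symm.trans ht) ((e2 h2).symm.trans ht')

/-- A single bond suffices to align the two lattices of macrotiles. -/
theorem render_attach_render (h : Consistent β P) (h' : Consistent β' P') (hl : K.Labeled β)
    (hl' : K.Labeled β') {u : ℤ × ℤ}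
    (hd : Disjoint (K.render β P).dom ((K.render β' P').translate u).dom)
    (h0 : link (K.render β P) ((K.render β' P').translate u) ≠ 0) :
    ∃ v, u = scale (2 * K.M) v := by
  have cX : K.Composed (fun π v => ∃ q, (π, q) ∈ Placed β P ∧ v = scale (2 * K.M) q)
      (K.render β P) := by simpa using composed_render (K := K) h hl 0
  have cY := composed_render (K := K) h' hl' u
  obtain ⟨a', p, h0 | h0⟩ := exists_bond_of_link h0
  · obtain ⟨π, v, π', v', k', l, A', o, o', ⟨q, hx, rfl⟩, ⟨q', hx', rfl⟩, hf, hf', hv, -⟩ :=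
      cX.match cY hd h0
    refine ⟨o' - o + q - q', ?_⟩
    rw [scale_sub, scale_add, ← hv]
    abel
  · obtain ⟨π', v', π, v, k', l, A', o', o, ⟨q', hx', rfl⟩, ⟨q, hx, rfl⟩, hf', hf, hv, -⟩ :=
      cY.match cX hd.symm h0
    refine ⟨-(o - o') + q - q', ?_⟩
    rw [scale_sub, scale_add, scale_neg, ← hv]
    abel

end Kit

end TwoHAM

end

/-! ### Stability of configurations -/

noncomputable section

namespace TwoHAM

open Assembly Relation

/-- Both ends of the border that a pad in `P` belongs to are occupied in `β`. -/
def Internal (β : Assembly) (P : PadSet) : Prop :=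
  ∀ q a k j, (q, a, k, j) ∈ P → owner q a (!j) ∈ β.dom

/-- The pads at the borders between tiles of `β` with equal abutting glues. -/
def fullPads (β : Assembly) : PadSet :=
  {x | ∃ t t', β x.1 = some t ∧ β (x.1 + (plus x.2.1).vec) = some t' ∧
    t (plus x.2.1) = t' (plus x.2.1).opposite}

theorem fullPads_consistent (β : Assembly) : Consistent β (fullPads β) := by
  refine ⟨fun q a k j h => ?_, fun q a k t t' h _ ht ht' => ?_⟩
  · obtain ⟨t, t', ht, ht', -⟩ := h
    cases j
    · exact mem_dom_of_eq ht
    · exact mem_dom_of_eq ht'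
  · obtain ⟨s, s', hs, hs', hss⟩ := h
    simp only at hs hs' hss
    rw [ht, Option.some.injEq] at hs
    rw [ht', Option.some.injEq] at hs'
    rwa [hs, hs']

theorem fullPads_internal (β : Assembly) : Internal β (fullPads β) := by
  rintro q a k j ⟨t, t', ht, ht', -⟩
  cases j
  · exact mem_dom_of_eq ht'
  · exact mem_dom_of_eq ht

theorem fullPads_translate (β : Assembly) (v : ℤ × ℤ) :
    fullPads (β.translate v) = (fullPads β).shift v := by
  ext ⟨q, a, k, j⟩
  simp only [fullPads, PadSet.shift, Set.mem_ofPred_eq, translate_apply, add_sub_right_comm]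

theorem Internal.translate {β : Assembly} {P : PadSet} (h : Internal β P) (v : ℤ × ℤ) :
    Internal (β.translate v) (P.shift v) := by
  intro q a k j hq
  have := h _ _ _ _ hq
  rwa [owner_sub] at this

theorem edgeBond_ne_zero {β β' : Assembly} {ρ : ℤ × ℤ} {a j : Bool}
    (h : Kit.edgeBond β β' (ρ, a, j) ≠ 0) :
    owner ρ a j ∈ β.dom ∧ owner ρ a (!j) ∈ β'.dom ∧
      ∀ γ : Assembly, β.Sub γ → β'.Sub γ → ∃ t t', γ ρ = some t ∧
        γ (ρ + (plus a).vec) = some t' ∧ t (plus a) = t' (plus a).opposite := by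
  cases j
  · obtain ⟨t, t', h1, h2, h3, -⟩ := pairBond_ne_zero h
    exact ⟨mem_dom_of_eq h1, mem_dom_of_eq h2, fun γ hγ hγ' =>
      ⟨t, t', hγ.apply_eq_some h1, hγ'.apply_eq_some h2, h3⟩⟩
  · obtain ⟨t, t', h1, h2, h3, -⟩ := pairBond_ne_zero h
    exact ⟨mem_dom_of_eq h2, mem_dom_of_eq h1, fun γ hγ hγ' =>
      ⟨t, t', hγ'.apply_eq_some h1, hγ.apply_eq_some h2, h3⟩⟩

namespace Kit

variable {K : Kit} {β β' : Assembly} {P P' : PadSet}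

/-! ### Stability of configurations -/

theorem link_placed_mount {x y : Piece × ℤ × ℤ} {a k : Bool} {l : Fin 3} {A : Glue}
    {o o' : ℤ × ℤ} (hl : l ≠ 1) (hf : HasFace x.1 false a k l A o)
    (hf' : HasFace y.1 true a k l A o') (hq : x.2 - o = y.2 - o')
    (hd : Disjoint (K.placedAsm x).dom (K.placedAsm y).dom) :
    (K.τ : ℝ≥0∞) ≤ link (K.placedAsm x) (K.placedAsm y) := by
  have e : y.2 - x.2 = o' - o := by
    rw [sub_eq_sub_iff_add_eq_add] at hq ⊢
    rw [← hq, add_comm]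
  rw [disjoint_placedAsm_iff, e] at hd
  refine (K.mount_link hl hf hf' hd).trans (le_of_eq ?_)
  rw [← link_translate (scale (2 * K.M) x.2), Assembly.translate_translate, ← scale_add, ← e,
    sub_add_cancel]
  rfl

theorem link_body_pad {q : ℤ × ℤ} {a k j : Bool} {t : TileType}
    (hd : Disjoint (K.placedAsm (.body t, owner q a j)).dom
      (K.placedAsm (.pad a k j (t (padSide a j)), q)).dom) :
    (K.τ : ℝ≥0∞) ≤ link (K.placedAsm (.body t, owner q a j))
      (K.placedAsm (.pad a k j (t (padSide a j)), q)) := by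
  cases j
  · exact link_placed_mount (l := 0) (a := a) (k := k) (A := t (plus a)) (o := 0) (o' := 0)
      (by simp) (Or.inl ⟨rfl, rfl, rfl, rfl⟩) ⟨rfl, rfl, rfl, rfl, rfl⟩ rfl hd
  · rw [link_comm]
    exact link_placed_mount (l := 2) (a := a) (k := k) (A := t (plus a).opposite) (o := 0)
      (o' := (plus a).vec) (by simp) ⟨rfl, rfl, rfl, rfl, rfl⟩ (Or.inr ⟨rfl, rfl, rfl, rfl⟩)
      (by simp [owner]) hd.symm

theorem placed_disjoint (h : Consistent β P) {x y : Piece × ℤ × ℤ} (hx : x ∈ Placed β P)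
    (hy : y ∈ Placed β P) (hxy : x ≠ y) : Disjoint (K.placedAsm x).dom (K.placedAsm y).dom :=
  Set.disjoint_left.2 fun _ h1 h2 => hxy (K.placed_eq h hx hy h1 h2)

variable (K) in
/-- A tile in the core of the macrotile at a given position. -/
def coreTile (q : ℤ × ℤ) : ℤ × ℤ := scale 2 (K.cellAt false false 0 0 0 + scale K.M q)

/-- A light cut splits no body and separates no pad from its owner, so it is determined by its
values on one core tile per macrotile. -/
theorem tied_coreTile (h : Consistent β P) {p : ℤ × ℤ} (hp : p ∈ (K.render β P).dom) :
    ∃ q ∈ β.dom, Tied K.τ (K.render β P) p (K.coreTile q) := by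
  obtain ⟨s, hs⟩ := mem_dom_iff.1 hp
  obtain ⟨⟨π, q⟩, hx, hxp⟩ := K.exists_placed hs
  rcases hx with ⟨t, h1, h2⟩ | ⟨a, k, j, t, h1, h2, h3⟩ <;> simp only at h1 h2 <;> subst h1
  · exact ⟨q, mem_dom_of_eq h2, ((K.placedAsm_stable _).tied (mem_dom_of_eq hxp)
      (K.mem_dom_body_core t q)).mono (K.placedAsm_sub_render h (body_mem_placed P h2))⟩
  · have m1 := body_mem_placed P h3
    have m2 := pad_mem_placed h2 h3
    have hd : Disjoint (K.placedAsm (.body t, owner q a j)).dom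
        (K.placedAsm (.pad a k j (t (padSide a j)), q)).dom :=
      placed_disjoint h m1 m2 (by simp)
    refine ⟨owner q a j, mem_dom_of_eq h3, Tied.mono (Stable.tied (stable_union
      (K.placedAsm_stable _) (K.placedAsm_stable _) hd (link_body_pad hd)) ?_ ?_)
      (union_sub (K.placedAsm_sub_render h m1) (K.placedAsm_sub_render h m2))⟩
    · rw [dom_union]
      exact Or.inr (mem_dom_of_eq hxp)
    · rw [dom_union]
      exact Or.inl (K.mem_dom_body_core t _)

/-- A light cut of the configuration would induce a cut of `β`. Finitely many edges across the
latter reach the temperature, and as all their pads are present, so do the bonds across the former.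
-/
theorem render_fullPads_stable (hβ : β.Stable K.τ) :
    (K.render β (fullPads β)).Stable K.τ := by
  classical
  intro A hA hA'
  have hc := fullPads_consistent β
  by_contra hlt
  have tied {p q : ℤ × ℤ} (ht : Tied K.τ (K.render β (fullPads β)) p q) : p ∈ A ↔ q ∈ A := by
    by_contra hn
    exact hlt (ht A hn)
  let B : Set (ℤ × ℤ) := {q | K.coreTile q ∈ A}
  -- Each pad goes to the side of its owner, so the two sides of the cut are configurations again.
  let Q (B : Set (ℤ × ℤ)) : PadSet := {x ∈ fullPads β | owner x.1 x.2.1 x.2.2.2 ∈ B}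
  have hcon (B : Set (ℤ × ℤ)) : Consistent (β.restrict B) (Q B) := by
    refine ⟨fun q a k j hq => ?_, fun q a k t t' h1 h2 ht ht' => ?_⟩
    · obtain ⟨t, ht⟩ := mem_dom_iff.1 (hc.owner_mem _ _ _ _ hq.1)
      exact mem_dom_of_eq (restrict_eq_some.2 ⟨hq.2, ht⟩)
    · exact hc.agree q a k t t' h1.1 h2.1 (restrict_eq_some.1 ht).2 (restrict_eq_some.1 ht').2
  have hsub (B : Set (ℤ × ℤ)) : (K.render (β.restrict B) (Q B)).Sub (K.render β (fullPads β)) :=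
    K.render_mono hc (restrict_sub B) fun x hx => hx.1
  have hB {C : Set (ℤ × ℤ)} {p : ℤ × ℤ} (hp : p ∈ (K.render (β.restrict C) (Q C)).dom) :
      ∃ q ∈ C, p ∈ A ↔ K.coreTile q ∈ A := by
    obtain ⟨q, hq, ht⟩ := tied_coreTile (hcon C) hp
    obtain ⟨t, h⟩ := mem_dom_iff.1 hq
    exact ⟨q, (restrict_eq_some.1 h).1, tied (ht.mono (hsub C))⟩
  have h1 : ∀ p ∈ (K.render (β.restrict B) (Q B)).dom, p ∈ A := fun p hp => by
    obtain ⟨q, hq, h⟩ := hB hp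
    exact h.2 hq
  have h2 : ∀ p ∈ (K.render (β.restrict Bᶜ) (Q Bᶜ)).dom, p ∈ Aᶜ := fun p hp => by
    obtain ⟨q, hq, h⟩ := hB hp
    exact fun hpA => hq (h.1 hpA)
  have hcut : (K.τ : ℝ≥0∞) ≤ β.cutWeight B := by
    apply hβ
    · obtain ⟨p, hp, hpA⟩ := hA
      obtain ⟨q, hq, ht⟩ := tied_coreTile hc hp
      exact ⟨q, hq, (tied ht).1 hpA⟩
    · obtain ⟨p, hp, hpA⟩ := hA'
      obtain ⟨q, hq, ht⟩ := tied_coreTile hc hp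
      exact ⟨q, hq, fun h => hpA ((tied ht).2 h)⟩
  rw [cutWeight_eq_link, link_eq_tsum_edgeBond] at hcut
  obtain ⟨F, hF⟩ := exists_finset_le_sum _ hcut
  refine hlt ?_
  rw [cutWeight_eq_link]
  refine (le_link_render (hcon B) (hcon Bᶜ) ?_ F hF ?_).trans (link_mono ?_ ?_)
  · exact Set.disjoint_left.2 fun p hp hp' => h2 p hp' (h1 p hp)
  · intro ρ a k j _ hb
    obtain ⟨ho, ho', hg⟩ := edgeBond_ne_zero hb
    obtain ⟨t, t', ht, ht', htt⟩ := hg β (restrict_sub _) (restrict_sub _)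
    obtain ⟨s, hs⟩ := mem_dom_iff.1 ho
    obtain ⟨s', hs'⟩ := mem_dom_iff.1 ho'
    exact ⟨⟨⟨t, t', ht, ht', htt⟩, (restrict_eq_some.1 hs).1⟩,
      ⟨⟨t, t', ht, ht', htt⟩, (restrict_eq_some.1 hs').1⟩⟩
  · exact sub_iff.2 fun p t hp => restrict_eq_some.2
      ⟨h1 p (mem_dom_of_eq hp), (hsub B).apply_eq_some hp⟩
  · exact sub_iff.2 fun p t hp => restrict_eq_some.2
      ⟨h2 p (mem_dom_of_eq hp), (hsub Bᶜ).apply_eq_some hp⟩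

theorem render_nonempty (h : Consistent β P) (hβ : β.dom.Nonempty) :
    (K.render β P).dom.Nonempty := by
  obtain ⟨q, hq⟩ := hβ
  obtain ⟨t, ht⟩ := mem_dom_iff.1 hq
  exact ⟨_, (K.placedAsm_sub_render h (body_mem_placed P ht)).dom_subset
    (K.mem_dom_body_core t q)⟩

theorem render_canAttach_pad {q : ℤ × ℤ} {a k j : Bool} {t : TileType}
    (hc : Consistent β (insert (q, a, k, j) P)) (hn : (q, a, k, j) ∉ P)
    (ht : β (owner q a j) = some t) (hs : (K.render β P).Stable K.τ) :
    (K.render β P).CanAttach K.τ (K.placedAsm (.pad a k j (t (padSide a j)), q)) := by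
  obtain ⟨hd, -⟩ := K.render_insert hc hn ht
  have hsub := K.placedAsm_sub_render (hc.mono (Set.subset_insert _ _)) (body_mem_placed P ht)
  refine canAttach_of_link hs (K.placedAsm_stable _) hd ?_
  exact (link_body_pad (hd.mono_left hsub.dom_subset)).trans (link_mono hsub (Sub.refl _))

end Kit

end TwoHAM

end

/-! ### The simulating system, and how it builds configurations -/

noncomputable section

namespace TwoHAM

open Assembly Relation

/-! ### The simulating system -/

/-- The kit codes the glues of the system and has its temperature. -/
structure Kit.Fits (K : Kit) (𝒯 : TAS) : Prop where
  temp : K.τ = 𝒯.temp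
  labels : K.labels = {g | ∃ t ∈ 𝒯.tiles, ∃ d, g = t d}

/-- The supertiles of the pads for the tiles of the system. -/
def Kit.padSupertiles (K : Kit) (𝒯 : TAS) : Set Supertile :=
  {s | ∃ a k j, ∃ t ∈ 𝒯.tiles, s = (K.asm (.pad a k j (t (padSide a j)))).supertile}

/-- The supertiles that represent the initial supertiles of the system. -/
def Kit.macroSupertiles (K : Kit) (𝒯 : TAS) : Set Supertile :=
  {s | ∃ β : Assembly, β.supertile ∈ 𝒯.init ∧ s = (K.render β (fullPads β)).supertile}

theorem TAS.isStableAssembly_of_init {𝒯 : TAS} {β : Assembly} (h : β.supertile ∈ 𝒯.init) :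
    IsStableAssembly 𝒯.tiles 𝒯.temp β :=
  (𝒯.init_stable _ h).isStableAssembly (mem_supertile_self β)

/-- The system that simulates `𝒯`. -/
def Kit.simulator (K : Kit) (𝒯 : TAS) (hK : K.Fits 𝒯) : TAS where
  tiles := universalTiles K.τ
  init := tileSupertiles (universalTiles K.τ) ∪ (K.padSupertiles 𝒯 ∪ K.macroSupertiles 𝒯)
  temp := K.τ
  init_stable := by
    rintro s (⟨t, ht, rfl⟩ | ⟨a, k, j, t, -, rfl⟩ | ⟨β, hβ, rfl⟩)
    · refine ⟨_, ⟨0, mem_dom_of_eq (t := t) (by simp [single])⟩, fun p t' h => ?_,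
        single_stable _ t, rfl⟩
      simp only [single] at h
      split_ifs at h
      rw [Option.some.injEq] at h
      rwa [← h]
    · exact ⟨_, K.asm_nonempty _, K.asm_over _, K.asm_stable _, rfl⟩
    · have h := TAS.isStableAssembly_of_init hβ
      exact ⟨_, Kit.render_nonempty (fullPads_consistent β) h.nonempty, Kit.render_over,
        Kit.render_fullPads_stable (hK.temp ▸ h.stable), rfl⟩

namespace Kit

variable {K : Kit} {𝒯 : TAS} {β β' : Assembly} {P P' : PadSet}

theorem Fits.labeled (hK : K.Fits 𝒯) (h : β.Over 𝒯.tiles) : K.Labeled β := by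
  intro q t d hq
  rw [hK.labels]
  exact ⟨t, h q t hq, d, rfl⟩

theorem available_pad (hK : K.Fits 𝒯) {a k j : Bool} {t : TileType} (ht : t ∈ 𝒯.tiles)
    (q : ℤ × ℤ) :
    (K.simulator 𝒯 hK).Available (K.placedAsm (.pad a k j (t (padSide a j)), q)).supertile := by
  rw [placedAsm, supertile_translate]
  exact .init (Or.inr (Or.inl ⟨a, k, j, t, ht, rfl⟩))

theorem stable_of_reflTransGen {𝒰 : TAS} {p : Supertile → Prop} {α α' : Assembly}
    (h : ReflTransGen (𝒰.AttachStep p) α α') (hα : α.Stable 𝒰.temp) : α'.Stable 𝒰.temp := by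
  induction h with
  | refl => exact hα
  | tail _ hs _ =>
    obtain ⟨γ, -, hγ, rfl⟩ := hs
    exact hγ.2

/-- Finitely many pads can be attached to a configuration. -/
theorem add_pads (hK : K.Fits 𝒯) (hT : β.Over 𝒯.tiles)
    (hs : (K.render β P).Stable K.τ) {Q : PadSet} (hQ : Q.Finite) (hc : Consistent β (P ∪ Q)) :
    ReflTransGen ((K.simulator 𝒯 hK).AttachStep (K.simulator 𝒯 hK).Available)
      (K.render β P) (K.render β (P ∪ Q)) := by
  induction Q, hQ using Set.Finite.induction_on with
  | empty => rw [Set.union_empty]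
  | @insert x Q _ _ ih =>
    have ih := ih (hc.mono (Set.union_subset_union_right _ (Set.subset_insert _ _)))
    rw [Set.union_insert] at hc ⊢
    by_cases hx : x ∈ P ∪ Q
    · rwa [Set.insert_eq_of_mem hx]
    · refine ih.tail ?_
      obtain ⟨q, a, k, j⟩ := x
      obtain ⟨t, ht⟩ := mem_dom_iff.1 (hc.owner_mem q a k j (Set.mem_insert _ _))
      exact ⟨_, available_pad hK (hT _ _ ht) q,
        render_canAttach_pad hc hx ht (stable_of_reflTransGen ih hs),
        (K.render_insert hc hx ht).2⟩

/-- Two configurations that represent assemblies that can be attached can be provided with pads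
such that they can be attached. -/
theorem exists_pads (hK : K.Fits 𝒯) (hP : Consistent β P) (hP' : Consistent β' P')
    (hi : Internal β' P') (hT : β.Over 𝒯.tiles) (hT' : β'.Over 𝒯.tiles)
    (hs : (K.render β P).Stable K.τ) (hs' : (K.render β' P').Stable K.τ)
    (hβ : β.dom.Nonempty) (hβ' : β'.dom.Nonempty) (ha : β.CanAttach K.τ β') :
    ∃ Q Q', Consistent β Q ∧ Consistent β' Q' ∧ Consistent (β.union β') (Q ∪ Q') ∧ P ⊆ Q ∧
      ReflTransGen ((K.simulator 𝒯 hK).AttachStep (K.simulator 𝒯 hK).Available)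
        (K.render β P) (K.render β Q) ∧
      ReflTransGen ((K.simulator 𝒯 hK).AttachStep (K.simulator 𝒯 hK).Available)
        (K.render β' P') (K.render β' Q') ∧
      (K.render β Q).CanAttach K.τ (K.render β' Q') ∧
      (Internal β P → Internal (β.union β') (Q ∪ Q')) := by
  classical
  obtain ⟨hd, -⟩ := id ha
  have hlink := ha.link_le hβ hβ'
  rw [link_eq_tsum_edgeBond] at hlink
  obtain ⟨F₀, hF₀⟩ := exists_finset_le_sum _ hlink
  -- Edges without a bond are dropped, so that new pads appear only where the abutting glues are
  -- equal.
  set F := F₀.filter fun e => edgeBond β β' e ≠ 0 with hFdef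
  have hF : K.τ ≤ ∑ e ∈ F, edgeBond β β' e := by rwa [hFdef, Finset.sum_filter_ne_zero]
  have hF0 : ∀ ρ a j, (ρ, a, j) ∈ F → edgeBond β β' (ρ, a, j) ≠ 0 :=
    fun ρ a j h => (Finset.mem_filter.1 h).2
  let A : PadSet := {x | (x.1, x.2.1, x.2.2.2) ∈ F}
  let A' : PadSet := {x | (x.1, x.2.1, !x.2.2.2) ∈ F}
  have memA (ρ : ℤ × ℤ) (a k j : Bool) : (ρ, a, k, j) ∈ A ↔ (ρ, a, j) ∈ F := Iff.rfl
  have memA' (ρ : ℤ × ℤ) (a k j : Bool) : (ρ, a, k, j) ∈ A' ↔ (ρ, a, !j) ∈ F := Iff.rfl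
  have hA : A.Finite := by
    refine Set.Finite.subset (Set.Finite.image
      (fun e : ((ℤ × ℤ) × Bool × Bool) × Bool => (e.1.1, e.1.2.1, e.2, e.1.2.2))
      (F.finite_toSet.prod (Set.finite_univ (α := Bool)))) ?_
    rintro ⟨ρ, a, k, j⟩ hx
    exact ⟨((ρ, a, j), k), ⟨hx, trivial⟩, rfl⟩
  have hA' : A'.Finite := by
    refine Set.Finite.subset (Set.Finite.image
      (fun e : ((ℤ × ℤ) × Bool × Bool) × Bool => (e.1.1, e.1.2.1, e.2, !e.1.2.2))
      (F.finite_toSet.prod (Set.finite_univ (α := Bool)))) ?_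
    rintro ⟨ρ, a, k, j⟩ hx
    exact ⟨((ρ, a, !j), k), ⟨hx, trivial⟩, by simp⟩
  have oA {ρ : ℤ × ℤ} {a k j : Bool} (h : (ρ, a, k, j) ∈ A) :
      owner ρ a j ∈ β.dom ∧ owner ρ a (!j) ∈ β'.dom := by
    obtain ⟨h1, h2, -⟩ := edgeBond_ne_zero (hF0 _ _ _ ((memA _ _ _ _).1 h))
    exact ⟨h1, h2⟩
  have oA' {ρ : ℤ × ℤ} {a k j : Bool} (h : (ρ, a, k, j) ∈ A') :
      owner ρ a j ∈ β'.dom ∧ owner ρ a (!j) ∈ β.dom := by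
    obtain ⟨h1, h2, -⟩ := edgeBond_ne_zero (hF0 _ _ _ ((memA' _ _ _ _).1 h))
    rw [Bool.not_not] at h2
    exact ⟨h2, h1⟩
  have no : ∀ q, q ∈ β.dom → q ∈ β'.dom → False := fun q h1 h2 => Set.disjoint_left.1 hd h1 h2
  have gA {ρ : ℤ × ℤ} {a k j : Bool} (h : (ρ, a, k, j) ∈ A ∪ A') {t t' : TileType}
      (ht : β.union β' ρ = some t) (ht' : β.union β' (ρ + (plus a).vec) = some t') :
      t (plus a) = t' (plus a).opposite := by
    have : ∃ j, (ρ, a, j) ∈ F := by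
      rcases h with h | h
      · exact ⟨j, h⟩
      · exact ⟨!j, h⟩
    obtain ⟨j, hj⟩ := this
    obtain ⟨-, -, hg⟩ := edgeBond_ne_zero (hF0 _ _ _ hj)
    obtain ⟨s, s', h1, h2, h3⟩ := hg _ sub_union_left (sub_union_right hd)
    rw [ht, Option.some.injEq] at h1
    rw [ht', Option.some.injEq] at h2
    rwa [h1, h2]
  have hc : Consistent (β.union β') ((P ∪ A) ∪ (P' ∪ A')) := by
    refine ⟨fun q a k j hq => ?_, fun q a k t t' h1 h2 ht ht' => ?_⟩
    · rw [dom_union]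
      rcases hq with (hq | hq) | (hq | hq)
      · exact Or.inl (hP.owner_mem _ _ _ _ hq)
      · exact Or.inl (oA hq).1
      · exact Or.inr (hP'.owner_mem _ _ _ _ hq)
      · exact Or.inr (oA' hq).1
    · rcases h1 with (h1 | h1) | (h1 | h1)
      · rcases h2 with (h2 | h2) | (h2 | h2)
        · have e1 : β.union β' q = β q := union_of_mem (hP.owner_mem _ _ _ _ h1)
          have e2 : β.union β' (q + (plus a).vec) = β (q + (plus a).vec) :=
            union_of_mem (hP.owner_mem _ _ _ _ h2)
          exact hP.agree q a k t t' h1 h2 (e1 ▸ ht) (e2 ▸ ht')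
        · exact gA (Or.inl h2) ht ht'
        -- An old pad of `β'` is internal, so both ends of its border lie in `β'`; it cannot face a
        -- pad mounted on `β`. Here the asymmetric hypothesis on `P'` enters, while `P` may be
        -- arbitrary.
        · exact (no _ (hP.owner_mem _ _ _ _ h1) (hi _ _ _ _ h2)).elim
        · exact gA (Or.inr h2) ht ht'
      · exact gA (Or.inl h1) ht ht'
      · rcases h2 with (h2 | h2) | (h2 | h2)
        · exact (no _ (hP.owner_mem _ _ _ _ h2) (hi _ _ _ _ h1)).elim
        · exact gA (Or.inl h2) ht ht'
        · have e1 : β.union β' q = β' q := union_of_mem_right hd (hP'.owner_mem _ _ _ _ h1)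
          have e2 : β.union β' (q + (plus a).vec) = β' (q + (plus a).vec) :=
            union_of_mem_right hd (hP'.owner_mem _ _ _ _ h2)
          exact hP'.agree q a k t t' h1 h2 (e1 ▸ ht) (e2 ▸ ht')
        · exact gA (Or.inr h2) ht ht'
      · exact gA (Or.inr h1) ht ht'
  have hc1 : Consistent β (P ∪ A) := by
    refine ⟨fun q a k j hq => hq.elim (hP.owner_mem _ _ _ _) fun h => (oA h).1,
      fun q a k t t' h1 h2 ht ht' => hc.agree q a k t t' (Or.inl h1) (Or.inl h2)
        (sub_union_left.apply_eq_some ht) (sub_union_left.apply_eq_some ht')⟩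
  have hc2 : Consistent β' (P' ∪ A') := by
    refine ⟨fun q a k j hq => hq.elim (hP'.owner_mem _ _ _ _) fun h => (oA' h).1,
      fun q a k t t' h1 h2 ht ht' => hc.agree q a k t t' (Or.inr h1) (Or.inr h2)
        ((sub_union_right hd).apply_eq_some ht) ((sub_union_right hd).apply_eq_some ht')⟩
  have r1 := add_pads hK hT hs hA hc1
  have r2 := add_pads hK hT' hs' hA' hc2
  have hdr := K.render_disjoint_of_consistent hc hd
  refine ⟨P ∪ A, P' ∪ A', hc1, hc2, hc, Set.subset_union_left, r1, r2, ?_, fun hiP => ?_⟩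
  · refine canAttach_of_link (stable_of_reflTransGen r1 hs) (stable_of_reflTransGen r2 hs') hdr ?_
    refine le_link_render hc1 hc2 hdr F hF fun ρ a k j h _ => ⟨Or.inr h, Or.inr ?_⟩
    rw [memA', Bool.not_not]
    exact h
  · intro q a k j hq
    rw [dom_union]
    rcases hq with (hq | hq) | (hq | hq)
    · exact Or.inl (hiP _ _ _ _ hq)
    · exact Or.inr (oA hq).2
    · exact Or.inr (hi _ _ _ _ hq)
    · exact Or.inl (oA' hq).2

/-- A configuration that represents an available assembly and is available. -/
structure Built (K : Kit) (𝒯 : TAS) (hK : K.Fits 𝒯) (β : Assembly) (P : PadSet) : Prop where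
  consistent : Consistent β P
  internal : Internal β P
  available : (K.simulator 𝒯 hK).Available (K.render β P).supertile

theorem Built.stable {hK : K.Fits 𝒯} (h : K.Built 𝒯 hK β P) : (K.render β P).Stable K.τ :=
  h.available.isStableAssembly.stable

theorem Built.translate {hK : K.Fits 𝒯} (h : K.Built 𝒯 hK β P) (v : ℤ × ℤ) :
    K.Built 𝒯 hK (β.translate v) (P.shift v) := by
  refine ⟨h.consistent.translate v, h.internal.translate v, ?_⟩
  rw [← K.render_translate h.consistent, supertile_translate]
  exact h.available

theorem Built.attach {hK : K.Fits 𝒯} (h : K.Built 𝒯 hK β P) (h' : K.Built 𝒯 hK β' P')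
    (hβ : IsStableAssembly 𝒯.tiles 𝒯.temp β) (hβ' : IsStableAssembly 𝒯.tiles 𝒯.temp β')
    (ha : β.CanAttach 𝒯.temp β') :
    ∃ Q, P ⊆ Q ∧ K.Built 𝒯 hK (β.union β') Q ∧
      ReflTransGen ((K.simulator 𝒯 hK).AttachStep (K.simulator 𝒯 hK).Available)
        (K.render β P) (K.render (β.union β') Q) := by
  obtain ⟨Q, Q', hQ, hQ', hc, hPQ, r, r', hcan, hint⟩ := exists_pads hK h.consistent h'.consistent
    h'.internal hβ.overT hβ'.overT h.stable h'.stable hβ.nonempty hβ'.nonempty (hK.temp ▸ ha)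
  have hstep : (K.simulator 𝒯 hK).AttachStep (K.simulator 𝒯 hK).Available (K.render β Q)
      (K.render (β.union β') (Q ∪ Q')) :=
    ⟨_, h'.available.of_reflTransGen r', hcan, (K.render_union hQ hQ' hc ha.1).symm⟩
  have r2 := r.tail hstep
  exact ⟨Q ∪ Q', hPQ.trans Set.subset_union_left,
    ⟨hc, hint h.internal, h.available.of_reflTransGen r2⟩, r2⟩

/-- Keeping all pads internal makes the statement inductive: the pads mounted for one attachment
become internal by it and cannot obstruct later ones. -/
theorem exists_built (hK : K.Fits 𝒯) {s : Supertile} (hs : 𝒯.Available s) :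
    ∀ β ∈ s, ∃ P, K.Built 𝒯 hK β P := by
  induction hs with
  | @init s hs =>
    intro β hβ
    rw [(𝒯.init_stable _ hs).eq_supertile hβ] at hs
    exact ⟨fullPads β, fullPads_consistent β, fullPads_internal β,
      .init (Or.inr (Or.inr ⟨β, hs, rfl⟩))⟩
  | @attach a b g ha hb hg iha ihb =>
    intro γ hγ
    obtain ⟨α, hα, β, hβ, hab, rfl⟩ := hg
    obtain ⟨u, rfl⟩ := hγ
    obtain ⟨P, hP⟩ := iha α hα
    obtain ⟨P', hP'⟩ := ihb β hβ
    obtain ⟨Q, -, hQ, -⟩ := hP.attach hP' (ha.isStableSupertile.isStableAssembly hα)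
      (hb.isStableSupertile.isStableAssembly hβ) hab
    exact ⟨_, hQ.translate u⟩

/-- The pad sets are chosen along the assembly sequence and only grow, so the limit is the
configuration with the union of all pads. -/
theorem exists_producible_render (hK : K.Fits 𝒯) {s : Supertile} (hs : s ∈ 𝒯.producible)
    (hβ : β ∈ s) : ∃ P, Consistent β P ∧ Internal β P ∧
      (K.render β P).supertile ∈ (K.simulator 𝒯 hK).producible := by
  obtain ⟨a, h0, hstep, hav, hm, hr⟩ := TAS.exists_seq_of_producible hs hβ
  obtain ⟨P₀, hP₀⟩ := exists_built hK (hav 0) _ (mem_supertile_self _)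
  obtain ⟨f, -, hg, hf⟩ := exists_dependent_seq (fun i P => K.Built 𝒯 hK (a i) P)
    (fun i P Q => P ⊆ Q ∧ ReflTransGen
      ((K.simulator 𝒯 hK).AttachStep (K.simulator 𝒯 hK).Available)
        (K.render (a i) P) (K.render (a (i + 1)) Q)) P₀ hP₀ (by
    intro i P hP
    rcases hstep i with h | ⟨δ, hδ, hcan, h⟩
    · exact ⟨P, h ▸ hP, subset_rfl, h ▸ .refl⟩
    · obtain ⟨P', hP'⟩ := exists_built hK hδ _ (mem_supertile_self _)
      obtain ⟨Q, h1, h2, h3⟩ := hP.attach hP' (hav i).isStableAssembly hδ.isStableAssembly hcan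
      exact ⟨Q, h ▸ h2, h1, h ▸ h3⟩)
  have hmono : ∀ i j, i ≤ j → f i ⊆ f j := fun i j hij =>
    monotone_nat_of_le_succ (f := f) (fun n => (hf n).1) hij
  obtain ⟨hc, hres⟩ := K.isResult_render hr hm hmono fun i => (hg i).consistent
  refine ⟨_, hc, fun q b k j hq => ?_,
    TAS.producible_of_chain _ (hg 0).available (fun i => (hf i).2) hres⟩
  obtain ⟨i, hi⟩ := Set.mem_iUnion.1 hq
  exact (hr.2 i).dom_subset ((hg i).internal _ _ _ _ hi)

end Kit

end TwoHAM

end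

/-! ### Classification of the producible supertiles of the simulator -/

noncomputable section

namespace TwoHAM

open Assembly Relation

/-- Every increasing sequence of assemblies has a result. -/
theorem exists_isResult {a : ℕ → Assembly} (hm : ∀ i j, i ≤ j → (a i).Sub (a j)) :
    ∃ α, IsResult a α := by
  classical
  let α : Assembly := fun p => if h : ∃ i, p ∈ (a i).dom then a h.choose p else none
  have hsub : ∀ i, (a i).Sub α := fun i p hp => by
    have h : ∃ i, p ∈ (a i).dom := ⟨i, hp⟩
    have e1 := hm i (max i h.choose) (le_max_left _ _) p hp
    have e2 := hm h.choose (max i h.choose) (le_max_right _ _) p h.choose_spec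
    simp only [α]
    rw [dif_pos h, e1, e2]
  refine ⟨α, subset_antisymm (fun p hp => ?_) (Set.iUnion_subset fun i => (hsub i).dom_subset),
    hsub⟩
  by_contra hn
  rw [Set.mem_iUnion] at hn
  refine hp ?_
  simp only [α]
  rw [dif_neg hn]

namespace Kit

variable {K : Kit} {𝒯 : TAS} {β β' : Assembly} {P P' : PadSet} {Q Q' : Supertile → Prop}
  {α γ : Assembly}

/-! ### The shape of the producible supertiles -/

/-- `α` is a configuration that represents an assembly whose supertile satisfies `Q`. -/
def IsMacro (K : Kit) (Q : Supertile → Prop) (α : Assembly) : Prop :=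
  ∃ β P u, Q β.supertile ∧ Consistent β P ∧ α = (K.render β P).translate u

/-- `α` is a pad. -/
def IsPad (K : Kit) (α : Assembly) : Prop :=
  ∃ a k j, ∃ A ∈ K.labels, ∃ u, α = (K.asm (.pad a k j A)).translate u

/-- `α` is a single tile. -/
def IsSingle (K : Kit) (α : Assembly) : Prop :=
  ∃ t ∈ universalTiles K.τ, ∃ u, α = (single t).translate u

/-- `α` is a configuration, a pad, or a single tile. -/
def IsForm (K : Kit) (Q : Supertile → Prop) (α : Assembly) : Prop :=
  K.IsMacro Q α ∨ K.IsPad α ∨ K.IsSingle α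

theorem IsMacro.translate (h : K.IsMacro Q α) (v : ℤ × ℤ) : K.IsMacro Q (α.translate v) := by
  obtain ⟨β, P, u, h1, h2, rfl⟩ := h
  exact ⟨β, P, u + v, h1, h2, Assembly.translate_translate _ _⟩

theorem IsPad.translate (h : K.IsPad α) (v : ℤ × ℤ) : K.IsPad (α.translate v) := by
  obtain ⟨a, k, j, A, hA, u, rfl⟩ := h
  exact ⟨a, k, j, A, hA, u + v, Assembly.translate_translate _ _⟩

theorem IsSingle.translate (h : K.IsSingle α) (v : ℤ × ℤ) : K.IsSingle (α.translate v) := by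
  obtain ⟨t, ht, u, rfl⟩ := h
  exact ⟨t, ht, u + v, Assembly.translate_translate _ _⟩

theorem IsForm.translate (h : K.IsForm Q α) (v : ℤ × ℤ) : K.IsForm Q (α.translate v) :=
  h.imp (·.translate v) (Or.imp (·.translate v) (·.translate v))

theorem IsSingle.nonempty (h : K.IsSingle α) : α.dom.Nonempty := by
  obtain ⟨t, ht, u, rfl⟩ := h
  exact nonempty_translate.2 ⟨0, mem_dom_of_eq (t := t) (by simp [single])⟩

theorem IsPad.nonempty (h : K.IsPad α) : α.dom.Nonempty := by
  obtain ⟨a, k, j, A, -, u, rfl⟩ := h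
  exact nonempty_translate.2 (K.asm_nonempty _)

/-- The supertiles that satisfy `Q` are stable supertiles of the system. -/
def StableIn (Q : Supertile → Prop) (𝒯 : TAS) : Prop :=
  ∀ β : Assembly, Q β.supertile → IsStableAssembly 𝒯.tiles 𝒯.temp β

theorem IsForm.nonempty (hQ : StableIn Q 𝒯) (h : K.IsForm Q α) : α.dom.Nonempty := by
  rcases h with ⟨β, P, u, h1, h2, rfl⟩ | h | h
  · exact nonempty_translate.2 (render_nonempty h2 (hQ β h1).nonempty)
  · exact h.nonempty
  · exact h.nonempty

theorem link_lt_of_single (h : K.IsSingle α) (h' : K.IsForm Q γ)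
    (hd : Disjoint α.dom γ.dom) : link α γ < K.τ := by
  obtain ⟨t, ht, u, rfl⟩ := h
  rcases h' with ⟨β, P, v, h1, h2, rfl⟩ | ⟨a, k, j, A, hA, v, rfl⟩ | ⟨t', ht', v, rfl⟩
  · exact link_single_lt_of_noInnerExposed K.two_le ht ((noInnerExposed_render h2).translate v) hd
  · exact link_single_lt_of_noInnerExposed K.two_le ht ((noInnerExposed_asm _).translate v) hd
  · exact link_single_single_lt K.two_le ht u v

/-- What can be attached to a configuration. -/
theorem attach_cases (hK : K.Fits 𝒯) (hQ : StableIn Q 𝒯) (hβ : IsStableAssembly 𝒯.tiles 𝒯.temp β)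
    (hc : Consistent β P) (h : K.IsForm Q γ) (ha : (K.render β P).CanAttach K.τ γ) :
    ∃ β' P', (K.render β P).union γ = K.render β' P' ∧ Consistent β' P' ∧ P ⊆ P' ∧
      (β' = β ∨ 𝒯.AttachStep Q β β') := by
  have hlink := ha.link_le (render_nonempty hc hβ.nonempty) (h.nonempty hQ)
  have hd := ha.1
  have hl := hK.labeled hβ.overT
  rcases h with ⟨β', P', u, hβ', hc', rfl⟩ | ⟨a, k, j, A, hA, u, rfl⟩ | h
  · have hS := hQ β' hβ'
    have hl' := hK.labeled hS.overT
    have h0 : link (K.render β P) ((K.render β' P').translate u) ≠ 0 := by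
      intro h0
      rw [h0] at hlink
      have := K.two_le
      exact absurd (Nat.cast_le.1 (hlink.trans_eq Nat.cast_zero.symm)) (by omega)
    obtain ⟨v, rfl⟩ := render_attach_render hc hc' hl hl' hd h0
    rw [K.render_translate hc'] at hd hlink ⊢
    have hc'' := hc'.translate v
    have hl'' := hl'.translate v
    have hcu := consistent_union hc hc'' hl hl'' hd
    have hdβ := K.disjoint_of_render hc hc'' hd
    refine ⟨_, _, K.render_union hc hc'' hcu hdβ, hcu, Set.subset_union_left,
      Or.inr ⟨_, (supertile_translate (α := β') v).symm ▸ hβ', ?_, rfl⟩⟩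
    refine canAttach_of_link hβ.stable (hS.stable.translate v) hdβ ?_
    rw [← hK.temp]
    exact hlink.trans (link_render_le hc hc'' hl hl'' hd)
  · obtain ⟨q, t, rfl, ht, rfl⟩ := render_attach_pad_mounted hc hl hA hd hlink
    obtain ⟨hn, hci⟩ := consistent_insert hc hl (k := k) ht hd
    exact ⟨β, _, (K.render_insert hci hn ht).2.symm, hci, Set.subset_insert _ _, Or.inl rfl⟩
  · rw [link_comm] at hlink
    exact absurd hlink (not_le.2 (link_lt_of_single (Q := fun s => s = β.supertile) h
      (Or.inl ⟨β, P, 0, rfl, hc, by simp⟩) hd.symm))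

theorem attach_cases_translate (hK : K.Fits 𝒯) (hQ : StableIn Q 𝒯)
    (hβ : IsStableAssembly 𝒯.tiles 𝒯.temp β) (hc : Consistent β P) (h : K.IsForm Q γ) {u : ℤ × ℤ}
    (ha : ((K.render β P).translate u).CanAttach K.τ γ) :
    ∃ β' P', ((K.render β P).translate u).union γ = (K.render β' P').translate u ∧
      Consistent β' P' ∧ P ⊆ P' ∧ (β' = β ∨ 𝒯.AttachStep Q β β') := by
  have ha' := ha.translate (-u)
  rw [Assembly.translate_translate, add_neg_cancel, translate_zero] at ha'
  obtain ⟨β', P', h1, h2⟩ := attach_cases hK hQ hβ hc (h.translate (-u)) ha'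
  refine ⟨β', P', ?_, h2⟩
  rw [← h1, union_translate, Assembly.translate_translate, neg_add_cancel, translate_zero]

/-- Only configurations can result from attachments. -/
theorem IsForm.union (hK : K.Fits 𝒯) (hQ : StableIn Q 𝒯)
    (hu : ∀ β β', Q (Assembly.supertile β) → 𝒯.AttachStep Q β β' → Q β'.supertile)
    (h : K.IsForm Q α) (h' : K.IsForm Q γ) (ha : α.CanAttach K.τ γ) :
    K.IsMacro Q (α.union γ) := by
  have key {α γ : Assembly} (h : K.IsMacro Q α) (h' : K.IsForm Q γ) (ha : α.CanAttach K.τ γ) :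
      K.IsMacro Q (α.union γ) := by
    obtain ⟨β, P, u, hβ, hc, rfl⟩ := h
    obtain ⟨β', P', e, hc', -, hs⟩ := attach_cases_translate hK hQ (hQ β hβ) hc h' ha
    refine ⟨β', P', u, ?_, hc', e⟩
    rcases hs with rfl | hs
    · exact hβ
    · exact hu _ _ hβ hs
  by_cases hm : K.IsMacro Q α
  · exact key hm h' ha
  by_cases hm' : K.IsMacro Q γ
  · rw [union_comm ha.1]
    exact key hm' h ha.symm
  exfalso
  have hlink := ha.link_le (h.nonempty hQ) (h'.nonempty hQ)
  refine absurd hlink (not_le.2 ?_)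
  -- Without a configuration only tiles and pads are left, and no two of these bind with the
  -- strength of the temperature.
  by_cases hs : K.IsSingle α
  · exact link_lt_of_single hs h' ha.1
  by_cases hs' : K.IsSingle γ
  · rw [link_comm]
    exact link_lt_of_single hs' h ha.1.symm
  obtain ⟨a, k, j, A, hA, u, rfl⟩ := (h.resolve_left hm).resolve_right hs
  obtain ⟨a', k', j', A', hA', u', rfl⟩ := (h'.resolve_left hm').resolve_right hs'
  exact link_pad_pad_lt hA hA' ha.1

theorem stableIn_available : StableIn 𝒯.Available 𝒯 := fun _ h => h.isStableAssembly

theorem stableIn_producible : StableIn (· ∈ 𝒯.producible) 𝒯 := fun β h =>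
  TAS.isStableAssembly_of_producible h (mem_supertile_self β)

theorem isForm_of_init (hK : K.Fits 𝒯) {s : Supertile} (hs : s ∈ (K.simulator 𝒯 hK).init)
    (hα : α ∈ s) : K.IsForm 𝒯.Available α := by
  rcases hs with ⟨t, ht, rfl⟩ | ⟨a, k, j, t, ht, rfl⟩ | ⟨β, hβ, rfl⟩ <;> obtain ⟨u, rfl⟩ := hα
  · exact Or.inr (Or.inr ⟨t, ht, u, rfl⟩)
  · refine Or.inr (Or.inl ⟨a, k, j, _, ?_, u, rfl⟩)
    rw [hK.labels]
    exact ⟨t, ht, _, rfl⟩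
  · exact Or.inl ⟨β, _, u, .init hβ, fullPads_consistent β, rfl⟩

theorem isForm_of_available (hK : K.Fits 𝒯) {s : Supertile}
    (hs : (K.simulator 𝒯 hK).Available s) : ∀ α ∈ s, K.IsForm 𝒯.Available α := by
  induction hs with
  | init hs => exact fun α hα => isForm_of_init hK hs hα
  | attach _ _ hg iha ihb =>
    obtain ⟨α, hα, γ, hγ, ha, rfl⟩ := hg
    rintro _ ⟨u, rfl⟩
    exact Or.inl ((IsForm.union hK stableIn_available (fun _ _ h hs => h.of_attachStep hs)
      (iha α hα) (ihb γ hγ) ha).translate u)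

/-- Once a stage is a configuration, the represented assembly and the pads are tracked through all
later stages, and limits of configurations are configurations. If no stage is one, no attachment has
happened and the sequence is constant. -/
theorem isForm_of_producible (hK : K.Fits 𝒯) {s : Supertile}
    (hs : s ∈ (K.simulator 𝒯 hK).producible) (hα : α ∈ s) :
    K.IsForm (· ∈ 𝒯.producible) α := by
  obtain ⟨a, h0, hstep, hav, hm, hr⟩ := TAS.exists_seq_of_producible hs hα
  have hform (i : ℕ) : K.IsForm 𝒯.Available (a i) :=
    isForm_of_available hK (hav i) _ (mem_supertile_self _)
  have mono (α : Assembly) (h : K.IsForm 𝒯.Available α) : K.IsForm (· ∈ 𝒯.producible) α := by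
    refine h.imp_left ?_
    rintro ⟨β, P, u, h1, h2⟩
    exact ⟨β, P, u, h1.producible, h2⟩
  by_cases hex : ∃ i, K.IsMacro 𝒯.Available (a i)
  · obtain ⟨n, β₀, P₀, u, hβ₀, hc₀, e₀⟩ := hex
    obtain ⟨f, -, hg, hf⟩ := exists_dependent_seq
      (fun i (x : Assembly × PadSet) => 𝒯.Available x.1.supertile ∧ Consistent x.1 x.2 ∧
        a (n + i) = (K.render x.1 x.2).translate u)
      (fun i x y => x.2 ⊆ y.2 ∧ (y.1 = x.1 ∨ 𝒯.AttachStep 𝒯.Available x.1 y.1))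
      (β₀, P₀) ⟨hβ₀, hc₀, e₀⟩ (by
      rintro i ⟨β, P⟩ ⟨h1, h2, h3⟩
      simp only at h1 h2 h3
      rcases hstep (n + i) with h | ⟨γ, hγ, hcan, h⟩
      · exact ⟨(β, P), ⟨h1, h2, h.trans h3⟩, subset_rfl, Or.inl rfl⟩
      · rw [h3] at hcan h
        obtain ⟨β', P', e, hc', hP, hs⟩ := attach_cases_translate hK stableIn_available
          h1.isStableAssembly h2 (isForm_of_available hK hγ _ (mem_supertile_self _)) hcan
        refine ⟨(β', P'), ⟨?_, hc', h.trans e⟩, hP, hs⟩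
        rcases hs with rfl | hs
        · exact h1
        · exact h1.of_attachStep hs)
    have hP : ∀ i j, i ≤ j → (f i).2 ⊆ (f j).2 := fun i j hij =>
      monotone_nat_of_le_succ (f := fun i => (f i).2) (fun n => (hf n).1) hij
    have hr1 (i : ℕ) : ReflTransGen (𝒯.AttachStep 𝒯.Available) (f i).1 (f (i + 1)).1 := by
      rcases (hf i).2 with h | h
      · rw [h]
      · exact .single h
    have hβ : ∀ i j, i ≤ j → (f i).1.Sub (f j).1 := fun i j hij => by
      induction j, hij using Nat.le_induction with
      | base => exact Sub.refl _
      | succ j _ ih => exact ih.trans (TAS.sub_of_reflTransGen (hr1 j))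
    obtain ⟨β, hres⟩ := exists_isResult hβ
    obtain ⟨hc, hres'⟩ := K.isResult_render hres hβ hP fun i => (hg i).2.1
    refine Or.inl ⟨β, _, u, TAS.producible_of_chain _ (hg 0).1 hr1 hres, hc, ?_⟩
    have hr2 : IsResult (fun i => a (n + i)) α := by
      refine isResult_of_refinement (a := fun i => a (n + i)) ⟨?_, fun i => hr.2 (n + i)⟩
        (fun i => ⟨i, rfl⟩) fun j => ⟨j, Sub.refl _⟩
      rw [hr.1]
      exact subset_antisymm (Set.iUnion_subset fun i => (hm i (n + i) (by omega)).dom_subset.trans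
        (Set.subset_iUnion (fun i => (a (n + i)).dom) i))
        (Set.iUnion_subset fun i => Set.subset_iUnion (fun i => (a i).dom) (n + i))
    refine hr2.unique ?_
    have := hres'.translate u
    rwa [show (fun i => a (n + i)) = fun i => (K.render (f i).1 (f i).2).translate u from
      funext fun i => (hg i).2.2]
  · push Not at hex
    have hconst (i : ℕ) : a i = a 0 := by
      induction i with
      | zero => rfl
      | succ i ih =>
        rcases hstep i with h | ⟨γ, hγ, hcan, h⟩
        · exact h.trans ih
        · refine absurd (IsForm.union hK stableIn_available (fun _ _ h hs => h.of_attachStep hs)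
            (hform i) (isForm_of_available hK hγ _ (mem_supertile_self _)) hcan) ?_
          rw [← h]
          exact hex _
    have : α = a 0 := hr.unique (isResult_const_of_le (fun i => by rw [hconst]; exact Sub.refl _)
      ⟨0, rfl⟩)
    rw [this]
    exact mono _ (hform 0)

end Kit

end TwoHAM

end

/-! ### The representation function and clean mapping -/

noncomputable section

namespace TwoHAM

open Assembly Relation

namespace Kit

variable {K : Kit} {𝒯 : TAS} {β β' : Assembly} {P P' : PadSet} {α γ : Assembly}

/-! ### The representation function -/

variable (K) in
/-- The scale of the simulation. -/
def side : ℕ := (2 * K.M).toNat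

theorem side_cast : (K.side : ℤ) = 2 * K.M := by
  have := K.M_pos
  simp only [side]
  omega

theorem side_pos : 0 < K.side := by
  have := K.side_cast; have := K.M_pos; omega

variable (K) in
/-- The block contains the body of the macrotile for `t`. -/
def BlockHas (t : TileType) (b : Block K.side) : Prop :=
  ∀ (i j : Fin K.side) s, K.asm (.body t) ((i : ℕ), (j : ℕ)) = some s → b i j = some s

theorem body_bounds {t : TileType} {p : ℤ × ℤ} (hp : p ∈ (K.asm (.body t)).dom) :
    (0 ≤ p.1 ∧ p.1 < 2 * K.M) ∧ 0 ≤ p.2 ∧ p.2 < 2 * K.M := by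
  rw [mem_dom_asm] at hp
  obtain ⟨⟨h1, h2⟩, h3, h4⟩ := K.body_extent hp
  simp only [cell] at h1 h2 h3 h4
  omega

theorem blockHas_iff {t : TileType} {q : ℤ × ℤ} :
    K.BlockHas t (α.block K.side q) ↔ (K.placedAsm (.body t, q)).Sub α := by
  have hs := K.side_cast
  rw [sub_iff]
  constructor
  · intro h p s hp
    have hp' : K.asm (.body t) (p - scale (2 * K.M) q) = some s := hp
    obtain ⟨⟨h1, h2⟩, h3, h4⟩ := body_bounds (mem_dom_of_eq hp')
    have e1 : (((p - scale (2 * K.M) q).1.toNat : ℕ) : ℤ) = (p - scale (2 * K.M) q).1 := by omega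
    have e2 : (((p - scale (2 * K.M) q).2.toNat : ℕ) : ℤ) = (p - scale (2 * K.M) q).2 := by omega
    have := h ⟨(p - scale (2 * K.M) q).1.toNat, by omega⟩
      ⟨(p - scale (2 * K.M) q).2.toNat, by omega⟩ s (by simp only [e1, e2]; exact hp')
    simp only [Assembly.block, e1, e2, hs] at this
    rw [← this]
    congr 1
    ext <;> simp [scale]
  · intro h i j s hij
    refine h _ s ?_
    rw [placedAsm, translate_apply, ← hij]
    congr 1
    ext <;> simp [scale, hs]

open Classical in
variable (K 𝒯) in
/-- The representation function: it reads the body of a macrotile. -/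
def reading : Repr K.side 𝒯.tiles where
  toFun b := if h : ∃ t ∈ 𝒯.tiles, K.BlockHas t b then some h.choose else none
  mem_tiles b t h := by
    split_ifs at h with hb
    rw [Option.some.injEq] at h
    rw [← h]
    exact hb.choose_spec.1

theorem Fits.coded_body (hK : K.Fits 𝒯) {t : TileType} (ht : t ∈ 𝒯.tiles) :
    K.Coded (.body t) := by
  rintro r a k l A o (⟨-, -, rfl, -⟩ | ⟨-, -, rfl, -⟩) <;> rw [hK.labels] <;> exact ⟨t, ht, _, rfl⟩

theorem reading_eq_some (hK : K.Fits 𝒯) {q : ℤ × ℤ} {t : TileType} :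
    (K.reading 𝒯).onAssembly α q = some t ↔
      t ∈ 𝒯.tiles ∧ (K.placedAsm (.body t, q)).Sub α := by
  simp only [← blockHas_iff, Repr.onAssembly, reading]
  constructor
  · intro h
    split_ifs at h with hb
    rw [Option.some.injEq] at h
    rw [← h]
    exact hb.choose_spec
  · rintro ⟨h1, h2⟩
    have hb : ∃ t ∈ 𝒯.tiles, K.BlockHas t (α.block K.side q) := ⟨t, h1, h2⟩
    rw [dif_pos hb, Option.some.injEq]
    have h3 := hb.choose_spec
    rw [blockHas_iff] at h2 h3
    have key {s : TileType} (h : (K.placedAsm (.body s, q)).Sub α) :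
        (K.asm (.body s)).Sub (α.translate (-scale (2 * K.M) q)) := by
      have := h.translate (-scale (2 * K.M) q)
      rwa [placedAsm, Assembly.translate_translate, add_neg_cancel, translate_zero] at this
    exact K.body_eq_of_sub (hK.coded_body h3.1) (hK.coded_body h1) (key h3.2) (key h2)

/-- A body of a macrotile can only be read at the position of a body. -/
theorem Composed.exists_body {Φ : Piece → ℤ × ℤ → Prop} (h : K.Composed Φ α) {t : TileType}
    {q : ℤ × ℤ} (hs : (K.placedAsm (.body t, q)).Sub α) :
    ∃ t', Φ (.body t') (scale (2 * K.M) q) := by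
  obtain ⟨hm, hk⟩ := K.marker_body t
  obtain ⟨s, hsm⟩ := mem_dom_iff.1 hm
  have h1 : α (K.slotPos false false 0 1 + scale (2 * K.M) q) = some s :=
    hs.apply_eq_some (by simpa [placedAsm] using hsm)
  obtain ⟨π, v, hΦ, -, -, hv⟩ := h _ _ h1
  obtain ⟨-, rfl⟩ := K.asm_eq_some hsm
  obtain ⟨-, hv⟩ := K.asm_eq_some hv
  have hκ := kindGlue_injective _ (congrFun hv Side.north)
  rw [hk] at hκ
  obtain ⟨⟨t', rfl⟩, hp⟩ := K.marker_unique (SpecialAt.of_kindAt K hκ.symm)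
  refine ⟨t', ?_⟩
  rw [add_sub_assoc, add_eq_left, sub_eq_zero] at hp
  rwa [hp]

/-- Bodies are read where they stand. Conversely, a body that is read contains the marker glue,
which occurs only at bodies of the configuration, so nothing else is read. -/
theorem reading_render (hK : K.Fits 𝒯) (hT : β.Over 𝒯.tiles) (hc : Consistent β P) :
    (K.reading 𝒯).onAssembly (K.render β P) = β := by
  have key {q : ℤ × ℤ} {t : TileType} (h : β q = some t) :
      (K.reading 𝒯).onAssembly (K.render β P) q = some t :=
    (reading_eq_some hK).2 ⟨hT _ _ h, K.placedAsm_sub_render hc (body_mem_placed P h)⟩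
  refine ext_some fun q t => ⟨fun h => ?_, key⟩
  have hcomp := composed_render (K := K) hc (hK.labeled hT) 0
  rw [translate_zero] at hcomp
  obtain ⟨t', q', hx, hq⟩ := hcomp.exists_body ((reading_eq_some hK).1 h).2
  rw [add_zero] at hq
  obtain rfl := scale_injective two_mul_M_pos hq
  rcases hx with ⟨s, h1, h2⟩ | ⟨_, _, _, _, h1, -⟩
  · rw [key h2, Option.some.injEq] at h
    rwa [← h]
  · simp at h1

theorem aligned_of_reading (hK : K.Fits 𝒯) (hT : β.Over 𝒯.tiles) (hc : Consistent β P)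
    {u : ℤ × ℤ}
    (h : (K.reading 𝒯).onAssembly ((K.render β P).translate u) ≠ Assembly.empty) :
    ∃ v, u = scale (2 * K.M) v := by
  obtain ⟨q, hq⟩ : ∃ q, (K.reading 𝒯).onAssembly ((K.render β P).translate u) q ≠ none := by
    by_contra! hn
    exact h (funext hn)
  obtain ⟨t, ht⟩ := Option.ne_none_iff_exists'.1 hq
  obtain ⟨t', q', -, hq'⟩ := (composed_render hc (hK.labeled hT) u).exists_body
    ((reading_eq_some hK).1 ht).2
  exact ⟨q - q', by rw [scale_sub, hq']; abel⟩

theorem ne_empty_of_nonempty (h : β.dom.Nonempty) : β ≠ Assembly.empty := by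
  rintro rfl
  obtain ⟨q, hq⟩ := h
  exact hq rfl

theorem onSupertile_render (hK : K.Fits 𝒯) (hT : β.Over 𝒯.tiles) (hc : Consistent β P)
    (hn : β.dom.Nonempty) :
    (K.reading 𝒯).onSupertile (K.render β P).supertile = β.supertile := by
  have e (v : ℤ × ℤ) : (K.reading 𝒯).onAssembly
      ((K.render β P).translate (scale (2 * K.M) v)) = β.translate v := by
    rw [K.render_translate hc, reading_render hK (hT.translate v) (hc.translate v)]
  ext δ
  constructor
  · rintro ⟨h, _, ⟨u, rfl⟩, rfl⟩
    obtain ⟨v, rfl⟩ := aligned_of_reading hK hT hc h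
    exact ⟨v, e v⟩
  · rintro ⟨v, rfl⟩
    exact ⟨ne_empty_of_nonempty (nonempty_translate.2 hn), _, ⟨_, rfl⟩, (e v).symm⟩

theorem onSupertile_eq_empty (hK : K.Fits 𝒯)
    (h : ∀ u t q, ¬ (K.placedAsm (.body t, q)).Sub (α.translate u)) :
    (K.reading 𝒯).onSupertile α.supertile = ∅ := by
  rw [Set.eq_empty_iff_forall_notMem]
  rintro δ ⟨h1, _, ⟨u, rfl⟩, rfl⟩
  refine h1 (funext fun q => ?_)
  by_contra hq
  obtain ⟨t, ht⟩ := Option.ne_none_iff_exists'.1 hq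
  exact h u t q ((reading_eq_some hK).1 ht).2

theorem onSupertile_pad (hK : K.Fits 𝒯) (h : K.IsPad α) :
    (K.reading 𝒯).onSupertile α.supertile = ∅ := by
  obtain ⟨a, k, j, A, hA, v, rfl⟩ := h
  refine onSupertile_eq_empty hK fun u t q hs => ?_
  rw [Assembly.translate_translate] at hs
  obtain ⟨t', h, -⟩ := (composed_asm (coded_pad hA) _).exists_body hs
  simp at h

theorem onSupertile_single (hK : K.Fits 𝒯) (h : K.IsSingle α) :
    (K.reading 𝒯).onSupertile α.supertile = ∅ := by
  obtain ⟨s, hs, v, rfl⟩ := h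
  refine onSupertile_eq_empty hK fun u t q hsub => ?_
  have key (p : ℤ × ℤ) (hp : p ∈ (K.placedAsm (.body t, q)).dom) : p = v + u := by
    have := hsub.dom_subset hp
    rw [Assembly.translate_translate, mem_dom_translate] at this
    by_contra hne
    refine this ?_
    rw [single, if_neg (by rwa [sub_eq_zero])]
  have h1 := K.mem_dom_body_core t q
  -- A second tile of the same cell: a body has more than one tile.
  have h2 : scale 2 (K.cellAt false false 0 0 0 + scale K.M q) + (1, 0) ∈
      (K.placedAsm (.body t, q)).dom := by
    rw [mem_dom_placedAsm] at h1 ⊢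
    convert h1 using 2
    ext <;> simp [cell, scale]; omega
  have h3 := (key _ h1).trans (key _ h2).symm
  simp at h3

/-! ### Clean mapping -/

theorem atMostOneBlock_of_bounds {m : ℕ}
    (h : ∀ p ∈ α.dom, (0 ≤ p.1 ∧ p.1 < m) ∧ 0 ≤ p.2 ∧ p.2 < m) : α.AtMostOneBlock m := by
  have key (q : ℤ × ℤ) (hq : α.BlockNonempty m q) : q = 0 := by
    obtain ⟨i, j, hij⟩ := hq
    obtain ⟨⟨h1, h2⟩, h3, h4⟩ := h _ hij
    simp only at h1 h2 h3 h4
    have hi := i.2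
    have hj := j.2
    have e1 := eq_of_mul_add_eq (M := (m : ℤ)) (q := q.1) (r := ((i : ℕ) : ℤ)) (q' := 0)
      (r' := m * q.1 + ((i : ℕ) : ℤ)) (by ring) (by omega) (by omega)
    have e2 := eq_of_mul_add_eq (M := (m : ℤ)) (q := q.2) (r := ((j : ℕ) : ℤ)) (q' := 0)
      (r' := m * q.2 + ((j : ℕ) : ℤ)) (by ring) (by omega) (by omega)
    exact Prod.ext e1.1 e2.1
  intro q q' hq hq'
  rw [key q hq, key q' hq']

theorem exists_atMostOneBlock_pad (h : K.IsPad α) :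
    ∃ α' ∈ α.supertile, α'.AtMostOneBlock K.side := by
  obtain ⟨a, k, j, A, hA, v, rfl⟩ := h
  -- An upper pad extends `w` cells beyond the boundary of the macrotile. Moving it back by `2 * w`
  -- tiles fits it into one block.
  refine ⟨(K.asm (.pad a k j A)).translate (ax a (if j then -(2 * K.w) else 0, 0)),
    by rw [supertile_translate]; exact ⟨_, rfl⟩, atMostOneBlock_of_bounds fun p hp => ?_⟩
  rw [mem_dom_translate, mem_dom_asm] at hp
  obtain ⟨⟨h1, h2⟩, h3, h4⟩ := K.pad_extent hp
  have hs := K.side_cast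
  have hw := K.three_le_w
  have hH := K.two_le_H
  have hb : K.b = K.w + 6 * K.H := rfl
  cases a <;> cases j <;> simp [cell, ax] at h1 h2 h3 h4 <;> omega

theorem exists_atMostOneBlock_single (h : K.IsSingle α) :
    ∃ α' ∈ α.supertile, α'.AtMostOneBlock K.side := by
  obtain ⟨t, ht, v, rfl⟩ := h
  refine ⟨single t, by rw [supertile_translate]; exact mem_supertile_self _,
    atMostOneBlock_of_bounds fun p hp => ?_⟩
  have : p = 0 := by
    by_contra hne
    exact hp (if_neg hne)
  have hs := K.side_pos
  subst this
  simp [hs]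

/-- A body stays in its own block. A pad stays in the block of its owner, except that an upper pad
also reaches into the block just below its owner along the axis. -/
theorem cleanOn_render (hK : K.Fits 𝒯) (hT : β.Over 𝒯.tiles) (hc : Consistent β P) :
    (K.reading 𝒯).CleanOn (K.render β P) := by
  left
  intro q ⟨i, j, hij⟩
  rw [reading_render hK hT hc]
  obtain ⟨s, hs⟩ := Option.ne_none_iff_exists'.1 hij
  have hm := K.side_cast
  have hi := i.2
  have hj := j.2
  obtain ⟨⟨π, r⟩, hx, hp⟩ := K.exists_placed hs
  have hp := mem_dom_of_eq hp
  rw [mem_dom_placedAsm] at hp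
  set c := cell (((K.side : ℤ) * q.1 + (i : ℕ), (K.side : ℤ) * q.2 + (j : ℕ)) : ℤ × ℤ) -
    scale K.M r with hcdef
  have c1 : K.M * r.1 + c.1 = K.M * q.1 + ((i : ℕ) : ℤ) / 2 := by
    simp only [hcdef, cell, scale, Prod.fst_sub, hm, mul_assoc]
    omega
  have c2 : K.M * r.2 + c.2 = K.M * q.2 + ((j : ℕ) : ℤ) / 2 := by
    simp only [hcdef, cell, scale, Prod.snd_sub, hm, mul_assoc]
    omega
  have hw := K.three_le_w
  have hH := K.two_le_H
  have hb : K.b = K.w + 6 * K.H := rfl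
  have hM : K.M = 3 * K.w + 6 * K.H - 1 := rfl
  have wrap {r q x y : ℤ} (h : K.M * r + x = K.M * q + y) (hx : K.M ≤ x) (hx' : x < 2 * K.M)
      (hy : 0 ≤ y) (hy' : y < K.M) : q = r + 1 :=
    (eq_of_mul_add_eq (M := K.M) (q := r + 1) (r := x - K.M) (by rw [← h]; ring) (by omega)
      (by omega)).1.symm
  rcases hx with ⟨t, h1, h2⟩ | ⟨a, k, jj, t, h1, h2, h3⟩ <;> simp only at h1 h2 <;> subst h1
  · obtain ⟨⟨h1, h3⟩, h4, h5⟩ := K.body_extent hp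
    have e1 := (eq_of_mul_add_eq c1 (by omega) (by omega)).1
    have e2 := (eq_of_mul_add_eq c2 (by omega) (by omega)).1
    refine ⟨0, 0, by norm_num, ?_⟩
    rw [show q + ((0 : ℤ), (0 : ℤ)) = r from Prod.ext (by simp [e1]) (by simp [e2])]
    exact mem_dom_of_eq h2
  · obtain ⟨⟨h4, h5⟩, h6, h7⟩ := K.pad_extent hp
    have ho := mem_dom_of_eq h3
    have hoff : q = owner r a jj ∨ q + (plus a).vec = owner r a jj := by
      cases a <;> cases jj <;>
        simp only [ax, if_true, if_false, Bool.false_eq_true] at h4 h5 h6 h7 <;>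
        simp only [owner, plus, Side.vec, if_true, if_false, Bool.false_eq_true]
      · exact Or.inl (Prod.ext (eq_of_mul_add_eq c1 (by omega) (by omega)).1.symm
          (eq_of_mul_add_eq c2 (by omega) (by omega)).1.symm)
      · have e2 := (eq_of_mul_add_eq c2 (by omega) (by omega)).1
        by_cases hcM : c.1 < K.M
        · have e1 := (eq_of_mul_add_eq c1 (by omega) (by omega)).1
          exact Or.inr (Prod.ext (by simp [e1]) (by simp [e2]))
        · have e1 := wrap c1 (by omega) (by omega) (by omega) (by omega)
          exact Or.inl (Prod.ext (by simp [e1]) (by simp [e2]))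
      · exact Or.inl (Prod.ext (eq_of_mul_add_eq c1 (by omega) (by omega)).1.symm
          (eq_of_mul_add_eq c2 (by omega) (by omega)).1.symm)
      · have e1 := (eq_of_mul_add_eq c1 (by omega) (by omega)).1
        by_cases hcM : c.2 < K.M
        · have e2 := (eq_of_mul_add_eq c2 (by omega) (by omega)).1
          exact Or.inr (Prod.ext (by simp [e1]) (by simp [e2]))
        · have e2 := wrap c2 (by omega) (by omega) (by omega) (by omega)
          exact Or.inl (Prod.ext (by simp [e1]) (by simp [e2]))
    rcases hoff with h | h
    · refine ⟨0, 0, by norm_num, ?_⟩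
      rwa [show q + ((0 : ℤ), (0 : ℤ)) = owner r a jj by rw [h]; simp]
    · refine ⟨(plus a).vec.1, (plus a).vec.2, ?_, by rwa [Prod.mk.eta, h]⟩
      cases a <;> simp [plus, Side.vec]

theorem clean_of_isForm (hK : K.Fits 𝒯) (h : K.IsForm (· ∈ 𝒯.producible) α) :
    (K.reading 𝒯).Clean α.supertile := by
  rcases h with ⟨β, P, u, hβ, hc, rfl⟩ | h | h
  · have hS := stableIn_producible β hβ
    left
    refine ⟨⟨β, hS.nonempty, hS.overT, ?_⟩, ?_⟩
    · rw [supertile_translate, onSupertile_render hK hS.overT hc hS.nonempty]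
    · rintro _ ⟨v, rfl⟩ hne
      rw [Assembly.translate_translate] at hne ⊢
      obtain ⟨v', hv⟩ := aligned_of_reading hK hS.overT hc hne
      rw [hv, K.render_translate hc]
      exact cleanOn_render hK (hS.overT.translate v') (hc.translate v')
  · exact Or.inr ⟨onSupertile_pad hK h, exists_atMostOneBlock_pad h⟩
  · exact Or.inr ⟨onSupertile_single hK h, exists_atMostOneBlock_single h⟩

end Kit

end TwoHAM

end

/-! ### The three conditions of simulation -/

noncomputable section

namespace TwoHAM

open Assembly Relation

namespace Kit

variable {K : Kit} {𝒯 : TAS} {β β' : Assembly} {P P' : PadSet} {α γ : Assembly}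

/-! ### The simulation -/

theorem isMacro_of_reading (hK : K.Fits 𝒯) {s : Supertile}
    (hs : s ∈ (K.simulator 𝒯 hK).producible) (hn : ((K.reading 𝒯).onSupertile s).Nonempty)
    (hα : α ∈ s) : K.IsMacro (· ∈ 𝒯.producible) α := by
  rw [TAS.eq_supertile_of_producible hs hα] at hn
  rcases isForm_of_producible hK hs hα with h | h | h
  · exact h
  · rw [onSupertile_pad hK h] at hn
    exact absurd rfl hn.ne_empty
  · rw [onSupertile_single hK h] at hn
    exact absurd rfl hn.ne_empty

theorem onSupertile_macro (hK : K.Fits 𝒯) (hβ : IsStableAssembly 𝒯.tiles 𝒯.temp β)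
    (hc : Consistent β P) (u : ℤ × ℤ) :
    (K.reading 𝒯).onSupertile ((K.render β P).translate u).supertile = β.supertile := by
  rw [supertile_translate, onSupertile_render hK hβ.overT hc hβ.nonempty]

theorem equivalentProductions (hK : K.Fits 𝒯) :
    EquivalentProductions (K.simulator 𝒯 hK) 𝒯 (K.reading 𝒯) := by
  constructor
  · ext t
    constructor
    · rintro ⟨hn, s, hs, rfl⟩
      obtain ⟨α, rfl⟩ := TAS.exists_mem_of_producible hs
      obtain ⟨β, P, u, hβ, hc, rfl⟩ := isMacro_of_reading hK hs hn (mem_supertile_self α)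
      rwa [onSupertile_macro hK (stableIn_producible β hβ) hc]
    · intro ht
      obtain ⟨β, rfl⟩ := TAS.exists_mem_of_producible ht
      obtain ⟨P, hc, -, hp⟩ := exists_producible_render hK ht (mem_supertile_self β)
      have hS := stableIn_producible β ht
      exact ⟨⟨β, mem_supertile_self β⟩, _, hp,
        (onSupertile_render hK hS.overT hc hS.nonempty).symm⟩
  · intro s hs
    obtain ⟨α, rfl⟩ := TAS.exists_mem_of_producible hs
    exact clean_of_isForm hK (isForm_of_producible hK hs (mem_supertile_self α))

/-- Mounting a pad leaves the represented assembly unchanged, and attaching a configuration is one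
step of the simulated system. -/
theorem follows (hK : K.Fits 𝒯) : Follows (K.simulator 𝒯 hK) 𝒯 (K.reading 𝒯) := by
  rintro a ha b - ⟨d, hd, α, hα, δ, hδ, hcan, rfl⟩ hn
  rw [TAS.eq_supertile_of_producible ha hα]
  obtain ⟨β, P, u, hβ, hc, rfl⟩ := isMacro_of_reading hK ha hn hα
  have hS := stableIn_producible β hβ
  obtain ⟨β', P', e, hc', -, hs⟩ := attach_cases_translate hK stableIn_producible hS hc
    (isForm_of_producible hK hd hδ) hcan
  rw [e, onSupertile_macro hK hS hc]
  rcases hs with rfl | ⟨ε, hε, hcan', rfl⟩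
  · exact Or.inl (onSupertile_macro hK hS hc' u).symm
  · rw [onSupertile_macro hK (hS.union (stableIn_producible ε hε) hcan') hc']
    exact Or.inr ⟨_, hε, β, mem_supertile_self β, ε, mem_supertile_self ε, hcan', rfl⟩

theorem reflTransGen_producible {𝒰 : TAS} {α α' : Assembly}
    (h : ReflTransGen (𝒰.AttachStep 𝒰.Available) α α') :
    ReflTransGen (𝒰.AttachStep (· ∈ 𝒰.producible)) α α' :=
  ReflTransGen.mono (fun _ _ hs => hs.imp fun _ hγ => ⟨hγ.1.producible, hγ.2⟩) _ _ h

theorem weaklyModels (hK : K.Fits 𝒯) :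
    WeaklyModels (K.simulator 𝒯 hK) 𝒯 (K.reading 𝒯) := by
  rintro a ha b - ⟨d, hd, α, hα, δ, hδ, hcan, rfl⟩ a' ha' hra
  obtain ⟨α', rfl⟩ := TAS.exists_mem_of_producible ha'
  have hn : ((K.reading 𝒯).onSupertile α'.supertile).Nonempty := by
    rw [hra]; exact ⟨α, hα⟩
  obtain ⟨β, P, u, hβ, hc, rfl⟩ := isMacro_of_reading hK ha' hn (mem_supertile_self α')
  have hSβ := stableIn_producible β hβ
  rw [onSupertile_macro hK hSβ hc] at hra
  rw [supertile_translate] at ha' ⊢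
  obtain ⟨v, rfl⟩ : α ∈ β.supertile := hra ▸ hα
  have hSα := hSβ.translate v
  rw [← supertile_translate (α := K.render β P) (scale (2 * K.M) v), K.render_translate hc]
    at ha' ⊢
  have hcα := hc.translate v
  -- The given configuration may carry any pads, but the partner can be chosen freshly with internal
  -- pads only, so no existing pad blocks the attachment.
  obtain ⟨P', hc', hi', hp'⟩ := exists_producible_render hK hd hδ
  have hSδ := TAS.isStableAssembly_of_producible hd hδ
  have hsα := (TAS.isStableAssembly_of_producible ha' (mem_supertile_self _)).stable
  have hsδ := (TAS.isStableAssembly_of_producible hp' (mem_supertile_self _)).stable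
  obtain ⟨Q, Q', hQ, hQ', hcQ, -, r, r', hcan', -⟩ := exists_pads hK hcα hc' hi' hSα.overT
    hSδ.overT hsα hsδ hSα.nonempty hSδ.nonempty (hK.temp ▸ hcan)
  have r := reflTransGen_producible r
  have hpQ := TAS.producible_of_reflTransGen r ha'
  have hpQ' := TAS.producible_of_reflTransGen (reflTransGen_producible r') hp'
  have hU := hSα.union hSδ hcan
  refine ⟨_, hpQ, ?_, TAS.grows_of_reflTransGen r, _,
    TAS.producible_union hpQ hpQ' hcan', ⟨_, hpQ', _, mem_supertile_self _, _,
      mem_supertile_self _, hcan', rfl⟩, ?_⟩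
  · rw [onSupertile_render hK hSα.overT hQ hSα.nonempty, supertile_translate, hra]
  · rw [K.render_union hQ hQ' hcQ hcan.1, onSupertile_render hK hU.overT hcQ hU.nonempty]

theorem simulatesAtScale (hK : K.Fits 𝒯) : SimulatesAtScale (K.simulator 𝒯 hK) 𝒯 K.side :=
  ⟨side_pos, K.reading 𝒯, equivalentProductions hK, follows hK, weaklyModels hK⟩

end Kit

end TwoHAM

end

/-! ### Codes, the scale, and the number and size of the added supertiles -/

noncomputable section

namespace TwoHAM

open Assembly Relation

/-! ### Codes for the glues of a system -/

/-- The glues of the tiles in `T`. -/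
def glues (T : Finset TileType) : Set Glue := {g | ∃ t ∈ T, ∃ d, g = t d}

/-- The dimension of square arrays of bits that can code the glues of `n` tiles. -/
def codeDim (n : ℕ) : ℕ := Nat.sqrt (Nat.log 2 (4 * n)) + 1

theorem le_two_pow_codeDim (n : ℕ) : 4 * n ≤ 2 ^ (codeDim n * codeDim n) :=
  (Nat.lt_pow_succ_log_self one_lt_two _).le.trans
    (Nat.pow_le_pow_right two_pos (Nat.lt_succ_sqrt _))

theorem exists_code (T : Finset TileType) :
    ∃ e : Glue → Fin (codeDim T.card) × Fin (codeDim T.card) → Bool, Set.InjOn e (glues T) := by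
  classical
  let L : Finset Glue := (T ×ˢ (Finset.univ : Finset Side)).image fun x => x.1 x.2
  have hL : ∀ {g}, g ∈ glues T ↔ g ∈ L := by
    intro g
    simp only [glues, L, Set.mem_ofPred_eq, Finset.mem_image, Finset.mem_product, Finset.mem_univ,
      and_true, Prod.exists]
    constructor
    · rintro ⟨t, ht, d, rfl⟩; exact ⟨t, d, ht, rfl⟩
    · rintro ⟨t, d, ht, rfl⟩; exact ⟨t, ht, d, rfl⟩
  have hc : L.card ≤ 4 * T.card := by
    refine Finset.card_image_le.trans ?_
    rw [Finset.card_product, mul_comm]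
    exact le_rfl
  obtain ⟨f⟩ : Nonempty ({g // g ∈ L} ↪ (Fin (codeDim T.card) × Fin (codeDim T.card) → Bool)) := by
    refine Function.Embedding.nonempty_of_card_le ?_
    rw [Fintype.card_coe, Fintype.card_fun, Fintype.card_bool, Fintype.card_prod, Fintype.card_fin]
    exact hc.trans (le_two_pow_codeDim _)
  refine ⟨fun g => if h : g ∈ L then f ⟨g, h⟩ else fun _ => false, fun g hg g' hg' h => ?_⟩
  rw [hL] at hg hg'
  simp only [dif_pos hg, dif_pos hg'] at h
  exact congrArg Subtype.val (f.injective h)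

/-- The bits of a lock that codes `A`: a fixed row that determines the position, and the bits of
the code together with their complements. -/
def lockBit {r : ℕ} (e : Glue → Fin r × Fin r → Bool) (A : Glue) (x i : ℤ) : Prop :=
  (i = 1 → x ≠ 1) ∧ ∀ c d : Fin r, i = d + 2 →
    (x = 2 * c + 1 → e A (c, d) = true) ∧ (x = 2 * c + 2 → e A (c, d) = false)

/-- The parameters for a system with the tiles `T` and temperature `τ`. -/
def kit (T : Finset TileType) (τ : ℕ) (hτ : 2 ≤ τ) : Kit where
  τ := τ
  two_le := hτ
  w := 2 * codeDim T.card + 2 * Nat.sqrt τ + 4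
  H := codeDim T.card + 2
  three_le_w := by omega
  two_le_H := by omega
  labels := glues T
  bit := lockBit (exists_code T).choose
  bit_zero A x := ⟨by omega, fun c d h => by omega⟩
  bit_one A x := ⟨fun h => h.1 rfl, fun h => ⟨fun _ => h, fun c d h => by omega⟩⟩
  separated A hA B hB h := by
    refine (exists_code T).choose_spec hA hB (funext fun ⟨c, d⟩ => ?_)
    have hc := c.2
    have hd := d.2
    have key (b : Bool) (hA : (exists_code T).choose A (c, d) = b) :
        (exists_code T).choose B (c, d) = b := by
      -- Exactly one of the columns `2 * c + 1` and `2 * c + 2` is set in row `d + 2`, according to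
      -- the value of the bit. The test uses the one that is set for `A`.
      have := h (2 * c + if b then 1 else 2) (d + 2) (by split_ifs <;> omega)
        (by split_ifs <;> omega) (by omega) (by omega) ⟨by omega, fun c' d' h' => ?_⟩
      · cases b
        · exact (this.2 c d rfl).2 rfl
        · exact (this.2 c d rfl).1 rfl
      · obtain rfl : d = d' := Fin.ext (by omega)
        cases b
        · simp only [Bool.false_eq_true, if_false]
          refine ⟨by omega, fun h => ?_⟩
          obtain rfl : c = c' := Fin.ext (by omega)
          exact hA
        · simp only [if_true]
          refine ⟨fun h => ?_, by omega⟩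
          obtain rfl : c = c' := Fin.ext (by omega)
          exact hA
    exact (key _ rfl).symm
  capacity n hn := by
    have hv : 0 < Nat.sqrt τ := Nat.sqrt_pos.2 (by omega)
    have h1 : n % Nat.sqrt τ < Nat.sqrt τ := Nat.mod_lt _ hv
    -- With `v = √τ` rounded down, `n ≤ τ ≤ v * v + 2 * v < (v + 3) * v`. So at most `2 * v + 1`
    -- columns are used, which is less than the width.
    have h2 : n / Nat.sqrt τ < Nat.sqrt τ + 3 := by
      rw [Nat.div_lt_iff_lt_mul hv]
      have h3 := Nat.sqrt_le_add τ
      have h4 : n ≤ τ := by omega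
      nlinarith
    push_cast
    omega

theorem kit_fits (𝒯 : TAS) (h : 2 ≤ 𝒯.temp) : (kit 𝒯.tiles 𝒯.temp h).Fits 𝒯 := ⟨rfl, rfl⟩

theorem side_kit (T : Finset TileType) (τ : ℕ) (hτ : 2 ≤ τ) :
    (kit T τ hτ).side = 24 * codeDim T.card + 12 * Nat.sqrt τ + 46 := by
  simp only [Kit.side, Kit.M, kit]
  omega

theorem side_kit_le (T : Finset TileType) (τ : ℕ) (hτ : 2 ≤ τ) :
    ((kit T τ hτ).side : ℝ) ≤ 130 * Real.sqrt (Real.log (T.card : ℝ) + (τ : ℝ)) := by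
  have h2 : (2 : ℝ) ≤ τ := by exact_mod_cast hτ
  have hlog : 0 ≤ Real.log (T.card : ℝ) := Real.log_natCast_nonneg _
  have hS := Real.sqrt_nonneg (Real.log (T.card : ℝ) + (τ : ℝ))
  have hS2 := Real.sq_sqrt (show 0 ≤ Real.log (T.card : ℝ) + (τ : ℝ) by linarith)
  set S := Real.sqrt (Real.log (T.card : ℝ) + (τ : ℝ)) with hSdef
  have hS1 : 1 ≤ S := by nlinarith
  -- The factor 2 stands for `1 / log 2`, as `log 2 > 1 / 2`.
  have hL : (Nat.log 2 (4 * T.card) : ℝ) ≤ 2 + 2 * Real.log (T.card : ℝ) := by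
    rcases Nat.eq_zero_or_pos T.card with h0 | h0
    · simp [h0]
    · have h1 : (2 : ℝ) ^ Nat.log 2 (4 * T.card) ≤ 4 * T.card := by
        exact_mod_cast Nat.pow_log_le_self 2 (by omega : 4 * T.card ≠ 0)
      have hT : (0 : ℝ) < T.card := by exact_mod_cast h0
      have h3 := Real.log_le_log (by positivity) h1
      rw [Real.log_pow, Real.log_mul (by norm_num) hT.ne', show (4 : ℝ) = 2 ^ 2 by norm_num,
        Real.log_pow] at h3
      have h4 := Real.log_two_gt_d9
      push_cast at h3
      nlinarith
  have hr : (Nat.sqrt (Nat.log 2 (4 * T.card)) : ℝ) ≤ 2 * S := by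
    have h1 : (Nat.sqrt (Nat.log 2 (4 * T.card)) : ℝ) ^ 2 ≤ Nat.log 2 (4 * T.card) := by
      exact_mod_cast Nat.sqrt_le' _
    exact le_of_sq_le_sq (by nlinarith) (by positivity)
  have hv : (Nat.sqrt τ : ℝ) ≤ S := by
    have h1 : (Nat.sqrt τ : ℝ) ^ 2 ≤ τ := by exact_mod_cast Nat.sqrt_le' _
    exact le_of_sq_le_sq (by nlinarith) hS
  -- The bounds give `24 * (2 * S + 1) + 12 * S + 46 = 60 * S + 70`, which is at most `130 * S`
  -- because `1 ≤ S`.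
  rw [side_kit, codeDim]
  push_cast
  linarith

/-! ### The number and the size of the initial supertiles -/

namespace Kit

variable (K : Kit) (𝒯 : TAS)

theorem encard_padSupertiles_le : (K.padSupertiles 𝒯).encard ≤ 8 * (𝒯.tiles.card : ℕ∞) := by
  classical
  have : K.padSupertiles 𝒯 ⊆ ↑(((Finset.univ : Finset (Bool × Bool × Bool)) ×ˢ 𝒯.tiles).image
      fun x => (K.asm (.pad x.1.1 x.1.2.1 x.1.2.2
        (x.2 (padSide x.1.1 x.1.2.2)))).supertile) := by
    rintro s ⟨a, k, j, t, ht, rfl⟩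
    rw [Finset.mem_coe, Finset.mem_image]
    exact ⟨((a, k, j), t), Finset.mem_product.2 ⟨Finset.mem_univ _, ht⟩, rfl⟩
  refine (Set.encard_le_encard this).trans ?_
  rw [Set.encard_coe_eq_coe_finsetCard]
  have h := Finset.card_image_le (s := (Finset.univ : Finset (Bool × Bool × Bool)) ×ˢ 𝒯.tiles)
    (f := fun x => (K.asm (.pad x.1.1 x.1.2.1 x.1.2.2
        (x.2 (padSide x.1.1 x.1.2.2)))).supertile)
  rw [Finset.card_product] at h
  exact_mod_cast h

/-- Translates of an assembly have translated sets of full pads and hence the same macro supertile,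
so one representative per initial supertile suffices. -/
theorem encard_macroSupertiles_le : (K.macroSupertiles 𝒯).encard ≤ 𝒯.init.encard := by
  classical
  let f (s : Supertile) : Supertile :=
    if h : ∃ β : Assembly, s = β.supertile then
      (K.render h.choose (fullPads h.choose)).supertile else ∅
  refine le_trans (Set.encard_le_encard ?_) (Set.encard_image_le f 𝒯.init)
  rintro _ ⟨β, hβ, rfl⟩
  refine ⟨_, hβ, ?_⟩
  have h : ∃ γ : Assembly, β.supertile = γ.supertile := ⟨β, rfl⟩
  simp only [f]
  rw [dif_pos h]
  obtain ⟨v, hv⟩ := exists_translate_of_supertile_eq h.choose_spec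
  conv_rhs => rw [hv, fullPads_translate, ← K.render_translate (fullPads_consistent _),
    supertile_translate]

theorem encard_le : (K.padSupertiles 𝒯 ∪ K.macroSupertiles 𝒯).encard ≤
    ((8 : ℕ) : ℕ∞) * ((𝒯.tiles.card : ℕ∞) + 𝒯.init.encard) := by
  refine (Set.encard_union_le _ _).trans ?_
  rw [mul_add]
  refine add_le_add (K.encard_padSupertiles_le 𝒯) ((K.encard_macroSupertiles_le 𝒯).trans ?_)
  exact le_mul_of_one_le_left' (by norm_num)

theorem finite_translate {α : Assembly} (h : α.dom.Finite) (u : ℤ × ℤ) :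
    (α.translate u).dom.Finite := by
  refine (h.image (· + u)).subset fun p hp => ?_
  exact ⟨p - u, mem_dom_translate.1 hp, sub_add_cancel _ _⟩

theorem isFiniteSupertile {α : Assembly} (h : α.dom.Finite) : IsFiniteSupertile α.supertile := by
  rintro _ ⟨u, rfl⟩
  exact finite_translate h u

variable {𝒯}

theorem render_finite {β : Assembly} (P : PadSet) (h : β.dom.Finite) :
    (K.render β P).dom.Finite := by
  -- The default tile plays no role, as `q` ranges over occupied positions only. Each of them owns
  -- at most one body and eight pads.
  let t (q : ℤ × ℤ) : TileType := (β q).elim (fun _ => kindGlue 0 none) id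
  let F (q : ℤ × ℤ) (o : Option (Bool × Bool × Bool)) : Piece × ℤ × ℤ :=
    o.elim (.body (t q), q) fun z => (.pad z.1 z.2.1 z.2.2 (t q (padSide z.1 z.2.2)),
      if z.2.2 then q - (plus z.1).vec else q)
  refine Set.Finite.subset (Set.Finite.biUnion h fun q _ => Set.finite_iUnion fun o =>
    (finite_translate (K.asm_finite (F q o).1) (scale (2 * K.M) (F q o).2))) fun p hp => ?_
  obtain ⟨s, hs⟩ := mem_dom_iff.1 hp
  obtain ⟨⟨π, q⟩, hx, hxp⟩ := K.exists_placed hs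
  simp only [Set.mem_iUnion]
  rcases hx with ⟨t', h1, h2⟩ | ⟨a, k, j, t', h1, h2, h3⟩ <;> simp only at h1 h2 <;> subst h1
  · refine ⟨q, mem_dom_of_eq h2, none, mem_dom_of_eq (t := s) ?_⟩
    simpa [F, t, h2, placedAsm] using hxp
  · refine ⟨owner q a j, mem_dom_of_eq h3, some (a, k, j), mem_dom_of_eq (t := s) ?_⟩
    have e : (if j = true then owner q a j - (plus a).vec else owner q a j) = q := by
      cases j <;> simp [owner]
    simp only [F, t, h3, Option.elim_some, id]
    rw [e]
    exact hxp

theorem isFinite_of_init (h : ∀ s ∈ 𝒯.init, IsFiniteSupertile s) :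
    ∀ s ∈ K.padSupertiles 𝒯 ∪ K.macroSupertiles 𝒯, IsFiniteSupertile s := by
  rintro s (⟨a, k, j, t, -, rfl⟩ | ⟨β, hβ, rfl⟩)
  · exact isFiniteSupertile (K.asm_finite _)
  · exact isFiniteSupertile (K.render_finite _ (h _ hβ _ (mem_supertile_self β)))

end Kit

end TwoHAM

end

theorem mainTheorem11 :
    ∃ K C : ℕ, ∃ c : ℝ, ∀ τ : ℕ, 2 ≤ τ →
      ∃ U : Finset TwoHAM.TileType, U.card ≤ K ∧
        ∀ 𝒯 : TwoHAM.TAS, 𝒯.temp = τ →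
          ∃ (I : Set TwoHAM.Supertile) (𝒰 : TwoHAM.TAS) (m : ℕ),
            I.encard ≤ (C : ℕ∞) * ((𝒯.tiles.card : ℕ∞) + 𝒯.init.encard) ∧
            ((∀ s ∈ 𝒯.init, TwoHAM.IsFiniteSupertile s) →
              ∀ s ∈ I, TwoHAM.IsFiniteSupertile s) ∧
            𝒰.tiles = U ∧ 𝒰.init = TwoHAM.tileSupertiles U ∪ I ∧ 𝒰.temp = τ ∧
            TwoHAM.SimulatesAtScale 𝒰 𝒯 m ∧
            (m : ℝ) ≤ c * Real.sqrt (Real.log (𝒯.tiles.card : ℝ) + (τ : ℝ)) := by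
  refine ⟨Fintype.card (TwoHAM.Side → TwoHAM.GlueKind), 8, 130, fun τ hτ =>
    ⟨TwoHAM.universalTiles τ, TwoHAM.card_universalTiles_le τ, ?_⟩⟩
  rintro 𝒯 rfl
  have hK := TwoHAM.kit_fits 𝒯 hτ
  set K := TwoHAM.kit 𝒯.tiles 𝒯.temp hτ
  exact ⟨K.padSupertiles 𝒯 ∪ K.macroSupertiles 𝒯, K.simulator 𝒯 hK, K.side, K.encard_le 𝒯,
    K.isFinite_of_init, rfl, rfl, rfl, TwoHAM.Kit.simulatesAtScale hK,
    TwoHAM.side_kit_le 𝒯.tiles 𝒯.temp hτ⟩
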